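/- **Setting.** Let $\eta=\mathrm{diag}(1,-1,-1,-1)$, $\Box=\partial_\mu\partial^\mu$, let $V^{\pm}$ be the closed forward/backward light cones, and let $D_\lambda^{(+)}(x)=\frac{i}{(2\pi)^3}\int\frac{d^3p}{2\omega}\,e^{-i\omega x^0+i\mathbf p\cdot\mathbf x}$, $\omega=\sqrt{|\mathbf p|^2+\lambda^2}$, be the positive-frequency part of the Pauli–Jordan distribution of mass $\lambda$; put $D_\lambda^{(-)}(x)=-D_\lambda^{(+)}(-x)$ and let $D_\lambda^{F}=\theta(x^0)D_\lambda^{(+)}-\theta(-x^0)D_\lambda^{(-)}$ be the Feynman propagator, $(\Box+\lambda^2)D^F_\lambda=\delta$. For a real function $\rho$ integrable on $(0,\infty)$ put $D^{(+)}=\int_0^\infty\rho(\lambda)D_\lambda^{(+)}d\lambda$ and $D^{F}=\int_0^\infty\rho(\lambda)D_\lambda^{F}d\lambda$ (the off-shell distributions). Let $v_a^\mu$ (Bose) and $u_a,\tilde u_a$ (Fermi), $a=1,\dots,r$, be the generalized free fields whose $n$-point functions are generated by Wick's theorem from the non-zero two-point functions $$\langle\Omega,v_a^\mu(x)v_b^\nu(y)\Omega\rangle=i\,\delta_{ab}\eta^{\mu\nu}D^{(+)}(x-y),\quad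 \langle\Omega,u_a(x)\tilde u_b(y)\Omega\rangle=-i\,\delta_{ab}D^{(+)}(x-y),\quad \langle\Omega,\tilde u_a(x)u_b(y)\Omega\rangle=i\,\delta_{ab}D^{(+)}(x-y),$$ with $v^\dagger=v$, $u^\dagger=u$, $\tilde u^\dagger=-\tilde u$. They act on the (indefinite-metric) space spanned by the vectors $\phi_1(g_1)\cdots\phi_n(g_n)\Omega$; operators are identified with their matrix elements between such vectors. The gauge charge $Q=Q^\dagger$ is defined by $[Q,v_a^\mu]=i\partial^\mu u_a$, $\{Q,u_a\}=0$, $\{Q,\tilde u_a\}=-i\partial_\mu v_a^\mu$, $Q\Omega=0$, and $d_Q=[Q,\cdot]$ is the graded commutator. Let $f_{abc}$ be completely antisymmetric constants, $F_a^{\mu\nu}=\partial^\mu v_a^\nu-\partial^\nu v_a^\mu$, and define the Wick polynomials (normal products and sums over repeated indices understood) $$T=f_{abc}\big(\tfrac12 v_{a\mu}v_{b\nu}F_c^{\nu\mu}+u_av_b^\mu\partial_\mu\tilde u_c\big),\quad T^\mu=f_{abc}\big(u_av_{b\nu}F_c^{\nu\mu}-\tfrac12u_au_b\partial^\mu\tilde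 u_c\big),\quad T^{\mu\nu}=\tfrac12f_{abc}u_au_bF_c^{\mu\nu},$$ $$S=i f_{abc}\big(u_av_b^\mu\,\Box v_{c\mu}+\tfrac12u_au_b\,\Box\tilde u_c\big),\qquad S^\mu=\tfrac i2f_{abc}u_au_b\,\Box v_c^\mu,$$ with $T^\emptyset=T$, $S^\emptyset=S$, $T^I=0$ for $|I|>2$ and $S^I=0$ for $|I|>1$. For Wick polynomials $A,B$ the tree part of $A(x)B(y)$ is the sum of the terms of its Wick expansion with exactly one contraction. A tree-level chronological product of $A(x),B(y)$ (of Fermi parities $p,q$) is an operator-valued distribution $\mathbf T(A(x),B(y))$ such that, for some splitting $[A(x),B(y)]^{\rm tree}=\mathrm{Adv}-\mathrm{Ret}$ of the graded commutator with $\mathrm{Adv}$ supported in $x-y\in V^+$ and $\mathrm{Ret}$ in $x-y\in V^-$, $$\mathbf T(A(x),B(y))=\mathrm{Adv}+(-1)^{pq}(B(y)A(x))^{\rm tree}=\mathrm{Ret}+(A(x)B(y))^{\rm tree}.$$ **Theorem.** The tree-level second-order chronological products can be chosen — namely by replacing, in the single-contraction terms, $D^{(+)}$ by the off-shell Feynman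 propagator $D^{F}$; this does give chronological products for all Wick polynomials $A,B$ of definite Fermi parity — such that, with $T^{I_1,I_2}(x,y)=\mathbf T(T^{I_1}(x),T^{I_2}(y))$, for all multi-indices $I_1,I_2$, in the sense of distributions, $$d_QT^{I_1,I_2}(x,y)=i\frac{\partial}{\partial x^\mu}T^{I_1\mu,I_2}(x,y)+i(-1)^{|I_1|}\frac{\partial}{\partial y^\mu}T^{I_1,I_2\mu}(x,y)+\mathbf T(S^{I_1}(x),T^{I_2}(y))+(-1)^{|I_1|}\,\mathbf T(T^{I_1}(x),S^{I_2}(y)).$$ -/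

import Mathlib

open scoped SchwartzMap LineDeriv

noncomputable section

namespace OffShellYM

/-! ### Minkowski space -/

/-- Minkowski space with coordinates `x 0` (time), `x 1`, `x 2`, `x 3`. The Euclidean norm is used
only for topology and Lebesgue measure. -/
abbrev Spacetime : Type := EuclideanSpace ℝ (Fin 4)

/-- Three-dimensional space (positions and momenta). -/
abbrev Space : Type := EuclideanSpace ℝ (Fin 3)

/-- The point with time coordinate `t` and position `x`. -/
def event (t : ℝ) (x : Space) : Spacetime := WithLp.toLp 2 (Fin.cons t x.ofLp)

/-- The coordinate vector `e_μ`. -/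
def basisVec (μ : Fin 4) : Spacetime := EuclideanSpace.single μ 1

/-- Diagonal entries of the Minkowski metric `diag(1,-1,-1,-1)`. -/
def metric (μ : Fin 4) : ℂ := if μ = 0 then 1 else -1

/-- The Minkowski square `ξ² = (ξ⁰)² - (ξ¹)² - (ξ²)² - (ξ³)²`. -/
def minkowskiSq (ξ : Spacetime) : ℝ := ξ 0 ^ 2 - ξ 1 ^ 2 - ξ 2 ^ 2 - ξ 3 ^ 2

/-- The closed forward light cone `V⁺`. -/
def forwardCone : Set Spacetime := {ξ | 0 ≤ minkowskiSq ξ ∧ 0 ≤ ξ 0}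

/-- The closed backward light cone `V⁻`. -/
def backwardCone : Set Spacetime := {ξ | 0 ≤ minkowskiSq ξ ∧ ξ 0 ≤ 0}

/-! ### Propagators

All of them are given by their values on test functions `g` on `Spacetime`. -/

/-- The relativistic energy `ω = √(|p|² + λ²)`. -/
def energy (lam : ℝ) (p : Space) : ℝ := Real.sqrt (‖p‖ ^ 2 + lam ^ 2)

/-- The distribution
`i (2π)⁻³ ∫ d³p / (2ω(p)) exp(-i ω(p) τ(t) + i p·x)`
of mass `lam`, evaluated on `g`. For `τ(t) = t` this is the positive frequency part
`D_λ⁽⁺⁾` of the Pauli-Jordan distribution; for `τ(t) = |t|` it is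
`θ(t) D_λ⁽⁺⁾ - θ(-t) D_λ⁽⁻⁾`, i.e. the Feynman propagator `D_λ^F`, `(□ + λ²) D_λ^F = δ`
(where `D_λ⁽⁻⁾(x) = - D_λ⁽⁺⁾(-x)`). -/
def massKernel (τ : ℝ → ℝ) (lam : ℝ) (g : Spacetime → ℂ) : ℂ :=
  Complex.I / (2 * (Real.pi : ℂ)) ^ 3 *
    ∫ t : ℝ, ∫ p : Space,
      Complex.exp (-Complex.I * ((energy lam p * τ t : ℝ) : ℂ)) / ((2 * energy lam p : ℝ) : ℂ) *
        ∫ x : Space, Complex.exp (Complex.I * ((inner ℝ p x : ℝ) : ℂ)) * g (event t x)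

/-- `D^{off,(+)} = ∫ dλ ρ(λ) D_λ⁽⁺⁾`. -/
def offShellPlus (ρ : ℝ → ℝ) (g : Spacetime → ℂ) : ℂ :=
  ∫ lam in Set.Ioi (0 : ℝ), (ρ lam : ℂ) * massKernel (fun t => t) lam g

/-- `D^{F,off} = ∫ dλ ρ(λ) D_λ^F`. -/
def offShellFeynman (ρ : ℝ → ℝ) (g : Spacetime → ℂ) : ℂ :=
  ∫ lam in Set.Ioi (0 : ℝ), (ρ lam : ℂ) * massKernel (fun t => |t|) lam g

/-! ### The fields -/

/-- The basic fields: `v_a^μ` (Bose), the ghosts `u_a` and `ũ_a` (Fermi), `a = 1, …, r`. -/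
inductive Field (r : ℕ) : Type
  | v (a : Fin r) (μ : Fin 4)
  | u (a : Fin r)
  | ut (a : Fin r)

/-- Statistics: `0` for Bose and `1` for Fermi fields. -/
def Field.parity {r : ℕ} : Field r → ℕ
  | .v _ _ => 0
  | .u _ => 1
  | .ut _ => 1

/-- The coefficients `c` in `⟨Ω, φ(x) ψ(y) Ω⟩ = c(φ,ψ) D⁽⁺⁾(x - y)`. -/
def twoPointCoeff {r : ℕ} : Field r → Field r → ℂ
  | .v a μ, .v b ν => if a = b ∧ μ = ν then Complex.I * metric μ else 0
  | .u a, .ut b => if a = b then -Complex.I else 0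
  | .ut a, .u b => if a = b then Complex.I else 0
  | _, _ => 0

/-- A field smeared with a real test function. -/
structure Smeared (r : ℕ) : Type where
  field : Field r
  test : 𝓢(Spacetime, ℝ)

/-- A derivative `∂_{α₁} ⋯ ∂_{αₖ} φ` of a basic field (lower derivative indices). -/
structure Jet (r : ℕ) : Type where
  field : Field r
  der : List (Fin 4)

/-- A factor in a vacuum expectation value: a smeared field, or a factor located at the point `x`
or `y` of one normal product `: ⋯ :`. -/
inductive Letter (r : ℕ) : Type
  | smeared (s : Smeared r)
  | atX (j : Jet r)
  | atY (j : Jet r)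

def Letter.parity {r : ℕ} : Letter r → ℕ
  | .smeared s => s.field.parity
  | .atX j => j.field.parity
  | .atY j => j.field.parity

/-- Iterated partial derivative of a real test function. -/
def testDeriv (α : List (Fin 4)) (g : 𝓢(Spacetime, ℝ)) : 𝓢(Spacetime, ℝ) :=
  α.foldr (fun μ k => ∂_{basisVec μ} k) g

/-- `⟨Ω, φ(f) ψ(g) Ω⟩`. -/
def pairSmeared {r : ℕ} (ρ : ℝ → ℝ) (s s' : Smeared r) : ℂ :=
  twoPointCoeff s.field s'.field *
    offShellPlus ρ (fun ξ => ∫ z, (s.test (z + ξ) : ℂ) * (s'.test z : ℂ))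

/-- `⟨Ω, φ(f) ∂^α ψ(x) Ω⟩ = c ∂_x^α ∫ D⁽⁺⁾(z - x) f(z) dz`. -/
def pairSmearedJet {r : ℕ} (ρ : ℝ → ℝ) (s : Smeared r) (j : Jet r) (x : Spacetime) : ℂ :=
  twoPointCoeff s.field j.field * offShellPlus ρ (fun ξ => (testDeriv j.der s.test (x + ξ) : ℂ))

/-- `⟨Ω, ∂^α φ(x) ψ(g) Ω⟩ = c ∂_x^α ∫ D⁽⁺⁾(x - z) g(z) dz`. -/
def pairJetSmeared {r : ℕ} (ρ : ℝ → ℝ) (j : Jet r) (x : Spacetime) (s : Smeared r) : ℂ :=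
  twoPointCoeff j.field s.field * offShellPlus ρ (fun ξ => (testDeriv j.der s.test (x - ξ) : ℂ))

/-- The two-point contraction of two factors. Factors of the same normal product are not
contracted with each other. -/
def contraction {r : ℕ} (ρ : ℝ → ℝ) (x y : Spacetime) : Letter r → Letter r → ℂ
  | .smeared s, .smeared s' => pairSmeared ρ s s'
  | .smeared s, .atX j => pairSmearedJet ρ s j x
  | .smeared s, .atY j => pairSmearedJet ρ s j y
  | .atX j, .smeared s => pairJetSmeared ρ j x s
  | .atY j, .smeared s => pairJetSmeared ρ j y s
  | _, _ => 0

/-- The vacuum expectation value of a product of factors with two-point function `W`, by Wick's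
theorem: the first factor is contracted with each of the others, with the Fermi sign, and the
remaining factors are treated in the same way. -/
def vev {r : ℕ} (W : Letter r → Letter r → ℂ) : List (Letter r) → ℂ
  | [] => 1
  | l :: ls =>
    ∑ k : Fin ls.length,
      (-1 : ℂ) ^ ((ls.get k).parity * ((ls.take k).map Letter.parity).sum) *
        W l (ls.get k) * vev W (ls.eraseIdx k)
termination_by ls => ls.length
decreasing_by
  simp only [List.length_cons]
  have := List.length_eraseIdx_le ls k
  omega

/-! ### States and the gauge charge -/

/-- The states `φ₁(f₁) ⋯ φₙ(fₙ) Ω` and their linear combinations: the word `[φ₁(f₁), …, φₙ(fₙ)]`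
stands for that vector. (Null vectors of the form are not divided out: operators enter only
through their matrix elements.) -/
abbrev State (r : ℕ) : Type := List (Smeared r) →₀ ℂ

/-- `[Q, φ(f)}` on the generators: `[Q, v^μ] = i ∂^μ u`, `{Q, u} = 0`,
`{Q, ũ} = - i ∂_μ v^μ`, with the derivatives transferred to the test function. -/
def chargeOnField {r : ℕ} : Smeared r → (Smeared r →₀ ℂ)
  | ⟨.v a μ, g⟩ => Finsupp.single ⟨.u a, ∂_{basisVec μ} g⟩ (-Complex.I * metric μ)
  | ⟨.u _, _⟩ => 0
  | ⟨.ut a, g⟩ => ∑ μ : Fin 4, Finsupp.single ⟨.v a μ, ∂_{basisVec μ} g⟩ Complex.I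

/-- `Q φ₁(f₁) ⋯ φₙ(fₙ) Ω`: `Q` is commuted to the right until it hits the vacuum, `Q Ω = 0`. -/
def chargeOnWord {r : ℕ} : List (Smeared r) → State r
  | [] => 0
  | s :: w => (chargeOnField s).mapDomain (fun s' => s' :: w) +
      (-1 : ℂ) ^ s.field.parity • (chargeOnWord w).mapDomain (fun w' => s :: w')

/-- The gauge charge `Q`. -/
def charge {r : ℕ} (ψ : State r) : State r := ψ.sum fun w c => c • chargeOnWord w

/-! ### Operators and operator-valued distributions -/

/-- An operator, given by its matrix elements `⟨ψ, X ψ'⟩`. -/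
abbrev Op (r : ℕ) : Type := State r → State r → ℂ

/-- The sign in `(φ₁(f₁) ⋯ φₙ(fₙ))† = ± φₙ(fₙ) ⋯ φ₁(f₁)`: the fields `v, u` are
self-adjoint and `ũ† = -ũ`. -/
def adjointSign {r : ℕ} : List (Smeared r) → ℂ
  | [] => 1
  | ⟨.v _ _, _⟩ :: w => adjointSign w
  | ⟨.u _, _⟩ :: w => adjointSign w
  | ⟨.ut _, _⟩ :: w => -adjointSign w

/-- The matrix elements `⟨ψ, : A(x) B(y) : ψ'⟩` of the normal product of the field monomials `A`
(at `x`) and `B` (at `y`). -/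
def normalProduct {r : ℕ} (ρ : ℝ → ℝ) (A B : List (Jet r)) (x y : Spacetime) : Op r :=
  fun ψ ψ' => ψ.sum fun w c => ψ'.sum fun w' c' =>
    (starRingEnd ℂ) c * c' * (adjointSign w *
      vev (contraction ρ x y)
        (w.reverse.map Letter.smeared ++ A.map Letter.atX ++ B.map Letter.atY ++
          w'.map Letter.smeared))

/-- Distributions in two variables `x, y` with operator values, as maps on test functions
(only the values on test functions matter). -/
abbrev OpDist (r : ℕ) : Type := (Spacetime × Spacetime → ℂ) → Op r

/-- Test functions: smooth with compact support. -/
def IsTest (h : Spacetime × Spacetime → ℂ) : Prop :=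
  ContDiff ℝ (⊤ : ℕ∞) h ∧ HasCompactSupport h

/-- Equality as operator-valued distributions. -/
def DistEq {r : ℕ} (X Y : OpDist r) : Prop := ∀ h, IsTest h → X h = Y h

/-- Partial derivative of a function of `(x, y)` with respect to `x^μ`. -/
def dX (μ : Fin 4) (h : Spacetime × Spacetime → ℂ) : Spacetime × Spacetime → ℂ :=
  fun z => fderiv ℝ h z (basisVec μ, 0)

/-- Partial derivative of a function of `(x, y)` with respect to `y^μ`. -/
def dY (μ : Fin 4) (h : Spacetime × Spacetime → ℂ) : Spacetime × Spacetime → ℂ :=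
  fun z => fderiv ℝ h z (0, basisVec μ)

/-- The distributional derivative `∂/∂x^μ`. -/
def distDX {r : ℕ} (μ : Fin 4) (X : OpDist r) : OpDist r := fun h => -X (dX μ h)

/-- The distributional derivative `∂/∂y^μ`. -/
def distDY {r : ℕ} (μ : Fin 4) (X : OpDist r) : OpDist r := fun h => -X (dY μ h)

/-- `d_Q X = [Q, X] = Q X - (-1)^p X Q` for an operator of parity `p`, with `Q† = Q`. -/
def gaugeComm {r : ℕ} (p : ℕ) (X : OpDist r) : OpDist r :=
  fun h ψ ψ' => X h (charge ψ) ψ' - (-1 : ℂ) ^ p * X h ψ (charge ψ')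

/-- The distribution supported in `{(x,y) | x - y ∈ K}`. -/
def SupportedIn {r : ℕ} (X : OpDist r) (K : Set Spacetime) : Prop :=
  ∀ h, IsTest h → (∀ z ∈ tsupport h, z.1 - z.2 ∉ K) → X h = 0

/-! ### Wick polynomials and tree contributions -/

/-- Wick polynomials: linear combinations of words, the word `[φ₁, …, φₙ]` standing for the
Wick monomial `: φ₁ ⋯ φₙ :` of (derivatives of) fields. -/
abbrev WickPoly (r : ℕ) : Type := List (Jet r) →₀ ℂ

def wordParity {r : ℕ} (w : List (Jet r)) : ℕ := (w.map fun j => j.field.parity).sum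

/-- All monomials have Fermi parity `p` mod 2. -/
def HasParity {r : ℕ} (A : WickPoly r) (p : ℕ) : Prop :=
  ∀ w ∈ A.support, wordParity w ≡ p [MOD 2]

/-- `⟨∂_x^α ∂_y^β P(x - y), H(x, y)⟩` for a distribution `P` on `Spacetime`. -/
def pairDifference (P : (Spacetime → ℂ) → ℂ) (α β : List (Fin 4))
    (H : Spacetime × Spacetime → ℂ) : ℂ :=
  (-1 : ℂ) ^ (α.length + β.length) *
    P (fun ξ => ∫ y, (α.foldr dX (β.foldr dY H)) (y + ξ, y))

/-- The sum over all single contractions between a factor of the monomial `A` at `x` and a factor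
of the monomial `B` at `y`, where `φ(x)`, `ψ(y)` contract to `c(φ,ψ) P(x - y)`; the remaining
factors form a normal product. The sign comes from moving the contracted factors together. -/
def treeOnWords {r : ℕ} (ρ : ℝ → ℝ) (P : (Spacetime → ℂ) → ℂ) (A B : List (Jet r)) : OpDist r :=
  fun h ψ ψ' => ∑ m : Fin A.length, ∑ n : Fin B.length,
    (-1 : ℂ) ^ ((A.get m).field.parity * wordParity (A.drop (m + 1)) +
        (B.get n).field.parity * wordParity (B.take n)) *
      twoPointCoeff (A.get m).field (B.get n).field *
      pairDifference P (A.get m).der (B.get n).der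
        (fun z => h z * normalProduct ρ (A.eraseIdx m) (B.eraseIdx n) z.1 z.2 ψ ψ')

def treeContract {r : ℕ} (ρ : ℝ → ℝ) (P : (Spacetime → ℂ) → ℂ) (A B : WickPoly r) : OpDist r :=
  fun h ψ ψ' => A.sum fun w c => B.sum fun w' c' => c * c' * treeOnWords ρ P w w' h ψ ψ'

/-- The tree part of the operator product `A(x) B(y)`. -/
def treeProduct {r : ℕ} (ρ : ℝ → ℝ) (A B : WickPoly r) : OpDist r :=
  treeContract ρ (offShellPlus ρ) A B

/-- The tree part of the operator product `B(y) A(x)`, as a distribution in `(x, y)`. -/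
def treeProductRev {r : ℕ} (ρ : ℝ → ℝ) (A B : WickPoly r) : OpDist r :=
  fun h => treeProduct ρ B A (fun z => h z.swap)

/-- The tree part of the graded commutator `[A(x), B(y)]` (`p`, `q` the parities of `A`, `B`). -/
def treeCommutator {r : ℕ} (ρ : ℝ → ℝ) (p q : ℕ) (A B : WickPoly r) : OpDist r :=
  fun h ψ ψ' => treeProduct ρ A B h ψ ψ' - (-1 : ℂ) ^ (p * q) * treeProductRev ρ A B h ψ ψ'

/-- `X` is a (tree) chronological product of `A(x)` and `B(y)`: the causal commutator is split as
`D = Adv - Ret` with `supp Adv ⊆ V⁺`, `supp Ret ⊆ V⁻`, and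
`X = Adv ± B(y) A(x) = Ret + A(x) B(y)`. -/
def IsTreeChronologicalProduct {r : ℕ} (ρ : ℝ → ℝ) (p q : ℕ) (A B : WickPoly r)
    (X : OpDist r) : Prop :=
  ∃ Adv Ret : OpDist r,
    DistEq (treeCommutator ρ p q A B) (fun h ψ ψ' => Adv h ψ ψ' - Ret h ψ ψ') ∧
    SupportedIn Adv forwardCone ∧ SupportedIn Ret backwardCone ∧
    DistEq X (fun h ψ ψ' => Adv h ψ ψ' + (-1 : ℂ) ^ (p * q) * treeProductRev ρ A B h ψ ψ') ∧
    DistEq X (fun h ψ ψ' => Ret h ψ ψ' + treeProduct ρ A B h ψ ψ')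

/-! ### The Yang-Mills interaction -/

/-- Complete antisymmetry of the structure constants. -/
def TotallyAntisymmetric {r : ℕ} (f : Fin r → Fin r → Fin r → ℂ) : Prop :=
  (∀ a b c, f b a c = -f a b c) ∧ (∀ a b c, f a c b = -f a b c)

/-- The Wick polynomial `A · F_c^{μν}`, where `F_c^{μν} = ∂^μ v_c^ν - ∂^ν v_c^μ`. -/
def timesFieldStrength {r : ℕ} (A : List (Jet r)) (c : Fin r) (μ ν : Fin 4) : WickPoly r :=
  Finsupp.single (A ++ [⟨.v c ν, [μ]⟩]) (metric μ) -
    Finsupp.single (A ++ [⟨.v c μ, [ν]⟩]) (metric ν)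

/-- The Wick polynomial `A · □φ`, where `□ = ∂_μ ∂^μ` (the Klein-Gordon operator of mass zero). -/
def timesBox {r : ℕ} (A : List (Jet r)) (φ : Field r) : WickPoly r :=
  ∑ μ : Fin 4, Finsupp.single (A ++ [⟨φ, [μ, μ]⟩]) (metric μ)

/-- `T = f_abc (½ v_{aμ} v_{bν} F_c^{νμ} + u_a v_b^μ ∂_μ ũ_c)`. -/
def lagrangian {r : ℕ} (f : Fin r → Fin r → Fin r → ℂ) : WickPoly r :=
  ∑ a, ∑ b, ∑ c, f a b c •
    ((∑ μ, ∑ ν, (1 / 2 * metric μ * metric ν) •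
        timesFieldStrength [⟨.v a μ, []⟩, ⟨.v b ν, []⟩] c ν μ) +
      ∑ μ, Finsupp.single [⟨.u a, []⟩, ⟨.v b μ, []⟩, ⟨.ut c, [μ]⟩] 1)

/-- `T^μ = f_abc (u_a v_{bν} F_c^{νμ} - ½ u_a u_b ∂^μ ũ_c)`. -/
def lagrangian1 {r : ℕ} (f : Fin r → Fin r → Fin r → ℂ) (μ : Fin 4) : WickPoly r :=
  ∑ a, ∑ b, ∑ c, f a b c •
    ((∑ ν, metric ν • timesFieldStrength [⟨.u a, []⟩, ⟨.v b ν, []⟩] c ν μ) -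
      Finsupp.single [⟨.u a, []⟩, ⟨.u b, []⟩, ⟨.ut c, [μ]⟩] (1 / 2 * metric μ))

/-- `T^{μν} = ½ f_abc u_a u_b F_c^{μν}`. -/
def lagrangian2 {r : ℕ} (f : Fin r → Fin r → Fin r → ℂ) (μ ν : Fin 4) : WickPoly r :=
  ∑ a, ∑ b, ∑ c, (1 / 2 * f a b c) • timesFieldStrength [⟨.u a, []⟩, ⟨.u b, []⟩] c μ ν

/-- The polynomials `T^I`. -/
def lagrangianT {r : ℕ} (f : Fin r → Fin r → Fin r → ℂ) : List (Fin 4) → WickPoly r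
  | [] => lagrangian f
  | [μ] => lagrangian1 f μ
  | [μ, ν] => lagrangian2 f μ ν
  | _ => 0

/-- The polynomials `S^I` in `d_Q T^I = i ∂_μ T^{Iμ} + S^I`:
`S = i f_abc (u_a v_b^μ □v_{cμ} + ½ u_a u_b □ũ_c)`, `S^μ = (i/2) f_abc u_a u_b □v_c^μ`, and
`S^I = 0` for `|I| > 1`. -/
def offShellS {r : ℕ} (f : Fin r → Fin r → Fin r → ℂ) : List (Fin 4) → WickPoly r
  | [] => ∑ a, ∑ b, ∑ c, (Complex.I * f a b c) •
      ((∑ μ, metric μ • timesBox [⟨.u a, []⟩, ⟨.v b μ, []⟩] (.v c μ)) +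
        (1 / 2 : ℂ) • timesBox [⟨.u a, []⟩, ⟨.u b, []⟩] (.ut c))
  | [μ] => ∑ a, ∑ b, ∑ c, (Complex.I / 2 * f a b c) •
      timesBox [⟨.u a, []⟩, ⟨.u b, []⟩] (.v c μ)
  | _ => 0

end OffShellYM

end

open scoped SchwartzMap LineDeriv

noncomputable section

namespace OffShellYM

open MeasureTheory

/-! ### Signed sums over the factors of a word -/

section Words

variable {X : Type*} (par : X → ℕ)

/-! The gauge identity never uses an equation of motion. On Wick polynomials, `d_Q T^I = i ∂_μ
T^{Iμ} + S^I` holds algebraically, because `S^I` keeps precisely the terms in which `□` acts on a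
field (`gauge_lagrangianT`). The second-order identity then follows once "contract one factor at `x`
with one factor at `y`, using a distribution `P(x - y)`" is shown to be compatible with `∂/∂x`,
`∂/∂y` and `d_Q`. Compatibility with derivatives is the Leibniz rule. Compatibility with `d_Q` says
that varying the two contracted legs contributes nothing: the two-point coefficients are gauge
invariant (`gaugeCoeff_mul_twoPointCoeff`), each varied leg carries one derivative `∂_i`, and `∂_x =
-∂_y` on functions of `x - y`. None of this depends on which propagator is used, so
`gaugeComm_treeContract` holds for every continuous time phase `τ`. The box is never evaluated on
the propagator, hence no delta terms arise.

The algebra rests on two operations on words: `extSum`, which extracts one factor with its Fermi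
sign, and `derSum`, a graded derivation. They commute (`derSum_extSum`). Wick's theorem is iterated
extraction, so a derivation preserving the two-point function annihilates all expectation values
(`derSum_vev_eq_zero`). In degree one this gives the action of `Q` on normal products
(`normalProduct_gauge`); a derivation of degree zero describes `∂_μ` (`fderiv_vev`).

That the Feynman propagator gives a chronological product is a matter of supports: `D^F` is `D⁽⁺⁾`
off the backward cone and the reflected `D⁽⁺⁾` off the forward cone. At fixed time and mass the
discrepancy is `∫ sin(ωt)/ω ĝ(p) d³p`, which must vanish when `g` vanishes on the ball `|x| ≤ |t|`.
For mass zero, the Fourier transform of a ball is the radial primitive of `sin(s|p|)/|p|`, and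
Fourier inversion applies. For positive mass, the derivative in `λ` at time `t` is an integral of
the same quantity over times up to `t`, and iteration gives bounds `Cⁿ/n!`
(`sinePairing_eq_zero_of_massless`).

All manipulations of smeared propagators go through one absolutely convergent integral
(`offShell_eq_integral`), obtained by trading `(1 - Δ)²` on the test function for decay in momentum
space. -/

/-- The signed sum `∑ₖ (-1)^{|wₖ| |w₀ ⋯ wₖ₋₁|} F(wₖ, w ∖ wₖ)` over the factors of a word. -/
def extSum : List X → (X → List X → ℂ) → ℂ
  | [], _ => 0
  | x :: w, F => F x w + extSum w (fun y w' => (-1) ^ (par x * par y) * F y (x :: w'))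

/-- The recursive form is suited to induction on words; the sum over positions is the form in which
`vev` and `treeOnWords` are defined. -/
theorem extSum_eq_sum (w : List X) (F : X → List X → ℂ) :
    extSum par w F = ∑ k : Fin w.length,
      (-1 : ℂ) ^ (par (w.get k) * ((w.take k).map par).sum) * F (w.get k) (w.eraseIdx k) := by
  induction w generalizing F with
  | nil => simp [extSum]
  | cons x w ih =>
    rw [extSum, ih]
    simp only [List.length_cons, List.get_eq_getElem]
    rw [Fin.sum_univ_succ]
    simp only [Fin.val_zero, List.getElem_cons_zero, List.take_zero, List.map_nil, List.sum_nil,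
      mul_zero, pow_zero, one_mul, List.eraseIdx_zero, List.tail_cons, Fin.val_succ,
      List.getElem_cons_succ, List.take_succ_cons, List.map_cons, List.sum_cons,
      List.eraseIdx_cons_succ]
    congr 1
    refine Finset.sum_congr rfl fun k _ => ?_
    rw [mul_add, pow_add, mul_comm (par x)]
    ring

theorem extSum_add (w : List X) (F G : X → List X → ℂ) :
    extSum par w (fun y w' => F y w' + G y w') = extSum par w F + extSum par w G := by
  simp only [extSum_eq_sum, mul_add, Finset.sum_add_distrib]

theorem extSum_mul_left (w : List X) (a : ℂ) (F : X → List X → ℂ) :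
    extSum par w (fun y w' => a * F y w') = a * extSum par w F := by
  simp only [extSum_eq_sum, Finset.mul_sum]
  exact Finset.sum_congr rfl fun _ _ => by ring

theorem extSum_sum {ι : Type*} (s : Finset ι) (w : List X) (F : ι → X → List X → ℂ) :
    extSum par w (fun y w' => ∑ i ∈ s, F i y w') = ∑ i ∈ s, extSum par w (F i) := by
  simp only [extSum_eq_sum, Finset.mul_sum]
  rw [Finset.sum_comm]

theorem extSum_zero (w : List X) : extSum par w (fun _ _ => 0) = 0 := by
  simp [extSum_eq_sum]

/-- Two summands that agree on all factorisations occurring in the sum give the same sum. -/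
theorem extSum_congr (w : List X) {F G : X → List X → ℂ}
    (h : ∀ y w', w'.length < w.length → par y + (w'.map par).sum = (w.map par).sum →
      F y w' = G y w') :
    extSum par w F = extSum par w G := by
  induction w generalizing F G with
  | nil => rfl
  | cons x w ih =>
    rw [extSum, extSum, h x w (by simp) (by simp)]
    congr 1
    refine ih fun y w' hw' hp => ?_
    rw [h y (x :: w') (by simpa using hw') (by simp; omega)]

/-- Extracting two factors in either order. -/
theorem extSum_extSum_swap (w : List X) (G : X → X → List X → ℂ) :
    extSum par w (fun y w' => extSum par w' (fun z w'' => G y z w'')) =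
      extSum par w (fun y w' => extSum par w' (fun z w'' =>
        (-1) ^ (par y * par z) * G z y w'')) := by
  induction w generalizing G with
  | nil => rfl
  | cons x w ih =>
    simp only [extSum, mul_add, extSum_add]
    have h1 := ih (fun y z w'' => (-1) ^ (par x * par y) * ((-1) ^ (par x * par z) *
      G y z (x :: w'')))
    simp only [← extSum_mul_left] at h1 ⊢
    rw [h1]
    rw [← add_assoc, ← add_assoc]
    congr 1
    · rw [add_comm]
      congr 1
      refine extSum_congr par w fun y w' _ _ => ?_
      rw [← mul_assoc, mul_comm (par y), ← mul_pow]
      simp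
    · refine extSum_congr par w fun y w' _ _ => extSum_congr par w' fun z w'' _ _ => ?_
      ring

/-- Extracting `j` from one word matches extracting `j` from the other up to the sign of passing
`k`, and likewise for `k`. When another letter is extracted, both remain behind in a shorter
context, so `hF` can be supplied by an induction hypothesis. -/
theorem extSum_swap (j k : X) (L R : List X) (F : X → List X → ℂ)
    (hF : ∀ y L' R', L'.length + R'.length < L.length + R.length →
      F y (L' ++ j :: k :: R') = (-1) ^ (par j * par k) * F y (L' ++ k :: j :: R')) :
    extSum par (L ++ j :: k :: R) F =
      (-1) ^ (par j * par k) * extSum par (L ++ k :: j :: R) F := by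
  induction L generalizing F with
  | nil =>
    simp only [List.nil_append, extSum, mul_add]
    have hs : ((-1 : ℂ) ^ (par j * par k)) * (-1) ^ (par k * par j) = 1 := by
      rw [mul_comm (par k), ← mul_pow]; simp
    rw [← mul_assoc _ _ (F j (k :: R)), hs, ← extSum_mul_left]
    have : extSum par R (fun y w' => (-1) ^ (par k * par y) * ((-1) ^ (par j * par y) *
        F y (j :: k :: w'))) = extSum par R (fun y w' => (-1) ^ (par j * par k) *
        ((-1) ^ (par j * par y) * ((-1) ^ (par k * par y) * F y (k :: j :: w')))) := by
      refine extSum_congr par R fun y w' hw' _ => ?_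
      have := hF y [] w' (by simpa using hw')
      simp only [List.nil_append] at this
      rw [this]; ring
    rw [this]; ring
  | cons x L ih =>
    simp only [List.cons_append, extSum, mul_add]
    have e1 : F x (L ++ j :: k :: R) = (-1) ^ (par j * par k) * F x (L ++ k :: j :: R) :=
      hF x L R (by simp)
    rw [e1, ih]
    intro y L' R' h
    have := hF y (x :: L') R' (by simp; omega)
    simp only [List.cons_append] at this
    rw [this]; ring

theorem extSum_letter_congr (j k : X) (hp : par j = par k) (L R : List X) (F : X → List X → ℂ)
    (hjk : ∀ w, F j w = F k w)
    (hF : ∀ y L' R', L'.length + R'.length < L.length + R.length →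
      F y (L' ++ j :: R') = F y (L' ++ k :: R')) :
    extSum par (L ++ j :: R) F = extSum par (L ++ k :: R) F := by
  induction L generalizing F with
  | nil =>
    simp only [List.nil_append, extSum, hjk, hp]
    congr 1
    refine extSum_congr par R fun y w' hw' _ => ?_
    have := hF y [] w' (by simpa using hw')
    simp only [List.nil_append] at this
    rw [this]
  | cons x L ih =>
    simp only [List.cons_append, extSum]
    rw [hF x L R (by simp), ih _ (by simp [hjk, hp])]
    intro y L' R' h
    have := hF y (x :: L') R' (by simp; omega)
    simp only [List.cons_append] at this
    rw [this]

variable {ι : Type*} [Fintype ι] (c : X → ι → ℂ) (t : X → ι → X) (d : ℕ)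

/-- The (graded, of degree `d`) derivation `x ↦ ∑ᵢ c(x,i) t(x,i)` applied to a word, evaluated by
the linear functional `F` on words. -/
def derSum : List X → (List X → ℂ) → ℂ
  | [], _ => 0
  | x :: w, F => ∑ i, c x i * F (t x i :: w) +
      (-1) ^ (d * par x) * derSum w (fun w' => F (x :: w'))

theorem derSum_add (w : List X) (F G : List X → ℂ) :
    derSum par c t d w (fun w' => F w' + G w') =
      derSum par c t d w F + derSum par c t d w G := by
  induction w generalizing F G with
  | nil => simp [derSum]
  | cons x w ih =>
    simp only [derSum, ih, mul_add, Finset.sum_add_distrib]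
    ring

theorem derSum_mul_left (w : List X) (a : ℂ) (F : List X → ℂ) :
    derSum par c t d w (fun w' => a * F w') = a * derSum par c t d w F := by
  induction w generalizing F with
  | nil => simp [derSum]
  | cons x w ih =>
    simp only [derSum, ih, mul_add, Finset.mul_sum]
    congr 1
    · exact Finset.sum_congr rfl fun _ _ => by ring
    · ring

theorem derSum_zero (w : List X) : derSum par c t d w (fun _ => 0) = 0 := by
  simpa using derSum_mul_left par c t d w 0 (fun _ => 0)

theorem derSum_sum {κ : Type*} (s : Finset κ) (w : List X) (F : κ → List X → ℂ) :
    derSum par c t d w (fun w' => ∑ i ∈ s, F i w') = ∑ i ∈ s, derSum par c t d w (F i) := by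
  classical
  induction s using Finset.induction_on with
  | empty => simp [derSum_zero]
  | insert a s ha ih => simp only [Finset.sum_insert ha, derSum_add, ih]

theorem derSum_append (w v : List X) (F : List X → ℂ) :
    derSum par c t d (w ++ v) F = derSum par c t d w (fun w' => F (w' ++ v)) +
      (-1) ^ (d * (w.map par).sum) * derSum par c t d v (fun v' => F (w ++ v')) := by
  induction w generalizing F with
  | nil => simp [derSum]
  | cons x w ih =>
    simp only [List.cons_append, derSum, ih, List.map_cons, List.sum_cons, mul_add, pow_add]
    ring

theorem neg_one_pow_congr {a b : ℕ} (h : a ≡ b [MOD 2]) : (-1 : ℂ) ^ a = (-1) ^ b := by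
  rw [neg_one_pow_eq_pow_mod_two, neg_one_pow_eq_pow_mod_two (n := b), h]

/-- Only words of the shifted parity occur in the sum, so a sign depending on the parity of the word
may be treated as constant and pulled out. -/
theorem derSum_congr (ht : ∀ x i, c x i ≠ 0 → par (t x i) ≡ par x + d [MOD 2])
    (w : List X) {F G : List X → ℂ}
    (h : ∀ w', w'.length = w.length → (w'.map par).sum ≡ (w.map par).sum + d [MOD 2] →
      F w' = G w') :
    derSum par c t d w F = derSum par c t d w G := by
  induction w generalizing F G with
  | nil => rfl
  | cons x w ih =>
    rw [derSum, derSum]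
    congr 1
    · refine Finset.sum_congr rfl fun i _ => ?_
      by_cases h0 : c x i = 0
      · simp [h0]
      · rw [h _ (by simp)]
        have := ht x i h0
        simp only [List.map_cons, List.sum_cons]
        unfold Nat.ModEq at *; omega
    · congr 1
      refine ih fun w' h1 h2 => h _ (by simp [h1]) ?_
      simp only [List.map_cons, List.sum_cons]
      unfold Nat.ModEq at *; omega

/-- A derivation commutes with the extraction of a factor. -/
theorem derSum_extSum (ht : ∀ x i, c x i ≠ 0 → par (t x i) ≡ par x + d [MOD 2])
    (w : List X) (F : X → List X → ℂ) :
    derSum par c t d w (fun w' => extSum par w' F) =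
      extSum par w (fun y w' => ∑ i, c y i * F (t y i) w' +
        (-1) ^ (d * par y) * derSum par c t d w' (F y)) := by
  induction w generalizing F with
  | nil => rfl
  | cons x w ih =>
    simp only [derSum, extSum, derSum_add, ih]
    simp only [mul_add, Finset.sum_add_distrib, extSum_add, ← extSum_mul_left, ← extSum_sum]
    -- The image of `x` has parity `|x| + d`, so moving it past `y` costs an additional
    -- `(-1)^{d|y|}`. This is the sign of the graded Leibniz rule.
    have key : ∀ x y i, c x i ≠ 0 → (-1 : ℂ) ^ (par (t x i) * par y) =
        (-1) ^ (par x * par y) * (-1) ^ (d * par y) := by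
      intro x y i h
      rw [← pow_add, ← add_mul]
      exact neg_one_pow_congr ((ht x i h).mul_right _)
    have e1 : extSum par w (fun y w' => ∑ i, c x i * ((-1) ^ (par (t x i) * par y) *
          F y (t x i :: w'))) =
        extSum par w (fun y w' => (-1) ^ (par x * par y) * ((-1) ^ (d * par y) *
          ∑ i, c x i * F y (t x i :: w'))) := by
      refine extSum_congr par w fun y w' _ _ => ?_
      simp only [Finset.mul_sum]
      refine Finset.sum_congr rfl fun i _ => ?_
      by_cases h0 : c x i = 0
      · simp [h0]
      · rw [key x y i h0]; ring
    have e2 : extSum par w (fun y w' => (-1) ^ (d * par x) * ∑ i, c y i *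
          ((-1) ^ (par x * par (t y i)) * F (t y i) (x :: w'))) =
        extSum par w (fun y w' => (-1) ^ (par x * par y) *
          ∑ i, c y i * F (t y i) (x :: w')) := by
      refine extSum_congr par w fun y w' _ _ => ?_
      simp only [Finset.mul_sum]
      refine Finset.sum_congr rfl fun i _ => ?_
      by_cases h0 : c y i = 0
      · simp [h0]
      · rw [mul_comm (par x) (par (t y i)), key y x i h0, mul_comm (par y)]
        have : ((-1 : ℂ) ^ (d * par x)) * (-1) ^ (d * par x) = 1 := by rw [← mul_pow]; simp
        linear_combination (c y i * (-1) ^ (par x * par y) * F (t y i) (x :: w')) * this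
    have e3 : extSum par w (fun y w' => (-1) ^ (d * par x) * ((-1) ^ (d * par y) *
          derSum par c t d w' (fun w' => (-1) ^ (par x * par y) * F y (x :: w')))) =
        extSum par w (fun y w' => (-1) ^ (par x * par y) * ((-1) ^ (d * par y) *
          ((-1) ^ (d * par x) * derSum par c t d w' fun w' => F y (x :: w')))) := by
      refine extSum_congr par w fun y w' _ _ => ?_
      rw [derSum_mul_left]; ring
    rw [e1, e2, e3]
    ring

end Words

/-! ### Vacuum expectation values -/

section Vev

variable {r : ℕ} {W : Letter r → Letter r → ℂ}

theorem vev_nil : vev W [] = 1 := by rw [vev]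

theorem vev_cons (l : Letter r) (w : List (Letter r)) :
    vev W (l :: w) = extSum Letter.parity w (fun y w' => W l y * vev W w') := by
  rw [vev, extSum_eq_sum]
  exact Finset.sum_congr rfl fun k _ => by rw [mul_assoc]

variable {ι : Type*} [Fintype ι] (c : Letter r → ι → ℂ) (t : Letter r → ι → Letter r) (d : ℕ)

/-- A derivation acts either on the contracted pair `l`, `y` or on the rest. In the latter case it
has passed both letters, and the signs `(-1)^{d|l|}` and `(-1)^{d|y|}` cancel because only letters
of equal parity contract. -/
theorem derSum_vev_cons (ht : ∀ x i, c x i ≠ 0 → (t x i).parity ≡ x.parity + d [MOD 2])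
    (hW : ∀ x y, W x y ≠ 0 → x.parity = y.parity) (l : Letter r) (w : List (Letter r)) :
    derSum Letter.parity c t d (l :: w) (vev W) =
      extSum Letter.parity w (fun y w' =>
        (∑ i, c l i * W (t l i) y + (-1) ^ (d * l.parity) * ∑ i, c y i * W l (t y i)) * vev W w' +
          W l y * derSum Letter.parity c t d w' (vev W)) := by
  simp only [derSum, vev_cons]
  rw [derSum_extSum _ _ _ _ ht]
  simp only [← extSum_mul_left, ← extSum_sum, ← extSum_add]
  refine extSum_congr _ w fun y w' _ _ => ?_
  rw [derSum_mul_left]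
  have : (-1 : ℂ) ^ (d * l.parity) * ((-1) ^ (d * y.parity) * W l y) = W l y := by
    by_cases h0 : W l y = 0
    · simp [h0]
    · rw [hW l y h0, ← mul_assoc, ← mul_pow]; simp
  simp only [add_mul, Finset.sum_mul, mul_add, Finset.mul_sum]
  rw [add_assoc]
  refine congrArg₂ _ (Finset.sum_congr rfl fun _ _ => by ring) (congrArg₂ _
    (Finset.sum_congr rfl fun _ _ => by ring) ?_)
  linear_combination derSum Letter.parity c t d w' (vev W) * this

/-- A derivation that leaves the two-point function invariant leaves all expectation values
invariant. -/
theorem derSum_vev_eq_zero (ht : ∀ x i, c x i ≠ 0 → (t x i).parity ≡ x.parity + d [MOD 2])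
    (hW : ∀ x y, W x y ≠ 0 → x.parity = y.parity)
    (hinv : ∀ x y, ∑ i, c x i * W (t x i) y +
      (-1) ^ (d * x.parity) * ∑ i, c y i * W x (t y i) = 0) (w : List (Letter r)) :
    derSum Letter.parity c t d w (vev W) = 0 := by
  induction hn : w.length using Nat.strong_induction_on generalizing w with
  | _ n ih =>
    cases w with
    | nil => rfl
    | cons l w =>
      rw [derSum_vev_cons c t d ht hW, ← extSum_zero Letter.parity w]
      refine extSum_congr _ w fun y w' hw' _ => ?_
      rw [hinv, ih w'.length (by simp at hn; omega) w' rfl]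
      ring

/-- Two neighbours either contract with each other, where `hjk` gives the sign, or with two other
letters, and then the sign results from extracting those letters in the opposite order. -/
theorem vev_swap (hW : ∀ x y, W x y ≠ 0 → x.parity = y.parity) {j k : Letter r}
    (hjk : W j k = (-1) ^ (j.parity * k.parity) * W k j) (L R : List (Letter r)) :
    vev W (L ++ j :: k :: R) = (-1) ^ (j.parity * k.parity) * vev W (L ++ k :: j :: R) := by
  induction hn : L.length + R.length using Nat.strong_induction_on generalizing L R with
  | _ n ih =>
    cases L with
    | nil =>
      simp only [List.nil_append, vev_cons, extSum, mul_add, hjk]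
      rw [mul_assoc]
      congr 1
      -- Here `j` contracts with `y` and `k` with `z`; extracting `z` before `y` turns this into the
      -- sum for the word beginning with `k, j`.
      have e := extSum_extSum_swap Letter.parity R (fun y z w'' =>
        (-1) ^ (k.parity * y.parity) * (W j y * (W k z * vev W w'')))
      simp only [extSum_mul_left] at e
      rw [e, ← extSum_mul_left]
      refine extSum_congr _ R fun y w' _ _ => ?_
      simp only [← extSum_mul_left]
      refine extSum_congr _ w' fun z w'' _ _ => ?_
      by_cases h1 : W j z = 0
      · simp [h1]
      by_cases h2 : W k y = 0
      · simp [h2]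
      rw [← hW _ _ h1, ← hW _ _ h2, mul_comm k.parity j.parity]
      ring
    | cons l L =>
      simp only [List.cons_append, vev_cons]
      refine extSum_swap _ j k L R _ fun y L' R' h => ?_
      rw [ih (L'.length + R'.length) (by simp at hn; omega) L' R' rfl]
      ring

/-- Expectation values see a letter only through its parity and its contractions. This is what
identifies jets whose derivatives are taken in a different order. -/
theorem vev_letter_congr {j k : Letter r} (hp : j.parity = k.parity)
    (hl : ∀ y, W j y = W k y) (hr : ∀ y, W y j = W y k) (L R : List (Letter r)) :
    vev W (L ++ j :: R) = vev W (L ++ k :: R) := by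
  induction hn : L.length + R.length using Nat.strong_induction_on generalizing L R with
  | _ n ih =>
    cases L with
    | nil => simp only [List.nil_append, vev_cons, hl]
    | cons l L =>
      simp only [List.cons_append, vev_cons]
      refine extSum_letter_congr _ j k hp L R _ (fun w => by rw [hr]) fun y L' R' h => ?_
      rw [ih (L'.length + R'.length) (by simp at hn; omega) L' R' rfl]

end Vev

/-! ### Schwartz functions on Minkowski space -/

theorem event_zero (t : ℝ) (x : Space) : event t x 0 = t := by simp [event]

theorem event_succ (t : ℝ) (x : Space) (j : Fin 3) : event t x j.succ = x j := by simp [event]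

theorem norm_event_sq (t : ℝ) (x : Space) : ‖event t x‖ ^ 2 = t ^ 2 + ‖x‖ ^ 2 := by
  rw [EuclideanSpace.norm_sq_eq, EuclideanSpace.norm_sq_eq, Fin.sum_univ_succ, event_zero]
  simp [event_succ]

theorem continuous_event : Continuous fun z : ℝ × Space => event z.1 z.2 := by
  refine (PiLp.continuous_toLp 2 _).comp (continuous_pi fun i => ?_)
  refine Fin.cases ?_ (fun j => ?_) i
  · simpa using continuous_fst
  · simp only [Fin.cons_succ]
    fun_prop

theorem event_add_smul (t : ℝ) (x : Space) (s : ℝ) (j : Fin 3) :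
    event t (x + s • EuclideanSpace.single j 1) = event t x + s • basisVec j.succ := by
  ext i
  refine Fin.cases ?_ (fun k => ?_) i
  · simp [event, basisVec]
  · simp [event, basisVec, Fin.succ_inj, Pi.single_apply]

section Schwartz

variable {E F : Type*} [NormedAddCommGroup E] [NormedSpace ℝ E]
  [NormedAddCommGroup F] [NormedSpace ℝ F]

theorem lineDerivOp_comm (v w : E) (G : 𝓢(E, F)) : ∂_{v} (∂_{w} G) = ∂_{w} (∂_{v} G) := by
  ext x
  have key : ∀ v w : E, (∂_{v} (∂_{w} G)) x = fderiv ℝ (fderiv ℝ G) x v w := by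
    intro v w
    rw [SchwartzMap.lineDerivOp_apply_eq_fderiv]
    have : (⇑(∂_{w} G : 𝓢(E, F)) : E → F) = fun y => fderiv ℝ G y w := by
      ext y; rw [SchwartzMap.lineDerivOp_apply_eq_fderiv]
    rw [this]
    have hd : DifferentiableAt ℝ (fderiv ℝ G) x :=
      ((G.smooth 2).fderiv_right (m := 1) (by norm_num)).differentiable (by norm_num) x
    rw [fderiv_clm_apply hd (by fun_prop)]
    simp
  rw [key, key]
  have h := (G.smooth 2).contDiffAt (x := x)
  exact h.isSymmSndFDerivAt (by simp) v w

theorem schwartz_bound (G : 𝓢(E, F)) (k : ℕ) :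
    ∃ C, 0 ≤ C ∧ ∀ x, ‖G x‖ ≤ C * ((1 + ‖x‖ ^ 2) ^ k)⁻¹ := by
  obtain ⟨C, hC⟩ : ∃ C, ∀ x, (1 + ‖x‖) ^ (2 * k) * ‖iteratedFDeriv ℝ 0 G x‖ ≤ C :=
    ⟨_, fun x => SchwartzMap.one_add_le_sup_seminorm_apply (𝕜 := ℝ) (m := (2 * k, 0))
      le_rfl le_rfl G x⟩
  refine ⟨C, le_trans (by positivity) (hC 0), fun x => ?_⟩
  rw [← div_eq_mul_inv, le_div_iff₀ (by positivity)]
  refine le_trans ?_ (hC x)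
  rw [norm_iteratedFDeriv_zero, mul_comm, pow_mul]
  gcongr
  nlinarith [norm_nonneg x]

/-- A form of Peetre's inequality: polynomial decay survives translation. -/
theorem one_add_sq_le {E : Type*} [NormedAddCommGroup E] (a x : E) :
    1 + ‖x‖ ^ 2 ≤ 2 * (1 + ‖a‖ ^ 2) * (1 + ‖a + x‖ ^ 2) := by
  have h : ‖x‖ ≤ ‖a + x‖ + ‖a‖ := by
    calc ‖x‖ = ‖(a + x) - a‖ := by simp
      _ ≤ _ := norm_sub_le _ _
  nlinarith [norm_nonneg x, norm_nonneg a, norm_nonneg (a + x), sq_nonneg (‖a + x‖ - ‖a‖),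
    mul_nonneg (sq_nonneg ‖a‖) (sq_nonneg ‖a + x‖)]

/-- The constant is uniform over bounded translations, as domination near a point requires when
differentiating in the translation. -/
theorem schwartz_bound_translate (G : 𝓢(E, F)) (k : ℕ) (R : ℝ) :
    ∃ C, 0 ≤ C ∧ ∀ a x, ‖a‖ ≤ R → ‖G (a + x)‖ ≤ C * ((1 + ‖x‖ ^ 2) ^ k)⁻¹ := by
  obtain ⟨C, hC0, hC⟩ := schwartz_bound G k
  refine ⟨C * (2 * (1 + R ^ 2)) ^ k, by positivity, fun a x ha => (hC _).trans ?_⟩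
  rw [mul_assoc]
  gcongr
  rw [← div_eq_mul_inv, le_div_iff₀ (by positivity), inv_mul_le_iff₀ (by positivity), ← mul_pow]
  gcongr
  refine (one_add_sq_le a x).trans ?_
  have : ‖a‖ ^ 2 ≤ R ^ 2 := by gcongr
  nlinarith [sq_nonneg ‖a + x‖]

end Schwartz

/-! ### Integrable weights in time, position and momentum -/

/-- The integrable weight that dominates Schwartz functions on `ℝ × Space`. -/
def decay (t : ℝ) (x : Space) : ℝ := (1 + t ^ 2)⁻¹ * ((1 + ‖x‖ ^ 2) ^ 2)⁻¹

theorem inv_pow_le_decay (t : ℝ) (x : Space) :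
    ((1 + ‖event t x‖ ^ 2) ^ 3)⁻¹ ≤ decay t x := by
  rw [decay, ← mul_inv, norm_event_sq]
  gcongr
  have h1 : (1 + t ^ 2) ≤ 1 + (t ^ 2 + ‖x‖ ^ 2) := by nlinarith [sq_nonneg ‖x‖]
  have h2 : (1 + ‖x‖ ^ 2) ≤ 1 + (t ^ 2 + ‖x‖ ^ 2) := by nlinarith [sq_nonneg t]
  calc (1 + t ^ 2) * (1 + ‖x‖ ^ 2) ^ 2 ≤
      (1 + (t ^ 2 + ‖x‖ ^ 2)) * (1 + (t ^ 2 + ‖x‖ ^ 2)) ^ 2 := by gcongr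
    _ = _ := by ring

theorem integrable_space_weight : Integrable fun x : Space => ((1 + ‖x‖ ^ 2) ^ 2)⁻¹ := by
  have h := integrable_rpow_neg_one_add_norm_sq (E := Space) (μ := volume) (r := 4)
    (by simp; norm_num)
  refine h.congr (Filter.Eventually.of_forall fun x => ?_)
  simp only
  rw [show (-4 / 2 : ℝ) = -(2 : ℕ) by norm_num, Real.rpow_neg (by positivity), Real.rpow_natCast]

theorem integrable_time_weight : Integrable fun t : ℝ => (1 + t ^ 2)⁻¹ := integrable_inv_one_add_sq

/-- The momentum space weight `1 / (2 |p| (1 + |p|²)²)`. -/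
def momentumWeight (p : Space) : ℝ := (2 * ‖p‖)⁻¹ * ((1 + ‖p‖ ^ 2) ^ 2)⁻¹

/-- The singularity `1/|p|` is harmless in three dimensions: the radial density `s²` absorbs it. -/
theorem integrable_momentumWeight : Integrable momentumWeight := by
  have h := (integrable_fun_norm_addHaar (E := Space) volume
    (f := fun s : ℝ => (2 * s)⁻¹ * ((1 + s ^ 2) ^ 2)⁻¹)).2 ?_
  · exact h
  · simp only [finrank_euclideanSpace, Fintype.card_fin, smul_eq_mul]
    refine Integrable.mono' (integrable_time_weight.integrableOn) ?_ ?_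
    · exact (by fun_prop : Measurable _).aestronglyMeasurable
    · filter_upwards [ae_restrict_mem measurableSet_Ioi] with s hs
      have hs : 0 < s := hs
      rw [Real.norm_of_nonneg (by positivity)]
      have : s ^ (3 - 1) * ((2 * s)⁻¹ * ((1 + s ^ 2) ^ 2)⁻¹) =
          s / (2 * (1 + s ^ 2)) * (1 + s ^ 2)⁻¹ := by
        field_simp
      rw [this]
      refine mul_le_of_le_one_left (by positivity) ?_
      rw [div_le_one (by positivity)]
      nlinarith [sq_nonneg (s - 1)]

theorem energy_nonneg (lam : ℝ) (p : Space) : 0 ≤ energy lam p := Real.sqrt_nonneg _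

theorem norm_le_energy (lam : ℝ) (p : Space) : ‖p‖ ≤ energy lam p := by
  unfold energy
  exact Real.le_sqrt_of_sq_le (by nlinarith [sq_nonneg lam])

theorem le_energy (lam : ℝ) (p : Space) : lam ≤ energy lam p := by
  unfold energy
  exact Real.le_sqrt_of_sq_le (by nlinarith [sq_nonneg ‖p‖])

theorem continuous_energy : Continuous fun z : ℝ × Space => energy z.1 z.2 := by
  unfold energy; fun_prop

/-! ### Smeared propagators -/

/-- The superposition with weight `ρ` of the propagators `massKernel τ lam`. -/
def offShell (τ : ℝ → ℝ) (ρ : ℝ → ℝ) (g : Spacetime → ℂ) : ℂ :=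
  ∫ lam in Set.Ioi (0 : ℝ), (ρ lam : ℂ) * massKernel τ lam g

theorem offShellPlus_eq (ρ : ℝ → ℝ) : offShellPlus ρ = offShell (fun t => t) ρ := rfl

theorem offShellFeynman_eq (ρ : ℝ → ℝ) : offShellFeynman ρ = offShell (fun t => |t|) ρ := rfl

theorem massKernel_const_mul (τ : ℝ → ℝ) (lam : ℝ) (a : ℂ) (g : Spacetime → ℂ) :
    massKernel τ lam (fun ξ => a * g ξ) = a * massKernel τ lam g := by
  unfold massKernel
  have : ∀ t p x, Complex.exp (Complex.I * ((inner ℝ p x : ℝ) : ℂ)) * (a * g (event t x)) =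
      a * (Complex.exp (Complex.I * ((inner ℝ p x : ℝ) : ℂ)) * g (event t x)) := by
    intros; ring
  simp only [this, integral_const_mul]
  simp only [mul_left_comm _ a, integral_const_mul]

theorem offShell_const_mul (τ ρ : ℝ → ℝ) (a : ℂ) (g : Spacetime → ℂ) :
    offShell τ ρ (fun ξ => a * g ξ) = a * offShell τ ρ g := by
  simp only [offShell, massKernel_const_mul, mul_left_comm _ a, integral_const_mul]

theorem offShell_neg (τ ρ : ℝ → ℝ) (g : Spacetime → ℂ) :
    offShell τ ρ (fun ξ => -g ξ) = -offShell τ ρ g := by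
  simpa using offShell_const_mul τ ρ (-1) g

/-- The plane wave `exp(i p·x)`. -/
def planeWave (p x : Space) : ℂ := Complex.exp (Complex.I * ((inner ℝ p x : ℝ) : ℂ))

theorem norm_planeWave (p x : Space) : ‖planeWave p x‖ = 1 := by
  rw [planeWave, mul_comm, Complex.norm_exp_ofReal_mul_I]

theorem continuous_planeWave : Continuous fun z : Space × Space => planeWave z.1 z.2 := by
  unfold planeWave; fun_prop

/-- The spatial Fourier transform at fixed time. -/
def spatialFourier (g : Spacetime → ℂ) (t : ℝ) (p : Space) : ℂ :=
  ∫ x : Space, planeWave p x * g (event t x)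

/-- `exp(-i ω τ(t)) / (2 ω)`. -/
def freqFactor (τ : ℝ → ℝ) (lam t : ℝ) (p : Space) : ℂ :=
  Complex.exp (-Complex.I * ((energy lam p * τ t : ℝ) : ℂ)) / ((2 * energy lam p : ℝ) : ℂ)

theorem massKernel_eq (τ : ℝ → ℝ) (lam : ℝ) (g : Spacetime → ℂ) :
    massKernel τ lam g = Complex.I / (2 * (Real.pi : ℂ)) ^ 3 *
      ∫ t : ℝ, ∫ p : Space, freqFactor τ lam t p * spatialFourier g t p := rfl

theorem norm_freqFactor (τ : ℝ → ℝ) (lam t : ℝ) (p : Space) :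
    ‖freqFactor τ lam t p‖ = (2 * energy lam p)⁻¹ := by
  rw [freqFactor, norm_div, show -Complex.I * ((energy lam p * τ t : ℝ) : ℂ) =
    ((-(energy lam p * τ t) : ℝ) : ℂ) * Complex.I by push_cast; ring,
    Complex.norm_exp_ofReal_mul_I, Complex.norm_real, Real.norm_of_nonneg
    (by have := energy_nonneg lam p; positivity), one_div]

theorem measurable_freqFactor {τ : ℝ → ℝ} (hτ : Continuous τ) :
    Measurable fun z : ℝ × ℝ × Space => freqFactor τ z.1 z.2.1 z.2.2 := by
  have he : Continuous fun z : ℝ × ℝ × Space => energy z.1 z.2.2 :=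
    continuous_energy.comp (f := fun z : ℝ × ℝ × Space => (z.1, z.2.2)) (by fun_prop)
  unfold freqFactor
  refine Measurable.div (Continuous.measurable ?_) (Continuous.measurable ?_) <;> fun_prop

/-- `(1 - Δ) G` with the spatial Laplacian `Δ`. -/
def bessel (G : 𝓢(Spacetime, ℂ)) : 𝓢(Spacetime, ℂ) :=
  G - ∑ j : Fin 3, ∂_{basisVec j.succ} (∂_{basisVec j.succ} G)

theorem schwartz_event_bound {F : Type*} [NormedAddCommGroup F] [NormedSpace ℝ F]
    (G : 𝓢(Spacetime, F)) (R : ℝ) :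
    ∃ C, 0 ≤ C ∧ ∀ a t x, ‖a‖ ≤ R → ‖G (a + event t x)‖ ≤ C * decay t x := by
  obtain ⟨C, hC0, hC⟩ := schwartz_bound_translate G 3 R
  refine ⟨C, hC0, fun a t x ha => (hC a _ ha).trans ?_⟩
  gcongr
  exact inv_pow_le_decay t x

theorem continuous_event_right (t : ℝ) : Continuous fun x : Space => event t x :=
  continuous_event.comp (f := fun x : Space => (t, x)) (by fun_prop)

theorem integrable_slice {F : Type*} [NormedAddCommGroup F] [NormedSpace ℝ F]
    (G : 𝓢(Spacetime, F)) (t : ℝ) : Integrable fun x : Space => G (event t x) := by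
  obtain ⟨C, hC0, hC⟩ := schwartz_event_bound G 0
  refine Integrable.mono' (g := fun x => C * decay t x) ?_ ?_ ?_
  · exact (integrable_space_weight.const_mul _).const_mul _
  · exact (G.continuous.comp (continuous_event_right t)).aestronglyMeasurable
  · exact Filter.Eventually.of_forall fun x => by simpa using hC 0 t x (by simp)

theorem integrable_planeWave_mul {g : Space → ℂ} (hg : Integrable g) (p : Space) :
    Integrable fun x => planeWave p x * g x := by
  refine hg.bdd_mul (c := 1) ?_ ?_
  · exact (continuous_planeWave.comp (f := fun x => (p, x)) (by fun_prop)).aestronglyMeasurable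
  · exact Filter.Eventually.of_forall fun x => (norm_planeWave p x).le

theorem hasLineDerivAt_slice (G : 𝓢(Spacetime, ℂ)) (t : ℝ) (j : Fin 3) (x : Space) :
    HasLineDerivAt ℝ (fun x : Space => G (event t x))
      ((∂_{basisVec j.succ} G : 𝓢(Spacetime, ℂ)) (event t x)) x
      (EuclideanSpace.single j 1) := by
  unfold HasLineDerivAt
  simp only [event_add_smul]
  rw [SchwartzMap.lineDerivOp_apply_eq_fderiv]
  have h := (G.hasFDerivAt (event t x)).hasLineDerivAt (basisVec j.succ)
  exact h

theorem hasLineDerivAt_planeWave (p x : Space) (j : Fin 3) :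
    HasLineDerivAt ℝ (planeWave p) (Complex.I * p j * planeWave p x) x
      (EuclideanSpace.single j 1) := by
  unfold HasLineDerivAt planeWave
  have h1 : HasDerivAt (fun s : ℝ => (inner ℝ p (x + s • EuclideanSpace.single j (1 : ℝ)) : ℝ))
      (p j) 0 := by
    have : (fun s : ℝ => (inner ℝ p (x + s • EuclideanSpace.single j (1 : ℝ)) : ℝ)) =
        fun s => inner ℝ p x + s * p j := by
      ext s; rw [inner_add_right, inner_smul_right, EuclideanSpace.inner_single_right]; simp
    rw [this]
    simpa using (hasDerivAt_id (0 : ℝ)).mul_const (p j) |>.const_add (inner ℝ p x)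
  have h2 := (h1.ofReal_comp.const_mul Complex.I).cexp
  simp only [zero_smul, add_zero] at h2
  refine h2.congr_deriv ?_
  rw [mul_comm]

theorem spatialFourier_lineDerivOp (G : 𝓢(Spacetime, ℂ)) (t : ℝ) (p : Space) (j : Fin 3) :
    spatialFourier (∂_{basisVec j.succ} G : 𝓢(Spacetime, ℂ)) t p =
      -(Complex.I * p j) * spatialFourier G t p := by
  have h := integral_bilinear_hasLineDerivAt_right_eq_neg_left_of_integrable (μ := volume)
    (f := planeWave p) (f' := fun x => Complex.I * p j * planeWave p x)
    (g := fun x => G (event t x))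
    (g' := fun x => (∂_{basisVec j.succ} G : 𝓢(Spacetime, ℂ)) (event t x))
    (v := EuclideanSpace.single j 1)
    (B := ContinuousLinearMap.mul ℝ ℂ) ?_ ?_ ?_ (fun x _ => hasLineDerivAt_planeWave p x j)
    (fun x _ => hasLineDerivAt_slice G t j x)
  · simp only [ContinuousLinearMap.mul_apply'] at h
    rw [spatialFourier, h, spatialFourier]
    simp only [mul_assoc, integral_const_mul]
    ring
  · simp only [ContinuousLinearMap.mul_apply', mul_assoc]
    exact ((integrable_planeWave_mul (integrable_slice G t) p).const_mul _).const_mul _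
  · exact integrable_planeWave_mul (integrable_slice _ t) p
  · exact integrable_planeWave_mul (integrable_slice _ t) p

theorem spatialFourier_add (G H : 𝓢(Spacetime, ℂ)) (t : ℝ) (p : Space) :
    spatialFourier (G + H : 𝓢(Spacetime, ℂ)) t p = spatialFourier G t p + spatialFourier H t p := by
  unfold spatialFourier
  rw [← integral_add (integrable_planeWave_mul (integrable_slice _ t) p)
    (integrable_planeWave_mul (integrable_slice _ t) p)]
  simp [mul_add]

theorem spatialFourier_sub (G H : 𝓢(Spacetime, ℂ)) (t : ℝ) (p : Space) :
    spatialFourier (G - H : 𝓢(Spacetime, ℂ)) t p = spatialFourier G t p - spatialFourier H t p := by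
  unfold spatialFourier
  rw [← integral_sub (integrable_planeWave_mul (integrable_slice _ t) p)
    (integrable_planeWave_mul (integrable_slice _ t) p)]
  simp [mul_sub]

/-- Used twice, this supplies a factor `(1 + |p|²)²` that can be divided off in momentum space, so
that smoothness of the test function becomes absolute convergence of the momentum integral. -/
theorem spatialFourier_bessel (G : 𝓢(Spacetime, ℂ)) (t : ℝ) (p : Space) :
    spatialFourier (bessel G) t p = ((1 + ‖p‖ ^ 2 : ℝ) : ℂ) * spatialFourier G t p := by
  rw [bessel, spatialFourier_sub]
  simp only [Fin.sum_univ_three, spatialFourier_add, spatialFourier_lineDerivOp]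
  rw [EuclideanSpace.norm_sq_eq, Fin.sum_univ_three]
  simp only [Real.norm_eq_abs, sq_abs]
  push_cast
  linear_combination (-(p 0 : ℂ) ^ 2 - p 1 ^ 2 - p 2 ^ 2) * spatialFourier G t p * Complex.I_sq

/-- The integral kernel of the propagators after two applications of `1 - Δ`. -/
def kernel (τ : ℝ → ℝ) (ρ : ℝ → ℝ) (z : ℝ × ℝ × Space × Space) : ℂ :=
  Complex.I / (2 * (Real.pi : ℂ)) ^ 3 * ((ρ z.1 : ℂ) *
    (freqFactor τ z.1 z.2.1 z.2.2.1 * ((((1 + ‖z.2.2.1‖ ^ 2) ^ 2 : ℝ) : ℂ)⁻¹ *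
      planeWave z.2.2.1 z.2.2.2)))

/-- The measure on masses, times, momenta and positions. -/
def kernelMeasure : Measure (ℝ × ℝ × Space × Space) :=
  (volume.restrict (Set.Ioi (0 : ℝ))).prod (volume.prod (volume.prod volume))

/-- The function that dominates `kernel`. -/
def kernelWeight (ρ : ℝ → ℝ) (z : ℝ × ℝ × Space × Space) : ℝ :=
  |ρ z.1| * ((1 + z.2.1 ^ 2)⁻¹ * (momentumWeight z.2.2.1 * ((1 + ‖z.2.2.2‖ ^ 2) ^ 2)⁻¹))

theorem integrable_kernelWeight {ρ : ℝ → ℝ} (hρ : IntegrableOn ρ (Set.Ioi 0)) :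
    Integrable (kernelWeight ρ) kernelMeasure :=
  Integrable.mul_prod (Integrable.abs hρ) (integrable_time_weight.mul_prod
    (integrable_momentumWeight.mul_prod integrable_space_weight))

/-- Bounding `ω` below by `|p|` gives an estimate uniform in `λ` and `t`, so the mass integral needs
only integrability of `ρ`. At `p = 0` the weight is `0` by the convention `0⁻¹ = 0`, which is why
that null set is excluded. -/
theorem norm_freqFactor_mul_le (τ : ℝ → ℝ) (lam t : ℝ) (p x : Space) (hp : p ≠ 0) :
    ‖freqFactor τ lam t p * ((((1 + ‖p‖ ^ 2) ^ 2 : ℝ) : ℂ)⁻¹ * planeWave p x)‖ ≤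
      momentumWeight p := by
  rw [norm_mul, norm_mul, norm_freqFactor, norm_planeWave, mul_one, momentumWeight, norm_inv,
    Complex.norm_real, Real.norm_of_nonneg (by positivity)]
  have : 0 < ‖p‖ := norm_pos_iff.2 hp
  gcongr
  exact norm_le_energy lam p

/-- The prefactor of the propagators has modulus at most one. -/
theorem norm_prefactor_le : ‖Complex.I / (2 * (Real.pi : ℂ)) ^ 3‖ ≤ 1 := by
  rw [norm_div, Complex.norm_I, norm_pow, norm_mul, Complex.norm_real,
    Real.norm_of_nonneg Real.pi_pos.le, Complex.norm_ofNat]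
  rw [div_le_one (by have := Real.pi_pos; positivity)]
  exact one_le_pow₀ (by nlinarith [Real.pi_gt_three])

theorem aestronglyMeasurable_kernel {τ : ℝ → ℝ} (hτ : Continuous τ) {ρ : ℝ → ℝ}
    (hρ : IntegrableOn ρ (Set.Ioi 0)) :
    AEStronglyMeasurable (kernel τ ρ) kernelMeasure := by
  unfold kernel
  refine AEStronglyMeasurable.const_mul (AEStronglyMeasurable.mul ?_ ?_) _
  · exact (Complex.continuous_ofReal.comp_aestronglyMeasurable hρ.1).comp_fst
  · refine Measurable.aestronglyMeasurable ?_
    refine Measurable.mul ?_ (Measurable.mul ?_ ?_)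
    · exact (measurable_freqFactor hτ).comp
        (f := fun z : ℝ × ℝ × Space × Space => (z.1, z.2.1, z.2.2.1)) (by fun_prop)
    · fun_prop
    · exact continuous_planeWave.measurable.comp
        (f := fun z : ℝ × ℝ × Space × Space => (z.2.2.1, z.2.2.2)) (by fun_prop)

theorem ae_momentum_ne_zero : ∀ᵐ z ∂kernelMeasure, z.2.2.1 ≠ 0 := by
  have h1 : ∀ᵐ p : Space, p ≠ 0 := by simp [ae_iff]
  have h2 : ∀ᵐ z : Space × Space ∂(volume.prod volume), z.1 ≠ 0 :=
    Measure.quasiMeasurePreserving_fst.ae h1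
  have h3 : ∀ᵐ z : ℝ × Space × Space ∂(volume.prod (volume.prod volume)), z.2.1 ≠ 0 :=
    Measure.quasiMeasurePreserving_snd.ae h2
  exact Measure.quasiMeasurePreserving_snd.ae h3

theorem norm_kernel_mul_le (τ : ℝ → ℝ) (ρ : ℝ → ℝ) (z : ℝ × ℝ × Space × Space)
    (hz : z.2.2.1 ≠ 0) {C : ℝ} {u : ℝ} (hu : u ≤ C * decay z.2.1 z.2.2.2)
    (hu0 : 0 ≤ u) :
    ‖kernel τ ρ z‖ * u ≤ C * kernelWeight ρ z := by
  have h1 : ‖kernel τ ρ z‖ ≤ 1 * (|ρ z.1| * momentumWeight z.2.2.1) := by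
    rw [kernel, norm_mul, norm_mul (ρ z.1 : ℂ), Complex.norm_real, Real.norm_eq_abs]
    gcongr
    · exact norm_prefactor_le
    · exact norm_freqFactor_mul_le τ _ _ _ _ hz
  calc ‖kernel τ ρ z‖ * u ≤ (1 * (|ρ z.1| * momentumWeight z.2.2.1)) *
        (C * decay z.2.1 z.2.2.2) := by
        gcongr
        exact (norm_nonneg _).trans h1
    _ = _ := by unfold kernelWeight decay; ring

/-- Vector values are allowed so that the same bound serves a Schwartz function and its Fréchet
derivative. -/
theorem integrable_kernel_mul {τ : ℝ → ℝ} (hτ : Continuous τ) {ρ : ℝ → ℝ}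
    (hρ : IntegrableOn ρ (Set.Ioi 0)) {F : Type*} [NormedAddCommGroup F] [NormedSpace ℝ F]
    [NormedSpace ℂ F] (G : 𝓢(Spacetime, F)) (a : Spacetime) :
    Integrable (fun z => kernel τ ρ z • G (a + event z.2.1 z.2.2.2)) kernelMeasure := by
  obtain ⟨C, hC0, hC⟩ := schwartz_event_bound G ‖a‖
  refine Integrable.mono' ((integrable_kernelWeight hρ).const_mul C) ?_ ?_
  · refine (aestronglyMeasurable_kernel hτ hρ).smul ?_
    refine Continuous.aestronglyMeasurable (G.continuous.comp ?_)
    exact continuous_const.add (continuous_event.comp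
      (f := fun z : ℝ × ℝ × Space × Space => (z.2.1, z.2.2.2)) (by fun_prop))
  · filter_upwards [ae_momentum_ne_zero] with z hz
    rw [norm_smul]
    exact norm_kernel_mul_le τ ρ z hz (hC a _ _ le_rfl) (norm_nonneg _)

/-- The smeared propagators as absolutely convergent integrals. -/
theorem offShell_eq_integral {τ : ℝ → ℝ} (hτ : Continuous τ) {ρ : ℝ → ℝ}
    (hρ : IntegrableOn ρ (Set.Ioi 0)) (G : 𝓢(Spacetime, ℂ)) :
    offShell τ ρ G =
      ∫ z, kernel τ ρ z * bessel (bessel G) (event z.2.1 z.2.2.2) ∂kernelMeasure := by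
  have hI := integrable_kernel_mul hτ hρ (bessel (bessel G)) 0
  simp only [zero_add, smul_eq_mul] at hI
  obtain ⟨C, hC0, hC⟩ := schwartz_event_bound (bessel (bessel G)) 0
  have hC' : ∀ t x, ‖bessel (bessel G) (event t x)‖ ≤ C * decay t x := fun t x => by
    simpa using hC 0 t x (by simp)
  have hm : Measurable (fun z : ℝ × ℝ × Space × Space =>
      freqFactor τ z.1 z.2.1 z.2.2.1 * ((((1 + ‖z.2.2.1‖ ^ 2) ^ 2 : ℝ) : ℂ)⁻¹ *
      planeWave z.2.2.1 z.2.2.2) * bessel (bessel G) (event z.2.1 z.2.2.2)) := by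
    refine Measurable.mul (Measurable.mul ?_ (Measurable.mul ?_ ?_)) ?_
    · exact (measurable_freqFactor hτ).comp
        (f := fun z : ℝ × ℝ × Space × Space => (z.1, z.2.1, z.2.2.1)) (by fun_prop)
    · fun_prop
    · exact continuous_planeWave.measurable.comp
        (f := fun z : ℝ × ℝ × Space × Space => (z.2.2.1, z.2.2.2)) (by fun_prop)
    · exact ((bessel (bessel G)).continuous.comp continuous_event).measurable.comp
        (f := fun z : ℝ × ℝ × Space × Space => (z.2.1, z.2.2.2)) (by fun_prop)
  have hb : ∀ (lam t : ℝ) (p x : Space), p ≠ 0 →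
      ‖freqFactor τ lam t p * ((((1 + ‖p‖ ^ 2) ^ 2 : ℝ) : ℂ)⁻¹ * planeWave p x) *
        bessel (bessel G) (event t x)‖ ≤
      C * ((1 + t ^ 2)⁻¹ * (momentumWeight p * ((1 + ‖x‖ ^ 2) ^ 2)⁻¹)) := by
    intro lam t p x hp
    rw [norm_mul]
    calc _ ≤ momentumWeight p * (C * decay t x) :=
          mul_le_mul (norm_freqFactor_mul_le τ lam t p x hp) (hC' t x) (norm_nonneg _)
            (by unfold momentumWeight; positivity)
      _ = _ := by unfold decay; ring
  have hp1 : ∀ᵐ p : Space, p ≠ 0 := by simp [ae_iff]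
  have hp2 : ∀ᵐ z : Space × Space ∂(volume.prod volume), z.1 ≠ 0 :=
    Measure.quasiMeasurePreserving_fst.ae hp1
  have hp3 : ∀ᵐ z : ℝ × Space × Space ∂(volume.prod (volume.prod volume)), z.2.1 ≠ 0 :=
    Measure.quasiMeasurePreserving_snd.ae hp2
  have hw2 := integrable_momentumWeight.mul_prod integrable_space_weight
  -- Integrability is needed for every fixed `λ`, and below for every fixed `λ` and `t`, to apply
  -- Fubini fibrewise. The factor `ρ` is left out, so the bound does not depend on `λ`.
  have h3 : ∀ lam : ℝ, Integrable (fun z : ℝ × Space × Space =>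
      freqFactor τ lam z.1 z.2.1 * ((((1 + ‖z.2.1‖ ^ 2) ^ 2 : ℝ) : ℂ)⁻¹ *
      planeWave z.2.1 z.2.2) * bessel (bessel G) (event z.1 z.2.2))
      (volume.prod (volume.prod volume)) := by
    intro lam
    refine Integrable.mono' ((integrable_time_weight.mul_prod hw2).const_mul C)
      (hm.comp (measurable_prodMk_left (x := lam))).aestronglyMeasurable ?_
    filter_upwards [hp3] with z hz
    exact hb lam z.1 z.2.1 z.2.2 hz
  have h2 : ∀ lam t : ℝ, Integrable (fun z : Space × Space =>
      freqFactor τ lam t z.1 * ((((1 + ‖z.1‖ ^ 2) ^ 2 : ℝ) : ℂ)⁻¹ *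
      planeWave z.1 z.2) * bessel (bessel G) (event t z.2)) (volume.prod volume) := by
    intro lam t
    refine Integrable.mono' ((hw2.const_mul (1 + t ^ 2)⁻¹).const_mul C)
      (hm.comp ((measurable_prodMk_left (x := lam)).comp
        (measurable_prodMk_left (x := t)))).aestronglyMeasurable ?_
    filter_upwards [hp2] with z hz
    exact hb lam t z.1 z.2 hz
  rw [kernelMeasure] at hI ⊢
  rw [integral_prod _ hI, offShell]
  refine integral_congr_ae (Filter.Eventually.of_forall fun lam => ?_)
  simp only [kernel, massKernel_eq]
  have e : ∀ z : ℝ × Space × Space, Complex.I / (2 * (Real.pi : ℂ)) ^ 3 * ((ρ lam : ℂ) *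
      (freqFactor τ lam z.1 z.2.1 * ((((1 + ‖z.2.1‖ ^ 2) ^ 2 : ℝ) : ℂ)⁻¹ *
      planeWave z.2.1 z.2.2))) * bessel (bessel G) (event z.1 z.2.2) =
      (ρ lam : ℂ) * (Complex.I / (2 * (Real.pi : ℂ)) ^ 3) * (freqFactor τ lam z.1 z.2.1 *
      ((((1 + ‖z.2.1‖ ^ 2) ^ 2 : ℝ) : ℂ)⁻¹ * planeWave z.2.1 z.2.2) *
      bessel (bessel G) (event z.1 z.2.2)) := fun z => by ring
  simp only [e]
  rw [integral_const_mul, integral_prod _ (h3 lam), mul_assoc]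
  congr 2
  refine integral_congr_ae (Filter.Eventually.of_forall fun t => ?_)
  simp only
  rw [integral_prod _ (h2 lam t)]
  refine integral_congr_ae (Filter.Eventually.of_forall fun p => ?_)
  simp only [mul_assoc, integral_const_mul]
  congr 1
  -- The innermost integral is the spatial Fourier transform of `(1 - Δ)² G`, whose factor `(1 +
  -- |p|²)²` cancels the one in the kernel.
  rw [← spatialFourier, spatialFourier_bessel, spatialFourier_bessel]
  have : ((1 + ‖p‖ ^ 2 : ℝ) : ℂ) ≠ 0 := by
    norm_cast; positivity
  push_cast at this ⊢
  field_simp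

theorem bessel_add (G H : 𝓢(Spacetime, ℂ)) : bessel (G + H) = bessel G + bessel H := by
  simp only [bessel, LineDeriv.lineDerivOp_add, Finset.sum_add_distrib]
  abel

theorem bessel_lineDerivOp (v : Spacetime) (G : 𝓢(Spacetime, ℂ)) :
    bessel (∂_{v} G) = ∂_{v} (bessel G) := by
  simp only [bessel, sub_eq_add_neg, LineDeriv.lineDerivOp_add, LineDeriv.lineDerivOp_neg,
    LineDeriv.lineDerivOp_sum]
  simp only [lineDerivOp_comm v]

/-- The translate `ξ ↦ G(a + ξ)`. -/
def translate (a : Spacetime) (G : 𝓢(Spacetime, ℂ)) : 𝓢(Spacetime, ℂ) :=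
  G.compSubConstCLM ℂ (-a)

theorem translate_apply (a : Spacetime) (G : 𝓢(Spacetime, ℂ)) (ξ : Spacetime) :
    translate a G ξ = G (a + ξ) := by
  simp [translate, add_comm]

theorem lineDerivOp_translate (v a : Spacetime) (G : 𝓢(Spacetime, ℂ)) :
    ∂_{v} (translate a G) = translate a (∂_{v} G) := by
  ext ξ
  rw [translate_apply, SchwartzMap.lineDerivOp_apply_eq_fderiv,
    SchwartzMap.lineDerivOp_apply_eq_fderiv]
  have : (⇑(translate a G) : Spacetime → ℂ) = fun ξ => G (a + ξ) := by
    ext ξ; rw [translate_apply]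
  rw [this, fderiv_comp_add_left]

theorem bessel_translate (a : Spacetime) (G : 𝓢(Spacetime, ℂ)) :
    bessel (translate a G) = translate a (bessel G) := by
  have h : ∀ G H : 𝓢(Spacetime, ℂ), translate a (G - H) = translate a G - translate a H :=
    fun G H => map_sub (SchwartzMap.compSubConstCLM ℂ (-a)) G H
  have h' : ∀ F : Fin 3 → 𝓢(Spacetime, ℂ), translate a (∑ j, F j) = ∑ j, translate a (F j) :=
    fun F => map_sum (SchwartzMap.compSubConstCLM ℂ (-a)) F _
  simp only [bessel, h, h', lineDerivOp_translate]

theorem offShell_add {τ : ℝ → ℝ} (hτ : Continuous τ) {ρ : ℝ → ℝ}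
    (hρ : IntegrableOn ρ (Set.Ioi 0)) (G H : 𝓢(Spacetime, ℂ)) :
    offShell τ ρ (fun ξ => G ξ + H ξ) = offShell τ ρ G + offShell τ ρ H := by
  have h1 := integrable_kernel_mul hτ hρ (bessel (bessel G)) 0
  have h2 := integrable_kernel_mul hτ hρ (bessel (bessel H)) 0
  simp only [zero_add, smul_eq_mul] at h1 h2
  change offShell τ ρ ⇑(G + H) = _
  rw [offShell_eq_integral hτ hρ, offShell_eq_integral hτ hρ, offShell_eq_integral hτ hρ,
    ← integral_add h1 h2, bessel_add, bessel_add]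
  simp [mul_add]

/-- The translation now sits on the smooth factor of an absolutely convergent integral, where one
can differentiate under the integral sign. -/
theorem offShell_translate {τ : ℝ → ℝ} (hτ : Continuous τ) {ρ : ℝ → ℝ}
    (hρ : IntegrableOn ρ (Set.Ioi 0)) (G : 𝓢(Spacetime, ℂ)) (a : Spacetime) :
    offShell τ ρ (fun ξ => G (a + ξ)) =
      ∫ z, kernel τ ρ z * bessel (bessel G) (a + event z.2.1 z.2.2.2) ∂kernelMeasure := by
  have : (fun ξ => G (a + ξ)) = translate a G := by ext ξ; rw [translate_apply]
  rw [this, offShell_eq_integral hτ hρ, bessel_translate, bessel_translate]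
  simp only [translate_apply]

/-- The derivative is the same functional applied to `∂_v G`, again a Schwartz function, so the
statement iterates and yields smoothness. -/
theorem hasFDerivAt_offShell_translate {τ : ℝ → ℝ} (hτ : Continuous τ) {ρ : ℝ → ℝ}
    (hρ : IntegrableOn ρ (Set.Ioi 0)) (G : 𝓢(Spacetime, ℂ)) (a : Spacetime) :
    ∃ D : Spacetime →L[ℝ] ℂ,
      HasFDerivAt (fun a => offShell τ ρ (fun ξ => G (a + ξ))) D a ∧
      ∀ v, D v = offShell τ ρ (fun ξ => (∂_{v} G : 𝓢(Spacetime, ℂ)) (a + ξ)) := by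
  set L := bessel (bessel G) with hL
  set L' : 𝓢(Spacetime, Spacetime →L[ℝ] ℂ) := SchwartzMap.fderivCLM ℝ Spacetime ℂ L with hL'
  obtain ⟨C, hC0, hC⟩ := schwartz_event_bound L' (‖a‖ + 1)
  have hd : HasFDerivAt (fun a => ∫ z, kernel τ ρ z * L (a + event z.2.1 z.2.2.2) ∂kernelMeasure)
      (∫ z, kernel τ ρ z • L' (a + event z.2.1 z.2.2.2) ∂kernelMeasure) a := by
    refine hasFDerivAt_integral_of_dominated_of_fderiv_le (𝕜 := ℝ)
      (s := Metric.ball a 1) (Metric.ball_mem_nhds a one_pos)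
      (bound := fun z => C * kernelWeight ρ z)
      (F' := fun a z => kernel τ ρ z • L' (a + event z.2.1 z.2.2.2)) ?_ ?_ ?_ ?_ ?_ ?_
    · exact Filter.Eventually.of_forall fun b => (integrable_kernel_mul hτ hρ L b).1
    · exact integrable_kernel_mul hτ hρ L a
    · exact (integrable_kernel_mul hτ hρ L' a).1
    · filter_upwards [ae_momentum_ne_zero] with z hz b hb
      rw [norm_smul]
      refine norm_kernel_mul_le τ ρ z hz (hC b _ _ ?_) (norm_nonneg _)
      have : ‖b - a‖ < 1 := by simpa [dist_eq_norm] using hb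
      have h2 : ‖b‖ ≤ ‖b - a‖ + ‖a‖ := by simpa using norm_add_le (b - a) a
      linarith
    · exact (integrable_kernelWeight hρ).const_mul C
    · refine Filter.Eventually.of_forall fun z b _ => ?_
      have h1 : HasFDerivAt (fun b => L (b + event z.2.1 z.2.2.2))
          (L' (b + event z.2.1 z.2.2.2)) b := by
        rw [hL', SchwartzMap.fderivCLM_apply]
        exact (hasFDerivAt_comp_add_right _).2 (L.hasFDerivAt _)
      exact h1.const_smul (kernel τ ρ z)
  refine ⟨_, by simpa only [offShell_translate hτ hρ] using hd, fun v => ?_⟩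
  rw [offShell_translate hτ hρ, bessel_lineDerivOp, bessel_lineDerivOp, ← hL,
    ContinuousLinearMap.integral_apply (integrable_kernel_mul hτ hρ L' a)]
  refine integral_congr_ae (Filter.Eventually.of_forall fun z => ?_)
  simp only [smul_apply, smul_eq_mul, hL', SchwartzMap.fderivCLM_apply,
    SchwartzMap.lineDerivOp_apply_eq_fderiv]

theorem contDiff_offShell_translate {τ : ℝ → ℝ} (hτ : Continuous τ) {ρ : ℝ → ℝ}
    (hρ : IntegrableOn ρ (Set.Ioi 0)) (G : 𝓢(Spacetime, ℂ)) :
    ContDiff ℝ (⊤ : ℕ∞) fun a => offShell τ ρ (fun ξ => G (a + ξ)) := by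
  rw [contDiff_infty]
  intro n
  induction n generalizing G with
  | zero =>
    rw [Nat.cast_zero, contDiff_zero, continuous_iff_continuousAt]
    intro a
    obtain ⟨D, hD, _⟩ := hasFDerivAt_offShell_translate hτ hρ G a
    exact hD.continuousAt
  | succ n ih =>
    rw [Nat.cast_succ, contDiff_succ_iff_fderiv_apply]
    refine ⟨fun a => (hasFDerivAt_offShell_translate hτ hρ G a).choose_spec.1.differentiableAt,
      by simp, fun v => ?_⟩
    convert ih (∂_{v} G) using 1
    ext a
    obtain ⟨D, hD, hDv⟩ := hasFDerivAt_offShell_translate hτ hρ G a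
    rw [hD.fderiv, hDv]

/-! ### Finite propagation speed -/

/-- `∫₀ᵗ s sin(k s) / k ds` in closed form. -/
def sinMoment (k t : ℝ) : ℝ := (Real.sin (t * k) - t * k * Real.cos (t * k)) / k ^ 3

theorem abs_sin_div_le (k t : ℝ) : |Real.sin (t * k) / k| ≤ |t| := by
  rcases eq_or_ne k 0 with rfl | hk
  · simp
  · rw [abs_div, div_le_iff₀ (abs_pos.2 hk), ← abs_mul]
    exact Real.abs_sin_le_abs

theorem hasDerivAt_sinMoment {k : ℝ} (hk : k ≠ 0) (t : ℝ) :
    HasDerivAt (sinMoment k) (t * (Real.sin (t * k) / k)) t := by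
  have h0 : HasDerivAt (fun t : ℝ => t * k) k t := by
    simpa using (hasDerivAt_id t).mul_const k
  have h1 := (h0.sin.sub (h0.mul h0.cos)).div_const (k ^ 3)
  refine h1.congr_deriv ?_
  field_simp
  ring

theorem integral_mul_sin_div {k : ℝ} (hk : k ≠ 0) (t : ℝ) :
    ∫ s in (0 : ℝ)..t, s * (Real.sin (s * k) / k) = sinMoment k t := by
  rw [intervalIntegral.integral_eq_sub_of_hasDerivAt (fun s _ => hasDerivAt_sinMoment hk s)]
  · simp [sinMoment]
  · exact Continuous.intervalIntegrable (by fun_prop) _ _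

/-- Read off from the integral form, which is bounded uniformly in `k`; the closed form hides the
cancellation near `k = 0`. -/
theorem abs_sinMoment_le {k : ℝ} (hk : k ≠ 0) {t : ℝ} (ht : 0 ≤ t) : |sinMoment k t| ≤ t ^ 3 := by
  rw [← integral_mul_sin_div hk]
  have := intervalIntegral.norm_integral_le_of_norm_le_const (a := 0) (b := t) (C := t ^ 2)
    (f := fun s => s * (Real.sin (s * k) / k)) ?_
  · simp only [Real.norm_eq_abs, sub_zero, abs_of_nonneg ht] at this
    linarith [this, pow_succ t 2]
  · intro s hs
    rw [Set.uIoc_of_le ht] at hs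
    rw [Real.norm_eq_abs, abs_mul, sq]
    have h1 := abs_sin_div_le k s
    rw [abs_of_pos hs.1] at h1 ⊢
    exact mul_le_mul hs.2 (h1.trans hs.2) (abs_nonneg _) ht

theorem energy_pos {p : Space} (hp : p ≠ 0) (lam : ℝ) : 0 < energy lam p :=
  (norm_pos_iff.2 hp).trans_le (norm_le_energy lam p)

/-- The point is that `sinMoment` is the integral of `s sin(sω)/ω` over `0 ≤ s ≤ t`: differentiating
in the mass reproduces the same function at earlier times. -/
theorem hasDerivAt_sin_energy {p : Space} (hp : p ≠ 0) (t lam : ℝ) :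
    HasDerivAt (fun lam => Real.sin (t * energy lam p) / energy lam p)
      (-lam * sinMoment (energy lam p) t) lam := by
  have hpos := energy_pos hp lam
  have hsq : 0 < ‖p‖ ^ 2 + lam ^ 2 := by have := norm_pos_iff.2 hp; positivity
  have h0 : HasDerivAt (fun lam => energy lam p) (lam / energy lam p) lam := by
    unfold energy
    have := ((hasDerivAt_pow 2 lam).const_add (‖p‖ ^ 2)).sqrt hsq.ne'
    refine this.congr_deriv ?_
    have : Real.sqrt (‖p‖ ^ 2 + lam ^ 2) ≠ 0 := (Real.sqrt_pos.2 hsq).ne'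
    field_simp
    norm_num
  have h1 := (h0.const_mul t).sin.div h0 hpos.ne'
  refine h1.congr_deriv ?_
  unfold sinMoment
  field_simp
  ring

/-! ### The sine pairing and its dependence on the mass -/

/-- `∫ d³p sin(ω t)/ω G(p)`. -/
def sinePairing (G : Space → ℂ) (t lam : ℝ) : ℂ :=
  ∫ p : Space, ((Real.sin (t * energy lam p) / energy lam p : ℝ) : ℂ) * G p

theorem continuous_energy_right (lam : ℝ) : Continuous fun p : Space => energy lam p :=
  continuous_energy.comp (f := fun p => (lam, p)) (by fun_prop)

theorem ae_ne_zero : ∀ᵐ p : Space, p ≠ 0 := by simp [ae_iff]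

theorem integrable_sine_mul {G : Space → ℂ} (hG : Integrable G) (t lam : ℝ) :
    Integrable fun p => ((Real.sin (t * energy lam p) / energy lam p : ℝ) : ℂ) * G p := by
  refine hG.bdd_mul (c := |t|) ?_ ?_
  · have := (continuous_energy_right lam).measurable
    exact (by fun_prop : Measurable _).aestronglyMeasurable
  · refine Filter.Eventually.of_forall fun p => ?_
    rw [Complex.norm_real, Real.norm_eq_abs]
    exact abs_sin_div_le _ _

theorem norm_sinePairing_le {G : Space → ℂ} (hG : Integrable G) {t T : ℝ} (ht : 0 ≤ t)
    (hT : t ≤ T) (lam : ℝ) : ‖sinePairing G t lam‖ ≤ T * ∫ p, ‖G p‖ := by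
  rw [sinePairing, ← integral_const_mul]
  refine norm_integral_le_of_norm_le (hG.norm.const_mul T)
    (Filter.Eventually.of_forall fun p => ?_)
  rw [norm_mul, Complex.norm_real, Real.norm_eq_abs]
  gcongr
  exact (abs_sin_div_le _ _).trans (by rwa [abs_of_nonneg ht])

theorem integrable_sinMoment_mul {G : Space → ℂ} (hG : Integrable G) {t : ℝ} (ht : 0 ≤ t)
    (lam : ℝ) : Integrable fun p => ((sinMoment (energy lam p) t : ℝ) : ℂ) * G p := by
  refine hG.bdd_mul (c := t ^ 3) ?_ ?_
  · have := (continuous_energy_right lam).measurable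
    unfold sinMoment
    exact (by fun_prop : Measurable _).aestronglyMeasurable
  · filter_upwards [ae_ne_zero] with p hp
    rw [Complex.norm_real, Real.norm_eq_abs]
    exact abs_sinMoment_le (energy_pos hp lam).ne' ht

theorem continuous_sinePairing {G : Space → ℂ} (hG : Integrable G) (lam : ℝ) :
    Continuous fun t => sinePairing G t lam := by
  rw [continuous_iff_continuousAt]
  intro t
  refine continuousAt_of_dominated (bound := fun p => (|t| + 1) * ‖G p‖) ?_ ?_ ?_ ?_
  · exact Filter.Eventually.of_forall fun s => (integrable_sine_mul hG s lam).1
  · filter_upwards [Metric.ball_mem_nhds t one_pos] with s hs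
    refine Filter.Eventually.of_forall fun p => ?_
    rw [norm_mul, Complex.norm_real, Real.norm_eq_abs]
    gcongr
    refine (abs_sin_div_le _ _).trans ?_
    have : |s - t| < 1 := by simpa [Real.dist_eq] using hs
    have h2 : |s| ≤ |s - t| + |t| := by simpa using abs_add_le (s - t) t
    linarith
  · exact hG.norm.const_mul _
  · refine Filter.Eventually.of_forall fun p => Continuous.continuousAt ?_
    fun_prop

theorem integral_mul_sinePairing {G : Space → ℂ} (hG : Integrable G) {t : ℝ} (ht : 0 ≤ t)
    (lam : ℝ) : ∫ s in (0 : ℝ)..t, (s : ℂ) * sinePairing G s lam =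
      ∫ p : Space, ((sinMoment (energy lam p) t : ℝ) : ℂ) * G p := by
  rw [intervalIntegral.integral_of_le ht]
  simp only [sinePairing, ← integral_const_mul]
  rw [integral_integral_swap]
  · refine integral_congr_ae ?_
    filter_upwards [ae_ne_zero] with p hp
    rw [← integral_mul_sin_div (energy_pos hp lam).ne', intervalIntegral.integral_of_le ht,
      ← integral_complex_ofReal, ← integral_mul_const]
    refine integral_congr_ae (Filter.Eventually.of_forall fun s => ?_)
    push_cast; ring
  · have hw : Integrable (fun z : ℝ × Space => t ^ 2 * ‖G z.2‖)
        ((volume.restrict (Set.Ioc 0 t)).prod volume) := by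
      have h1 : Integrable (fun _ : ℝ => t ^ 2) (volume.restrict (Set.Ioc 0 t)) := by simp
      exact h1.mul_prod hG.norm
    refine Integrable.mono' hw ?_ ?_
    · have he : Measurable fun z : ℝ × Space => energy lam z.2 :=
        ((continuous_energy_right lam).comp continuous_snd).measurable
      simp only [Function.uncurry_def]
      refine AEStronglyMeasurable.mul (Continuous.aestronglyMeasurable (by fun_prop))
        (AEStronglyMeasurable.mul ?_ hG.1.comp_snd)
      exact (by fun_prop : Measurable _).aestronglyMeasurable
    · have : ∀ᵐ z : ℝ × Space ∂((volume.restrict (Set.Ioc 0 t)).prod volume), z.1 ∈ Set.Ioc 0 t :=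
        Measure.quasiMeasurePreserving_fst.ae (ae_restrict_mem measurableSet_Ioc)
      filter_upwards [this] with z hz
      simp only [Function.uncurry_def, norm_mul, Complex.norm_real, Real.norm_eq_abs]
      rw [← mul_assoc, sq]
      gcongr
      · rw [abs_of_pos hz.1]; exact hz.2
      · refine (abs_sin_div_le _ _).trans ?_
        rw [abs_of_pos hz.1]; exact hz.2

/-- A closed evolution equation in `λ` of Volterra type: the right side involves only times between
`0` and `t`, so vanishing on a time interval is propagated from one mass to another. -/
theorem hasDerivAt_sinePairing {G : Space → ℂ} (hG : Integrable G) {t : ℝ} (ht : 0 ≤ t)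
    (lam : ℝ) : HasDerivAt (sinePairing G t)
      (-lam * ∫ s in (0 : ℝ)..t, (s : ℂ) * sinePairing G s lam) lam := by
  rw [integral_mul_sinePairing hG ht, ← integral_const_mul]
  refine (hasDerivAt_integral_of_dominated_loc_of_deriv_le
    (F := fun lam p => ((Real.sin (t * energy lam p) / energy lam p : ℝ) : ℂ) * G p)
    (F' := fun lam p => -lam * (((sinMoment (energy lam p) t : ℝ) : ℂ) * G p))
    (s := Metric.ball lam 1) (bound := fun p => (|lam| + 1) * (t ^ 3 * ‖G p‖))
    (Metric.ball_mem_nhds lam one_pos) ?_ (integrable_sine_mul hG t lam) ?_ ?_ ?_ ?_).2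
  · exact Filter.Eventually.of_forall fun l => (integrable_sine_mul hG t l).1
  · exact (integrable_sinMoment_mul hG ht lam).1.const_mul _
  · filter_upwards [ae_ne_zero] with p hp l hl
    rw [norm_mul, norm_neg, Complex.norm_real, norm_mul, Complex.norm_real, Real.norm_eq_abs,
      Real.norm_eq_abs]
    gcongr
    · have : |l - lam| < 1 := by simpa [Real.dist_eq] using hl
      have h2 : |l| ≤ |l - lam| + |lam| := by simpa using abs_add_le (l - lam) lam
      linarith
    · exact abs_sinMoment_le (energy_pos hp l).ne' ht
  · exact (hG.norm.const_mul _).const_mul _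
  · filter_upwards [ae_ne_zero] with p hp l _
    refine ((hasDerivAt_sin_energy hp t l).ofReal_comp.mul_const (G p)).congr_deriv ?_
    push_cast; ring

/-- If the massless pairing vanishes up to time `T`, so does the massive one. -/
theorem sinePairing_eq_zero_of_massless {G : Space → ℂ} (hG : Integrable G) {T : ℝ}
    (h0 : ∀ t, 0 ≤ t → t ≤ T → sinePairing G t 0 = 0) {t : ℝ} (ht : 0 ≤ t) (htT : t ≤ T)
    {lam : ℝ} (hlam : 0 ≤ lam) : sinePairing G t lam = 0 := by
  have hT : 0 ≤ T := ht.trans htT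
  set K := T * ∫ p, ‖G p‖ with hK
  have hK0 : 0 ≤ K := mul_nonneg hT (integral_nonneg fun _ => norm_nonneg _)
  -- `K` is the a priori bound for the pairing. In `C`, `lam` bounds the prefactor of the mass
  -- derivative, one `T` bounds the weight `s`, and the other the length of the time interval.
  set C := lam * (T * T) with hC
  have hC0 : 0 ≤ C := by positivity
  -- Picard iteration from the massless case: integrating the evolution equation from mass `0`,
  -- where the pairing vanishes, improves the bound of order `n` to order `n + 1`.
  have key : ∀ (n : ℕ) (t l : ℝ), 0 ≤ t → t ≤ T → 0 ≤ l → l ≤ lam →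
      ‖sinePairing G t l‖ ≤ K * ((C * l) ^ n / n.factorial) := by
    intro n
    induction n with
    | zero =>
      intro t l ht htT _ _
      simpa using norm_sinePairing_le hG ht htT l
    | succ n ih =>
      intro t l ht htT hl hll
      have hB : ∀ x, HasDerivAt (fun x : ℝ => K * ((C * x) ^ (n + 1) / (n + 1).factorial))
          (K * (C * ((C * x) ^ n / n.factorial))) x := by
        intro x
        have h1 : HasDerivAt (fun x : ℝ => C * x) C x := by
          simpa using (hasDerivAt_id x).const_mul C
        refine (((h1.pow (n + 1)).div_const _).const_mul K).congr_deriv ?_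
        rw [Nat.factorial_succ]
        push_cast
        have : (n.factorial : ℝ) ≠ 0 := by positivity
        field_simp
      refine image_norm_le_of_norm_deriv_right_le_deriv_boundary (a := 0) (b := lam)
        (f := sinePairing G t) (f' := fun l => -l * ∫ s in (0 : ℝ)..t, (s : ℂ) * sinePairing G s l)
        (fun l _ => (hasDerivAt_sinePairing hG ht l).continuousAt.continuousWithinAt)
        (fun l _ => (hasDerivAt_sinePairing hG ht l).hasDerivWithinAt) ?_ hB ?_ ⟨hl, hll⟩
      · rw [h0 t ht htT]; simp
      · intro l hl
        rw [norm_mul, norm_neg, Complex.norm_real, Real.norm_of_nonneg hl.1]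
        have hb : ‖∫ s in (0 : ℝ)..t, (s : ℂ) * sinePairing G s l‖ ≤
            T * (K * ((C * l) ^ n / n.factorial)) * |t - 0| := by
          refine intervalIntegral.norm_integral_le_of_norm_le_const fun s hs => ?_
          rw [Set.uIoc_of_le ht] at hs
          rw [norm_mul, Complex.norm_real, Real.norm_of_nonneg hs.1.le]
          gcongr
          · exact hs.2.trans htT
          · exact ih s l hs.1.le (hs.2.trans htT) hl.1 hl.2.le
        rw [sub_zero, abs_of_nonneg ht] at hb
        have hX : 0 ≤ K * ((C * l) ^ n / n.factorial) := by
          have := hl.1; positivity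
        calc l * ‖∫ s in (0 : ℝ)..t, (s : ℂ) * sinePairing G s l‖
            ≤ lam * (T * (K * ((C * l) ^ n / n.factorial)) * T) := by
              refine mul_le_mul hl.2.le (hb.trans ?_) (norm_nonneg _) hlam
              gcongr
          _ = _ := by rw [hC]; ring
  have hlim : Filter.Tendsto (fun n : ℕ => K * ((C * lam) ^ n / n.factorial)) Filter.atTop
      (nhds (K * 0)) := (FloorSemiring.tendsto_pow_div_factorial_atTop _).const_mul K
  rw [mul_zero] at hlim
  have := ge_of_tendsto' hlim fun n => key n t lam ht htT hlam le_rfl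
  exact norm_le_zero_iff.1 this

/-! ### The Fourier transform of a ball and the massless case -/

/-- The point of `Space` with first coordinate `u` and remaining coordinates `z`. -/
def spaceCons (z : ℝ × EuclideanSpace ℝ (Fin 2)) : Space :=
  WithLp.toLp 2 (Fin.cons z.1 z.2.ofLp)

theorem measurePreserving_spaceCons :
    MeasurePreserving spaceCons (volume.prod volume) volume := by
  have h1 : MeasurePreserving (Prod.map id (@WithLp.ofLp 2 (Fin 2 → ℝ)))
      ((volume : Measure ℝ).prod volume) (volume.prod volume) :=
    (MeasurePreserving.id volume).prod (PiLp.volume_preserving_ofLp (Fin 2))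
  have h2 := (volume_preserving_piFinSuccAbove (fun _ : Fin 3 => ℝ) 0).symm
  have h3 := PiLp.volume_preserving_toLp (Fin 3)
  have h := h3.comp (h2.comp h1)
  have e : spaceCons = (WithLp.toLp 2) ∘
      (MeasurableEquiv.piFinSuccAbove (fun _ : Fin 3 => ℝ) 0).symm ∘
      Prod.map id (@WithLp.ofLp 2 (Fin 2 → ℝ)) := by
    funext z
    simp [spaceCons, MeasurableEquiv.piFinSuccAbove, Fin.insertNthEquiv]
  rw [e]
  exact h

theorem norm_spaceCons_sq (z : ℝ × EuclideanSpace ℝ (Fin 2)) :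
    ‖spaceCons z‖ ^ 2 = z.1 ^ 2 + ‖z.2‖ ^ 2 := by
  rw [EuclideanSpace.norm_sq_eq, EuclideanSpace.norm_sq_eq, Fin.sum_univ_succ]
  simp [spaceCons]

theorem measurableEmbedding_spaceCons : MeasurableEmbedding spaceCons := by
  have hc : Continuous spaceCons := by
    refine (PiLp.continuous_toLp 2 _).comp (continuous_pi fun i => ?_)
    refine Fin.cases ?_ (fun j => ?_) i
    · simpa using continuous_fst
    · simp only [Fin.cons_succ]
      fun_prop
  refine hc.measurableEmbedding fun z w h => ?_
  have h' : ∀ i, spaceCons z i = spaceCons w i := fun i => by rw [h]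
  refine Prod.ext (by simpa [spaceCons] using h' 0) ?_
  ext j
  simpa [spaceCons] using h' j.succ

/-- Integration over a ball of a function of the first coordinate. -/
theorem integral_ball_first {φ : ℝ → ℂ} (hφ : Continuous φ) {s : ℝ} (hs : 0 ≤ s) :
    ∫ y in Metric.ball (0 : Space) s, φ (y 0) =
      ∫ u in (-s)..s, φ u * ((Real.pi * (s ^ 2 - u ^ 2) : ℝ) : ℂ) := by
  have hI : IntegrableOn (fun y : Space => φ (y 0)) (Metric.ball (0 : Space) s) := by
    refine IntegrableOn.mono_set ?_ Metric.ball_subset_closedBall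
    exact ContinuousOn.integrableOn_compact (isCompact_closedBall _ _)
      (by fun_prop : Continuous fun y : Space => φ (y 0)).continuousOn
  rw [← integrable_indicator_iff Metric.isOpen_ball.measurableSet,
    ← measurePreserving_spaceCons.integrable_comp_emb measurableEmbedding_spaceCons] at hI
  simp only [Function.comp_def] at hI
  rw [← integral_indicator Metric.isOpen_ball.measurableSet,
    ← measurePreserving_spaceCons.integral_comp measurableEmbedding_spaceCons,
    integral_prod _ hI, intervalIntegral.integral_of_le (by linarith),
    ← integral_indicator measurableSet_Ioc]
  refine integral_congr_ae (Filter.Eventually.of_forall fun u => ?_)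
  have hmem : ∀ z, spaceCons (u, z) ∈ Metric.ball (0 : Space) s ↔ u ^ 2 + ‖z‖ ^ 2 < s ^ 2 := by
    intro z
    rw [mem_ball_zero_iff, ← sq_lt_sq₀ (norm_nonneg _) hs, norm_spaceCons_sq]
  have h0 : ∀ z, spaceCons (u, z) 0 = u := fun z => by simp [spaceCons]
  simp only
  -- The slice of the ball at height `u` is a disc of radius `√(s² - u²)` and area `π(s² - u²)`.
  -- Otherwise it is empty; the endpoint `u = s`, which lies in `Ioc`, causes no discrepancy because
  -- the area factor vanishes there.
  by_cases hu : u ^ 2 < s ^ 2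
  · have hu' : u ∈ Set.Ioc (-s) s := by
      have := abs_lt.1 ((sq_lt_sq.1 hu).trans_le (abs_of_nonneg hs).le)
      exact ⟨this.1, this.2.le⟩
    rw [Set.indicator_of_mem hu']
    have : ∀ z, (Metric.ball (0 : Space) s).indicator (fun y : Space => φ (y 0))
        (spaceCons (u, z)) =
        (Metric.ball (0 : EuclideanSpace ℝ (Fin 2)) (Real.sqrt (s ^ 2 - u ^ 2))).indicator
          (fun _ => φ u) z := by
      intro z
      have hiff : spaceCons (u, z) ∈ Metric.ball (0 : Space) s ↔
          z ∈ Metric.ball (0 : EuclideanSpace ℝ (Fin 2)) (Real.sqrt (s ^ 2 - u ^ 2)) := by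
        rw [hmem, mem_ball_zero_iff, Real.lt_sqrt (norm_nonneg _)]
        constructor <;> intro h <;> linarith
      by_cases hz : spaceCons (u, z) ∈ Metric.ball (0 : Space) s
      · rw [Set.indicator_of_mem hz, Set.indicator_of_mem (hiff.1 hz), h0]
      · rw [Set.indicator_of_notMem hz, Set.indicator_of_notMem (mt hiff.2 hz)]
    simp only [this]
    rw [integral_indicator Metric.isOpen_ball.measurableSet, setIntegral_const, mul_comm,
      Complex.real_smul]
    congr 2
    rw [Measure.real, EuclideanSpace.volume_ball_fin_two, ENNReal.toReal_mul, ENNReal.toReal_pow,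
      ENNReal.toReal_ofReal (Real.sqrt_nonneg _), Real.sq_sqrt (by linarith)]
    simp [mul_comm, Real.pi_pos.le]
  · have : ∀ z, (Metric.ball (0 : Space) s).indicator (fun y : Space => φ (y 0))
        (spaceCons (u, z)) = 0 := by
      intro z
      refine Set.indicator_of_notMem (mt (hmem z).1 ?_) _
      nlinarith [sq_nonneg ‖z‖]
    simp only [this, integral_zero]
    by_cases hu' : u ∈ Set.Ioc (-s) s
    · rw [Set.indicator_of_mem hu']
      have h1 : u ^ 2 ≤ s ^ 2 := sq_le_sq' hu'.1.le hu'.2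
      have : s ^ 2 - u ^ 2 = 0 := by linarith [not_lt.1 hu]
      simp [this]
    · rw [Set.indicator_of_notMem hu']

theorem integral_exp_mul_parabola {k : ℝ} (hk : k ≠ 0) (s : ℝ) :
    ∫ u in (-s)..s, Complex.exp (Complex.I * ((k * u : ℝ) : ℂ)) *
      ((Real.pi * (s ^ 2 - u ^ 2) : ℝ) : ℂ) = ((4 * Real.pi * sinMoment k s : ℝ) : ℂ) := by
  have hk' : (k : ℂ) ≠ 0 := by exact_mod_cast hk
  -- The antiderivative comes from integrating by parts until the quadratic polynomial is exhausted:
  -- `f/(ik) - f'/(ik)² + f''/(ik)³` with `f = s² - u²`.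
  have hder : ∀ u : ℝ, HasDerivAt (fun u : ℝ => Complex.exp (Complex.I * ((k * u : ℝ) : ℂ)) *
      (Real.pi * ((s ^ 2 - u ^ 2) / (Complex.I * k) - 2 * u / k ^ 2 - 2 * Complex.I / k ^ 3)))
      (Complex.exp (Complex.I * ((k * u : ℝ) : ℂ)) * ((Real.pi * (s ^ 2 - u ^ 2) : ℝ) : ℂ)) u := by
    intro u
    have h0 : HasDerivAt (fun u : ℝ => ((u : ℝ) : ℂ)) 1 u := Complex.ofRealCLM.hasDerivAt
    have h1 : HasDerivAt (fun u : ℝ => Complex.exp (Complex.I * ((k * u : ℝ) : ℂ)))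
        (Complex.exp (Complex.I * ((k * u : ℝ) : ℂ)) * (Complex.I * k)) u := by
      have := (h0.const_mul (k : ℂ)).const_mul Complex.I |>.cexp
      push_cast
      simpa using this
    have h2 : HasDerivAt (fun u : ℝ => (Real.pi * (((s : ℂ) ^ 2 - (u : ℂ) ^ 2) / (Complex.I * k) -
        2 * u / k ^ 2 - 2 * Complex.I / k ^ 3) : ℂ))
        (Real.pi * ((-(2 * u)) / (Complex.I * k) - 2 / k ^ 2)) u := by
      have hsq : HasDerivAt (fun u : ℝ => ((u : ℂ)) ^ 2) (2 * u) u := by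
        refine (h0.fun_pow 2).congr_deriv ?_
        simp
      have := ((((hsq.const_sub ((s : ℂ) ^ 2)).div_const (Complex.I * k)).sub
        ((h0.const_mul 2).div_const ((k : ℂ) ^ 2))).sub_const
        (2 * Complex.I / (k : ℂ) ^ 3)).const_mul (Real.pi : ℂ)
      simpa using this
    refine (h1.mul h2).congr_deriv ?_
    push_cast
    have hI : Complex.I ≠ 0 := Complex.I_ne_zero
    have hI2 := Complex.I_sq
    have hI3 : Complex.I ^ 3 = -Complex.I := by rw [pow_succ, hI2]; ring
    field_simp
    ring_nf
    simp only [hI2, hI3]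
    ring
  rw [intervalIntegral.integral_eq_sub_of_hasDerivAt (fun u _ => hder u)
    (Continuous.intervalIntegrable (by fun_prop) _ _)]
  have e1 : Complex.exp (Complex.I * ((k * s : ℝ) : ℂ)) =
      (Real.cos (s * k) : ℂ) + Real.sin (s * k) * Complex.I := by
    rw [mul_comm, Complex.exp_mul_I, mul_comm k, Complex.ofReal_cos, Complex.ofReal_sin]
  have e2 : Complex.exp (Complex.I * ((k * -s : ℝ) : ℂ)) =
      (Real.cos (s * k) : ℂ) - Real.sin (s * k) * Complex.I := by
    rw [mul_comm, Complex.exp_mul_I, show k * -s = -(s * k) by ring, Complex.ofReal_neg,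
      Complex.cos_neg, Complex.sin_neg, Complex.ofReal_cos, Complex.ofReal_sin]
    ring
  rw [e1, e2, sinMoment]
  have hI2 := Complex.I_sq
  push_cast
  field_simp
  linear_combination (-4 * Complex.sin (s * k) * Complex.I) * hI2

/-- The Fourier transform of the indicator function of a ball. -/
theorem integral_ball_planeWave {p : Space} (hp : p ≠ 0) {s : ℝ} (hs : 0 ≤ s) :
    ∫ y in Metric.ball (0 : Space) s, planeWave p y =
      ((4 * Real.pi * sinMoment ‖p‖ s : ℝ) : ℂ) := by
  have hnorm : ‖p‖ ≠ 0 := norm_ne_zero_iff.2 hp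
  set e : Space := EuclideanSpace.single 0 ‖p‖ with he
  have hv : ‖e‖ = ‖p‖ := by simp [he]
  -- A reflection interchanging `p` with the vector of equal length on the first axis; it preserves
  -- balls and Lebesgue measure, so only the dependence on one coordinate remains.
  set R := (Submodule.span ℝ {e - p})ᗮ.reflection with hR
  have hRe : R e = p := Submodule.reflection_sub hv
  have hpre : R ⁻¹' Metric.ball (0 : Space) s = Metric.ball 0 s := by
    ext y; simp
  have h1 := (R.measurePreserving.setIntegral_preimage_emb
    R.toHomeomorph.measurableEmbedding (planeWave p) (Metric.ball 0 s))
  rw [hpre] at h1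
  rw [← h1]
  have h2 : ∀ y, planeWave p (R y) = Complex.exp (Complex.I * ((‖p‖ * y 0 : ℝ) : ℂ)) := by
    intro y
    rw [planeWave, ← hRe, LinearIsometryEquiv.inner_map_map, he, hRe,
      EuclideanSpace.inner_single_left]
    simp
  simp only [h2]
  rw [← integral_exp_mul_parabola hnorm s]
  exact integral_ball_first (φ := fun u => Complex.exp (Complex.I * ((‖p‖ * u : ℝ) : ℂ)))
    (by fun_prop) hs

theorem energy_zero (p : Space) : energy 0 p = ‖p‖ := by simp [energy, Real.sqrt_sq]

/-- If the Fourier transform of `G` vanishes in a ball, the massless sine pairing vanishes. -/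
theorem sinePairing_massless_eq_zero {G : Space → ℂ} (hG : Integrable G) {T : ℝ}
    (h0 : ∀ y : Space, ‖y‖ ≤ T → ∫ p, planeWave p y * G p = 0) {t : ℝ} (ht : 0 ≤ t)
    (htT : t ≤ T) : sinePairing G t 0 = 0 := by
  -- Spherical means: up to `4π`, the radial primitive of the massless sine pairing is the integral
  -- over a ball of the Fourier transform of `G`, which vanishes there.
  have hb : ∀ s, 0 ≤ s → s ≤ T → ∫ u in (0 : ℝ)..s, (u : ℂ) * sinePairing G u 0 = 0 := by
    intro s hs hsT
    rw [integral_mul_sinePairing hG hs]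
    have e1 : ∫ p : Space, ((sinMoment (energy 0 p) s : ℝ) : ℂ) * G p =
        (4 * Real.pi : ℂ)⁻¹ * ∫ p : Space,
          ∫ y in Metric.ball (0 : Space) s, planeWave p y * G p := by
      rw [← integral_const_mul]
      refine integral_congr_ae ?_
      filter_upwards [ae_ne_zero] with p hp
      rw [integral_mul_const, integral_ball_planeWave hp hs, energy_zero]
      have : (Real.pi : ℂ) ≠ 0 := by exact_mod_cast Real.pi_ne_zero
      push_cast
      field_simp
    rw [e1, integral_integral_swap]
    · rw [setIntegral_congr_fun (g := fun _ => (0 : ℂ)) Metric.isOpen_ball.measurableSet]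
      · simp
      · intro y hy
        exact h0 y ((mem_ball_zero_iff.1 hy).le.trans hsT)
    · have hw : Integrable (fun z : Space × Space => ‖G z.1‖ * (1 : ℝ))
          (volume.prod (volume.restrict (Metric.ball (0 : Space) s))) := by
        have h1 : Integrable (fun _ : Space => (1 : ℝ))
            (volume.restrict (Metric.ball (0 : Space) s)) := by
          have : IsFiniteMeasure (volume.restrict (Metric.ball (0 : Space) s)) :=
            ⟨by simpa using measure_ball_lt_top (μ := volume) (x := (0 : Space)) (r := s)⟩
          exact integrable_const _
        exact hG.norm.mul_prod h1
      refine Integrable.mono' hw ?_ ?_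
      · simp only [Function.uncurry_def]
        exact (continuous_planeWave.aestronglyMeasurable).mul hG.1.comp_fst
      · refine Filter.Eventually.of_forall fun z => ?_
        simp [Function.uncurry_def, norm_planeWave]
  have hc := continuous_sinePairing hG 0
  -- The primitive vanishes identically, so its derivative `s · sinePairing G s 0` does too; the
  -- factor `s` is nonzero in the open interval.
  have hopen : ∀ s, 0 < s → s < T → sinePairing G s 0 = 0 := by
    intro s hs hsT
    have hd : HasDerivAt (fun s => ∫ u in (0 : ℝ)..s, (u : ℂ) * sinePairing G u 0)
        ((s : ℂ) * sinePairing G s 0) s :=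
      intervalIntegral.integral_hasDerivAt_right
        (Continuous.intervalIntegrable (by fun_prop) _ _)
        ((by fun_prop :
          Continuous fun u : ℝ => (u : ℂ) * sinePairing G u 0).stronglyMeasurableAtFilter _ _)
        (by fun_prop : Continuous fun u : ℝ => (u : ℂ) * sinePairing G u 0).continuousAt
    have hz : (fun s => ∫ u in (0 : ℝ)..s, (u : ℂ) * sinePairing G u 0) =ᶠ[nhds s] fun _ => 0 := by
      filter_upwards [Ioo_mem_nhds hs hsT] with u hu
      exact hb u hu.1.le hu.2.le
    have := (hd.congr_of_eventuallyEq hz.symm).unique (hasDerivAt_const s (0 : ℂ))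
    have hs' : (s : ℂ) ≠ 0 := by exact_mod_cast hs.ne'
    exact (mul_eq_zero.1 this).resolve_left hs'
  rcases eq_or_lt_of_le ht with rfl | ht0
  · simp [sinePairing]
  · have hcl : Set.Icc 0 T ⊆ {s | sinePairing G s 0 = 0} := by
      rw [← closure_Ioo (ht0.trans_le htT).ne]
      exact closure_minimal (fun s hs => hopen s hs.1 hs.2)
        (isClosed_singleton.preimage hc)
    exact hcl ⟨ht, htT⟩

open scoped FourierTransform in
/-- Fourier inversion on `Space`. -/
theorem integral_planeWave_fourier {f : Space → ℂ} (hf : Continuous f) (hfi : Integrable f)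
    (hF : Integrable fun p => ∫ x, planeWave p x * f x) {y : Space} (hy : f (-y) = 0) :
    ∫ p, planeWave p y * ∫ x, planeWave p x * f x = 0 := by
  -- `planeWave` has the opposite sign and no `2π` compared with `𝓕`; the substitution `p = c w`
  -- converts between them. Applying the transform twice with the same sign evaluates `f` at `-y`,
  -- and the Jacobian is irrelevant since that value is zero.
  set c : ℝ := -(2 * Real.pi) with hc
  have hc0 : c ≠ 0 := by simp [hc, Real.pi_ne_zero]
  have hfour : ∀ w : Space, 𝓕 f w = ∫ x, planeWave (c • w) x * f x := by
    intro w
    rw [Real.fourier_eq']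
    refine integral_congr_ae (Filter.Eventually.of_forall fun x => ?_)
    simp only [planeWave, smul_eq_mul, real_inner_smul_left, real_inner_comm w x, hc]
    congr 2
    push_cast; ring
  have hF' : Integrable (𝓕 f) := by
    have := hF.comp_smul hc0
    exact this.congr (Filter.Eventually.of_forall fun w => (hfour w).symm)
  have hinv := congrFun (hf.fourierInv_fourier_eq hfi hF') (-y)
  rw [hy, Real.fourierInv_eq'] at hinv
  have hs := Measure.integral_comp_smul volume
    (fun p : Space => planeWave p y * ∫ x, planeWave p x * f x) c
  have e : (fun w : Space => planeWave (c • w) y * ∫ x, planeWave (c • w) x * f x) =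
      fun w => Complex.exp (((2 * Real.pi * inner ℝ w (-y) : ℝ) : ℂ) * Complex.I) • 𝓕 f w := by
    ext w
    rw [hfour, smul_eq_mul, planeWave, real_inner_smul_left, inner_neg_right, hc]
    congr 2
    push_cast; ring
  rw [e, hinv] at hs
  have := (smul_eq_zero.1 hs.symm).resolve_left (by positivity)
  exact this

/-! ### Locality of the propagators -/

/-- `(1 + |p|²)²` times the transform is the transform of `(1 - Δ)² G` and hence bounded. -/
theorem integrable_spatialFourier (G : 𝓢(Spacetime, ℂ)) (t : ℝ) :
    Integrable (spatialFourier G t) := by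
  have hc : ∀ H : 𝓢(Spacetime, ℂ), Continuous (spatialFourier H t) := by
    intro H
    refine continuous_of_dominated (bound := fun x => ‖H (event t x)‖) ?_ ?_ ?_ ?_
    · exact fun p => (integrable_planeWave_mul (integrable_slice H t) p).1
    · exact fun p => Filter.Eventually.of_forall fun x => by rw [norm_mul, norm_planeWave, one_mul]
    · exact (integrable_slice H t).norm
    · refine Filter.Eventually.of_forall fun x => ?_
      have : Continuous fun p => planeWave p x :=
        continuous_planeWave.comp (f := fun p => (p, x)) (by fun_prop)
      fun_prop
  set H := bessel (bessel G)
  refine Integrable.mono' (integrable_space_weight.const_mul (∫ x, ‖H (event t x)‖))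
    (hc G).aestronglyMeasurable (Filter.Eventually.of_forall fun p => ?_)
  have h1 : ‖spatialFourier H t p‖ ≤ ∫ x, ‖H (event t x)‖ := by
    refine (norm_integral_le_integral_norm _).trans_eq ?_
    simp only [norm_mul, norm_planeWave, one_mul]
  rw [spatialFourier_bessel, spatialFourier_bessel, norm_mul, norm_mul, Complex.norm_real,
    Real.norm_of_nonneg (by positivity), ← mul_assoc, ← sq] at h1
  rw [← div_eq_mul_inv, le_div_iff₀ (by positivity), mul_comm]
  exact h1

/-- Finite propagation speed: the Pauli-Jordan distribution vanishes outside the light cone. -/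
theorem sinePairing_spatialFourier_eq_zero (G : 𝓢(Spacetime, ℂ)) (t : ℝ)
    (h : ∀ x, ‖x‖ ≤ |t| → G (event t x) = 0) {lam : ℝ} (hlam : 0 ≤ lam) :
    sinePairing (spatialFourier G t) |t| lam = 0 := by
  have hG := integrable_spatialFourier G t
  refine sinePairing_eq_zero_of_massless hG (T := |t|) (fun s hs hst => ?_) (abs_nonneg t) le_rfl
    hlam
  refine sinePairing_massless_eq_zero hG (T := |t|) (fun y hy => ?_) hs hst
  exact integral_planeWave_fourier (f := fun x => G (event t x))
    (G.continuous.comp (continuous_event_right t)) (integrable_slice G t) hG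
    (h _ (by rwa [norm_neg]))

theorem integrable_freqFactor_mul {τ : ℝ → ℝ} (hτ : Continuous τ) {lam : ℝ} (hlam : 0 < lam)
    (t : ℝ) {G : Space → ℂ} (hG : Integrable G) :
    Integrable fun p => freqFactor τ lam t p * G p := by
  refine hG.bdd_mul (c := (2 * lam)⁻¹) ?_ ?_
  · exact ((measurable_freqFactor hτ).comp
      (f := fun p => (lam, t, p)) (by fun_prop)).aestronglyMeasurable
  · refine Filter.Eventually.of_forall fun p => ?_
    rw [norm_freqFactor]
    gcongr
    exact le_energy lam p

/-- The two phases differ by `-2i sin(ω|t|)`, so the difference of the sides is a multiple of the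
sine pairing and vanishes by finite propagation speed. -/
theorem integral_freqFactor_abs (G : 𝓢(Spacetime, ℂ)) (t : ℝ)
    (h : ∀ x, ‖x‖ ≤ |t| → G (event t x) = 0) {lam : ℝ} (hlam : 0 < lam) :
    ∫ p, freqFactor (fun t => |t|) lam t p * spatialFourier G t p =
      ∫ p, freqFactor (fun t => -|t|) lam t p * spatialFourier G t p := by
  have hG := integrable_spatialFourier G t
  rw [← sub_eq_zero, ← integral_sub (integrable_freqFactor_mul (by fun_prop) hlam t hG)
    (integrable_freqFactor_mul (by fun_prop) hlam t hG)]
  have h0 := sinePairing_spatialFourier_eq_zero G t h hlam.le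
  have : ∀ p, freqFactor (fun t => |t|) lam t p * spatialFourier G t p -
      freqFactor (fun t => -|t|) lam t p * spatialFourier G t p = -Complex.I *
      (((Real.sin (|t| * energy lam p) / energy lam p : ℝ) : ℂ) * spatialFourier G t p) := by
    intro p
    have hpos : (energy lam p : ℂ) ≠ 0 := by
      exact_mod_cast (hlam.trans_le (le_energy lam p)).ne'
    rw [freqFactor, freqFactor, ← sub_mul, ← mul_assoc, ← sub_div]
    congr 1
    have e1 : ∀ s : ℝ, Complex.exp (-Complex.I * ((energy lam p * s : ℝ) : ℂ)) =
        Complex.cos ((s * energy lam p : ℝ) : ℂ) -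
          Complex.sin ((s * energy lam p : ℝ) : ℂ) * Complex.I := by
      intro s
      rw [show -Complex.I * ((energy lam p * s : ℝ) : ℂ) =
        (-((s * energy lam p : ℝ) : ℂ)) * Complex.I by push_cast; ring, Complex.exp_mul_I,
        Complex.cos_neg, Complex.sin_neg]
      ring
    rw [e1, e1, neg_mul, Complex.ofReal_neg, Complex.cos_neg, Complex.sin_neg]
    push_cast
    field_simp
    ring
  simp only [this]
  rw [integral_const_mul, ← sinePairing, h0, mul_zero]

theorem massKernel_congr {τ τ' : ℝ → ℝ} {lam : ℝ} {g : Spacetime → ℂ}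
    (h : ∀ t, ∫ p, freqFactor τ lam t p * spatialFourier g t p =
      ∫ p, freqFactor τ' lam t p * spatialFourier g t p) :
    massKernel τ lam g = massKernel τ' lam g := by
  rw [massKernel_eq, massKernel_eq]
  simp only [h]

theorem freqFactor_congr {τ τ' : ℝ → ℝ} {t : ℝ} (h : τ t = τ' t) (lam : ℝ) (p : Space) :
    freqFactor τ lam t p = freqFactor τ' lam t p := by rw [freqFactor, freqFactor, h]

theorem mem_forwardCone_event {t : ℝ} {x : Space} :
    event t x ∈ forwardCone ↔ ‖x‖ ^ 2 ≤ t ^ 2 ∧ 0 ≤ t := by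
  have h1 : event t x 1 = x 0 := event_succ t x 0
  have h2 : event t x 2 = x 1 := event_succ t x 1
  have h3 : event t x 3 = x 2 := event_succ t x 2
  rw [forwardCone, Set.mem_ofPred_eq, minkowskiSq, event_zero, h1, h2, h3,
    EuclideanSpace.norm_sq_eq, Fin.sum_univ_three]
  simp only [Real.norm_eq_abs, sq_abs]
  refine and_congr_left fun _ => ?_
  constructor <;> intro h <;> linarith

theorem mem_backwardCone_event {t : ℝ} {x : Space} :
    event t x ∈ backwardCone ↔ ‖x‖ ^ 2 ≤ t ^ 2 ∧ t ≤ 0 := by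
  have h1 : event t x 1 = x 0 := event_succ t x 0
  have h2 : event t x 2 = x 1 := event_succ t x 1
  have h3 : event t x 3 = x 2 := event_succ t x 2
  rw [backwardCone, Set.mem_ofPred_eq, minkowskiSq, event_zero, h1, h2, h3,
    EuclideanSpace.norm_sq_eq, Fin.sum_univ_three]
  simp only [Real.norm_eq_abs, sq_abs]
  refine and_congr_left fun _ => ?_
  constructor <;> intro h <;> linarith

theorem norm_sq_le_of_le_abs {t : ℝ} {x : Space} (h : ‖x‖ ≤ |t|) : ‖x‖ ^ 2 ≤ t ^ 2 := by
  rw [← sq_abs t]; gcongr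

/-- Outside the backward cone the Feynman propagator is the positive frequency propagator. -/
theorem offShellFeynman_eq_plus (ρ : ℝ → ℝ) (G : 𝓢(Spacetime, ℂ))
    (h : ∀ ξ ∈ backwardCone, G ξ = 0) : offShellFeynman ρ G = offShellPlus ρ G := by
  refine setIntegral_congr_fun measurableSet_Ioi fun lam hlam => ?_
  congr 1
  refine massKernel_congr fun t => ?_
  -- For `t ≥ 0` the phases coincide. For `t < 0` the ball `|x| ≤ |t|` lies in the backward cone,
  -- where `G` vanishes, so the sign of the phase may be reversed.
  rcases le_or_gt 0 t with ht | ht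
  · simp only [freqFactor_congr (τ := fun t => |t|) (τ' := fun t => t) (abs_of_nonneg ht)]
  · rw [integral_freqFactor_abs G t (fun x hx => h _ (mem_backwardCone_event.2
      ⟨norm_sq_le_of_le_abs hx, ht.le⟩)) hlam]
    simp only [freqFactor_congr (τ := fun t => -|t|) (τ' := fun t => t)
      (by simp [abs_of_neg ht] : -|t| = t)]

theorem event_neg (t : ℝ) (x : Space) : event (-t) (-x) = -event t x := by
  ext i
  refine Fin.cases ?_ (fun k => ?_) i <;> simp [event]

/-- Reversing `t`, `p` and `x` together leaves `ω` and `p·x` unchanged; only the time phase notices.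
-/
theorem massKernel_comp_neg (τ : ℝ → ℝ) (lam : ℝ) (g : Spacetime → ℂ) :
    massKernel τ lam (fun ξ => g (-ξ)) = massKernel (fun t => τ (-t)) lam g := by
  rw [massKernel_eq, massKernel_eq]
  congr 1
  rw [← integral_neg_eq_self]
  refine integral_congr_ae (Filter.Eventually.of_forall fun t => ?_)
  simp only
  rw [← integral_neg_eq_self]
  refine integral_congr_ae (Filter.Eventually.of_forall fun p => ?_)
  simp only
  congr 1
  · simp [freqFactor, energy]
  · rw [spatialFourier, ← integral_neg_eq_self, spatialFourier]
    refine integral_congr_ae (Filter.Eventually.of_forall fun x => ?_)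
    simp only [event_neg, neg_neg, planeWave, inner_neg_left, inner_neg_right]

theorem offShell_comp_neg (τ ρ : ℝ → ℝ) (g : Spacetime → ℂ) :
    offShell τ ρ (fun ξ => g (-ξ)) = offShell (fun t => τ (-t)) ρ g := by
  simp only [offShell, massKernel_comp_neg]

/-- Outside the forward cone the Feynman propagator is the reflected positive frequency
propagator. -/
theorem offShellFeynman_eq_plus_comp_neg (ρ : ℝ → ℝ) (G : 𝓢(Spacetime, ℂ))
    (h : ∀ ξ ∈ forwardCone, G ξ = 0) :
    offShellFeynman ρ G = offShellPlus ρ (fun ξ => G (-ξ)) := by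
  rw [offShellPlus_eq, offShell_comp_neg]
  refine setIntegral_congr_fun measurableSet_Ioi fun lam hlam => ?_
  congr 1
  refine massKernel_congr fun t => ?_
  rcases le_or_gt t 0 with ht | ht
  · simp only [freqFactor_congr (τ := fun t => |t|) (τ' := fun t => -t) (abs_of_nonpos ht)]
  · rw [integral_freqFactor_abs G t (fun x hx => h _ (mem_forwardCone_event.2
      ⟨norm_sq_le_of_le_abs hx, ht.le⟩)) hlam]
    simp only [freqFactor_congr (τ := fun t => -|t|) (τ' := fun t => -t)
      (by simp [abs_of_pos ht] : -|t| = -t)]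

/-! ### Test functions of two variables -/

theorem IsTest.add {H K : Spacetime × Spacetime → ℂ} (hH : IsTest H) (hK : IsTest K) :
    IsTest fun z => H z + K z :=
  ⟨hH.1.add hK.1, hH.2.add hK.2⟩

theorem IsTest.mul {h N : Spacetime × Spacetime → ℂ} (hh : IsTest h)
    (hN : ContDiff ℝ (⊤ : ℕ∞) N) : IsTest fun z => h z * N z :=
  ⟨hh.1.mul hN, hh.2.mul_right⟩

theorem IsTest.const_mul {h : Spacetime × Spacetime → ℂ} (hh : IsTest h) (a : ℂ) :
    IsTest fun z => a * h z :=
  ⟨contDiff_const.mul hh.1, hh.2.mul_left⟩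

theorem isTest_zero : IsTest fun _ => 0 := ⟨contDiff_const, HasCompactSupport.zero⟩

theorem IsTest.sum {ι : Type*} (s : Finset ι) {H : ι → Spacetime × Spacetime → ℂ}
    (h : ∀ i, IsTest (H i)) : IsTest fun z => ∑ i ∈ s, H i z := by
  classical
  induction s using Finset.induction_on with
  | empty => simpa using isTest_zero
  | insert a s ha ih => simpa only [Finset.sum_insert ha] using (h a).add ih

theorem IsTest.fderiv_apply {H : Spacetime × Spacetime → ℂ} (hH : IsTest H)
    (v : Spacetime × Spacetime) : IsTest fun z => fderiv ℝ H z v := by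
  refine ⟨(hH.1.fderiv_right (m := (⊤ : ℕ∞)) (by simp)).clm_apply contDiff_const, ?_⟩
  exact (hH.2.fderiv ℝ).comp_left (g := fun L : Spacetime × Spacetime →L[ℝ] ℂ => L v) (by simp)

theorem IsTest.dX {H : Spacetime × Spacetime → ℂ} (hH : IsTest H) (μ : Fin 4) :
    IsTest (dX μ H) := hH.fderiv_apply _

theorem IsTest.dY {H : Spacetime × Spacetime → ℂ} (hH : IsTest H) (μ : Fin 4) :
    IsTest (dY μ H) := hH.fderiv_apply _

theorem fderiv_fderiv_comm {H : Spacetime × Spacetime → ℂ} (hH : IsTest H)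
    (v w : Spacetime × Spacetime) :
    (fun z => fderiv ℝ (fun z => fderiv ℝ H z w) z v) =
      fun z => fderiv ℝ (fun z => fderiv ℝ H z v) z w := by
  have hd : Differentiable ℝ (fderiv ℝ H) :=
    (hH.1.fderiv_right (m := (⊤ : ℕ∞)) (by simp)).differentiable (by simp)
  ext z
  rw [fderiv_clm_apply (hd z) (by fun_prop), fderiv_clm_apply (hd z) (by fun_prop)]
  simp only [fderiv_fun_const, Pi.zero_apply, ContinuousLinearMap.comp_zero, zero_add,
    ContinuousLinearMap.flip_apply]
  exact ((contDiff_infty.1 hH.1 2).contDiffAt.isSymmSndFDerivAt (by simp)) v w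

theorem dX_dX_comm {H : Spacetime × Spacetime → ℂ} (hH : IsTest H) (μ ν : Fin 4) :
    dX μ (dX ν H) = dX ν (dX μ H) := fderiv_fderiv_comm hH _ _

theorem dY_dY_comm {H : Spacetime × Spacetime → ℂ} (hH : IsTest H) (μ ν : Fin 4) :
    dY μ (dY ν H) = dY ν (dY μ H) := fderiv_fderiv_comm hH _ _

theorem dX_dY_comm {H : Spacetime × Spacetime → ℂ} (hH : IsTest H) (μ ν : Fin 4) :
    dX μ (dY ν H) = dY ν (dX μ H) := fderiv_fderiv_comm hH _ _

theorem IsTest.foldr_dX {H : Spacetime × Spacetime → ℂ} (hH : IsTest H) (α : List (Fin 4)) :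
    IsTest (α.foldr OffShellYM.dX H) := by
  induction α with
  | nil => exact hH
  | cons μ α ih => exact ih.dX μ

theorem IsTest.foldr_dY {H : Spacetime × Spacetime → ℂ} (hH : IsTest H) (α : List (Fin 4)) :
    IsTest (α.foldr OffShellYM.dY H) := by
  induction α with
  | nil => exact hH
  | cons μ α ih => exact ih.dY μ

/-- `∂_x^α ∂_y^β H`. -/
def mixedDeriv (α β : List (Fin 4)) (H : Spacetime × Spacetime → ℂ) : Spacetime × Spacetime → ℂ :=
  α.foldr dX (β.foldr dY H)

theorem IsTest.mixedDeriv {H : Spacetime × Spacetime → ℂ} (hH : IsTest H) (α β : List (Fin 4)) :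
    IsTest (mixedDeriv α β H) := (hH.foldr_dY β).foldr_dX α

theorem foldr_dY_dX {H : Spacetime × Spacetime → ℂ} (hH : IsTest H) (β : List (Fin 4))
    (μ : Fin 4) : β.foldr dY (dX μ H) = dX μ (β.foldr dY H) := by
  induction β with
  | nil => rfl
  | cons ν β ih => rw [List.foldr_cons, List.foldr_cons, ih, dX_dY_comm (hH.foldr_dY β)]

theorem foldr_dY_dY {H : Spacetime × Spacetime → ℂ} (hH : IsTest H) (β : List (Fin 4))
    (μ : Fin 4) : β.foldr dY (dY μ H) = dY μ (β.foldr dY H) := by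
  induction β with
  | nil => rfl
  | cons ν β ih => rw [List.foldr_cons, List.foldr_cons, ih, dY_dY_comm (hH.foldr_dY β)]

theorem foldr_dX_dX {H : Spacetime × Spacetime → ℂ} (hH : IsTest H) (α : List (Fin 4))
    (μ : Fin 4) : α.foldr dX (dX μ H) = dX μ (α.foldr dX H) := by
  induction α with
  | nil => rfl
  | cons ν α ih => rw [List.foldr_cons, List.foldr_cons, ih, dX_dX_comm (hH.foldr_dX α)]

theorem foldr_dX_dY {H : Spacetime × Spacetime → ℂ} (hH : IsTest H) (α : List (Fin 4))
    (μ : Fin 4) : α.foldr dX (dY μ H) = dY μ (α.foldr dX H) := by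
  induction α with
  | nil => rfl
  | cons ν α ih => rw [List.foldr_cons, List.foldr_cons, ih, dX_dY_comm (hH.foldr_dX α)]

theorem mixedDeriv_dX {H : Spacetime × Spacetime → ℂ} (hH : IsTest H) (α β : List (Fin 4))
    (μ : Fin 4) : mixedDeriv α β (dX μ H) = dX μ (mixedDeriv α β H) := by
  rw [mixedDeriv, foldr_dY_dX hH, foldr_dX_dX (hH.foldr_dY β)]; rfl

theorem mixedDeriv_dY {H : Spacetime × Spacetime → ℂ} (hH : IsTest H) (α β : List (Fin 4))
    (μ : Fin 4) : mixedDeriv α β (dY μ H) = dY μ (mixedDeriv α β H) := by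
  rw [mixedDeriv, foldr_dY_dY hH, foldr_dX_dY (hH.foldr_dY β)]; rfl

theorem foldr_dX_foldr_dY_comm {H : Spacetime × Spacetime → ℂ} (hH : IsTest H)
    (α β : List (Fin 4)) : β.foldr dY (α.foldr dX H) = mixedDeriv α β H := by
  unfold mixedDeriv
  induction α with
  | nil => rfl
  | cons μ α ih => rw [List.foldr_cons, foldr_dY_dX (hH.foldr_dX α), ih, List.foldr_cons]

theorem IsTest.differentiable {H : Spacetime × Spacetime → ℂ} (hH : IsTest H) :
    Differentiable ℝ H := hH.1.differentiable (by simp)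

theorem mixedDeriv_add {H K : Spacetime × Spacetime → ℂ} (hH : IsTest H) (hK : IsTest K)
    (α β : List (Fin 4)) :
    mixedDeriv α β (fun z => H z + K z) = fun z => mixedDeriv α β H z + mixedDeriv α β K z := by
  have h : ∀ (v : Spacetime × Spacetime) {H K : Spacetime × Spacetime → ℂ}, IsTest H → IsTest K →
      (fun z => fderiv ℝ (fun z => H z + K z) z v) = fun z => fderiv ℝ H z v + fderiv ℝ K z v := by
    intro v H K hH hK
    ext z
    rw [fderiv_fun_add (hH.differentiable z) (hK.differentiable z)]
    rfl
  have hy : β.foldr dY (fun z => H z + K z) = fun z => β.foldr dY H z + β.foldr dY K z := by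
    induction β with
    | nil => rfl
    | cons μ β ih =>
      rw [List.foldr_cons, ih]
      exact h _ (hH.foldr_dY β) (hK.foldr_dY β)
  unfold mixedDeriv
  rw [hy]
  induction α with
  | nil => rfl
  | cons μ α ih =>
    rw [List.foldr_cons, ih]
    exact h _ ((hH.foldr_dY β).foldr_dX α) ((hK.foldr_dY β).foldr_dX α)

theorem mixedDeriv_const_mul {H : Spacetime × Spacetime → ℂ} (hH : IsTest H) (a : ℂ)
    (α β : List (Fin 4)) :
    mixedDeriv α β (fun z => a * H z) = fun z => a * mixedDeriv α β H z := by
  have h : ∀ (v : Spacetime × Spacetime) {H : Spacetime × Spacetime → ℂ}, IsTest H →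
      (fun z => fderiv ℝ (fun z => a * H z) z v) = fun z => a * fderiv ℝ H z v := by
    intro v H hH
    ext z
    rw [fderiv_const_mul (hH.differentiable z)]
    rfl
  have hy : β.foldr dY (fun z => a * H z) = fun z => a * β.foldr dY H z := by
    induction β with
    | nil => rfl
    | cons μ β ih =>
      rw [List.foldr_cons, ih]
      exact h _ (hH.foldr_dY β)
  unfold mixedDeriv
  rw [hy]
  induction α with
  | nil => rfl
  | cons μ α ih =>
    rw [List.foldr_cons, ih]
    exact h _ ((hH.foldr_dY β).foldr_dX α)

/-! ### Pairing test functions with distributions in `x - y` -/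

/-- `ξ ↦ ∫ K(y + ξ, y) dy`. -/
def diffPair (K : Spacetime × Spacetime → ℂ) (ξ : Spacetime) : ℂ := ∫ y, K (y + ξ, y)

theorem IsTest.hasCompactSupport_slice {K : Spacetime × Spacetime → ℂ} (hK : IsTest K)
    (ξ : Spacetime) : HasCompactSupport fun y : Spacetime => K (y + ξ, y) := by
  refine HasCompactSupport.intro (hK.2.isCompact.image continuous_snd) fun y hy => ?_
  by_contra h
  exact hy ⟨(y + ξ, y), subset_tsupport _ h, rfl⟩

theorem IsTest.integrable_slice {K : Spacetime × Spacetime → ℂ} (hK : IsTest K)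
    (ξ : Spacetime) : Integrable fun y : Spacetime => K (y + ξ, y) := by
  have := hK.1.continuous
  exact Continuous.integrable_of_hasCompactSupport (by fun_prop) (hK.hasCompactSupport_slice ξ)

/-- The derivative of the integrand is bounded by a constant on a compact set of `y` that does not
depend on `ξ`, which permits differentiation under the integral. -/
theorem IsTest.hasFDerivAt_diffPair {K : Spacetime × Spacetime → ℂ} (hK : IsTest K)
    (ξ : Spacetime) :
    ∃ D : Spacetime →L[ℝ] ℂ, HasFDerivAt (diffPair K) D ξ ∧
      ∀ v, D v = diffPair (fun z => fderiv ℝ K z (v, 0)) ξ := by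
  have hcd : Continuous (fderiv ℝ K) := (hK.1.fderiv_right (m := (⊤ : ℕ∞)) (by simp)).continuous
  have hcs := hK.2.fderiv ℝ
  obtain ⟨C, hC⟩ := hcs.exists_bound_of_continuous hcd
  set S : Set Spacetime := Prod.snd '' tsupport (fderiv ℝ K)
  have hS : IsCompact S := hcs.isCompact.image continuous_snd
  set i : Spacetime →L[ℝ] Spacetime × Spacetime := ContinuousLinearMap.inl ℝ Spacetime Spacetime
  have hi : Integrable fun y : Spacetime => (fderiv ℝ K (y + ξ, y)).comp i := by
    refine Continuous.integrable_of_hasCompactSupport ?_ ?_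
    · exact (hcd.comp (by fun_prop : Continuous fun y : Spacetime => (y + ξ, y))).clm_comp
        continuous_const
    · refine HasCompactSupport.intro hS fun y hy => ?_
      have : fderiv ℝ K (y + ξ, y) = 0 := by
        by_contra h
        exact hy ⟨(y + ξ, y), subset_tsupport _ h, rfl⟩
      simp [this]
  have hd : HasFDerivAt (diffPair K) (∫ y, (fderiv ℝ K (y + ξ, y)).comp i) ξ := by
    refine hasFDerivAt_integral_of_dominated_of_fderiv_le (𝕜 := ℝ) (s := Set.univ)
      Filter.univ_mem (bound := S.indicator fun _ => C * ‖i‖)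
      (F' := fun ξ y => (fderiv ℝ K (y + ξ, y)).comp i) ?_ (hK.integrable_slice ξ) hi.1 ?_ ?_ ?_
    · exact Filter.Eventually.of_forall fun ξ => (hK.integrable_slice ξ).1
    · refine Filter.Eventually.of_forall fun y ξ _ => ?_
      by_cases hy : y ∈ S
      · rw [Set.indicator_of_mem hy]
        refine (ContinuousLinearMap.opNorm_comp_le _ _).trans ?_
        gcongr
        exact hC _
      · rw [Set.indicator_of_notMem hy]
        have : fderiv ℝ K (y + ξ, y) = 0 := by
          by_contra h
          exact hy ⟨(y + ξ, y), subset_tsupport _ h, rfl⟩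
        simp [this]
    · rw [integrable_indicator_iff hS.measurableSet]
      exact integrableOn_const hS.measure_lt_top.ne
    · refine Filter.Eventually.of_forall fun y ξ _ => ?_
      have h1 : HasFDerivAt (fun ξ : Spacetime => (y + ξ, y)) i ξ :=
        ((hasFDerivAt_id ξ).const_add y).prodMk (hasFDerivAt_const y ξ)
      exact (hK.differentiable (y + ξ, y)).hasFDerivAt.comp ξ h1
  refine ⟨_, hd, fun v => ?_⟩
  rw [ContinuousLinearMap.integral_apply hi]
  rfl

theorem IsTest.contDiff_diffPair {K : Spacetime × Spacetime → ℂ} (hK : IsTest K) :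
    ContDiff ℝ (⊤ : ℕ∞) (diffPair K) := by
  rw [contDiff_infty]
  intro n
  induction n generalizing K with
  | zero =>
    rw [Nat.cast_zero, contDiff_zero, continuous_iff_continuousAt]
    exact fun ξ => (hK.hasFDerivAt_diffPair ξ).choose_spec.1.continuousAt
  | succ n ih =>
    rw [Nat.cast_succ, contDiff_succ_iff_fderiv_apply]
    refine ⟨fun ξ => (hK.hasFDerivAt_diffPair ξ).choose_spec.1.differentiableAt,
      by simp, fun v => ?_⟩
    convert ih (hK.fderiv_apply (v, 0)) using 1
    ext ξ
    obtain ⟨D, hD, hD'⟩ := hK.hasFDerivAt_diffPair ξ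
    rw [hD.fderiv, hD']

theorem IsTest.hasCompactSupport_diffPair {K : Spacetime × Spacetime → ℂ} (hK : IsTest K) :
    HasCompactSupport (diffPair K) := by
  refine HasCompactSupport.intro (hK.2.isCompact.image
    (by fun_prop : Continuous fun z : Spacetime × Spacetime => z.1 - z.2)) fun ξ hξ => ?_
  have : ∀ y, K (y + ξ, y) = 0 := by
    intro y
    by_contra h
    exact hξ ⟨(y + ξ, y), subset_tsupport _ h, by simp⟩
  simp [diffPair, this]

/-- `diffPair K` as a Schwartz function. -/
def IsTest.schwartz {K : Spacetime × Spacetime → ℂ} (hK : IsTest K) : 𝓢(Spacetime, ℂ) :=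
  hK.hasCompactSupport_diffPair.toSchwartzMap hK.contDiff_diffPair

theorem IsTest.coe_schwartz {K : Spacetime × Spacetime → ℂ} (hK : IsTest K) :
    ⇑hK.schwartz = diffPair K := rfl

/-- The sum of the two derivatives is a total derivative along the direction of simultaneous
translation, whose integral vanishes. This is `∂_x = -∂_y` on distributions in `x - y`, the analytic
half of the gauge cancellation. -/
theorem diffPair_dX {K : Spacetime × Spacetime → ℂ} (hK : IsTest K) (μ : Fin 4) :
    diffPair (dX μ K) = fun ξ => -diffPair (dY μ K) ξ := by
  ext ξ
  have hsum : ∀ y, HasLineDerivAt ℝ (fun y : Spacetime => K (y + ξ, y))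
      (dX μ K (y + ξ, y) + dY μ K (y + ξ, y)) y (basisVec μ) := by
    intro y
    have h1 : HasFDerivAt (fun y : Spacetime => (y + ξ, y))
        ((ContinuousLinearMap.id ℝ Spacetime).prod (ContinuousLinearMap.id ℝ Spacetime)) y :=
      ((hasFDerivAt_id y).add_const ξ).prodMk (hasFDerivAt_id y)
    have h2 := HasFDerivAt.comp (f := fun y : Spacetime => (y + ξ, y)) y
        (hK.differentiable (y + ξ, y)).hasFDerivAt h1
    have h3 := h2.hasLineDerivAt (basisVec μ)
    have e : ((fderiv ℝ K (y + ξ, y)).comp ((ContinuousLinearMap.id ℝ Spacetime).prod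
        (ContinuousLinearMap.id ℝ Spacetime))) (basisVec μ) =
        dX μ K (y + ξ, y) + dY μ K (y + ξ, y) := by
      simp only [dX, dY, ← map_add]
      simp
    rw [e] at h3
    exact h3
  have hi : Integrable fun y : Spacetime => dX μ K (y + ξ, y) + dY μ K (y + ξ, y) :=
    ((hK.dX μ).integrable_slice ξ).add ((hK.dY μ).integrable_slice ξ)
  have h := integral_bilinear_hasLineDerivAt_right_eq_neg_left_of_integrable (μ := volume)
    (f := fun _ : Spacetime => (1 : ℂ)) (f' := fun _ => 0)
    (g := fun y : Spacetime => K (y + ξ, y))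
    (g' := fun y => dX μ K (y + ξ, y) + dY μ K (y + ξ, y)) (v := basisVec μ)
    (B := ContinuousLinearMap.mul ℝ ℂ) (by simp)
    (by simpa only [ContinuousLinearMap.mul_apply', one_mul] using hi)
    (by simpa using hK.integrable_slice ξ)
    (fun y _ => (hasFDerivAt_const (1 : ℂ) y).hasLineDerivAt _) (fun y _ => hsum y)
  simp only [ContinuousLinearMap.mul_apply', one_mul, zero_mul, integral_zero, neg_zero] at h
  rw [integral_add ((hK.dX μ).integrable_slice ξ) ((hK.dY μ).integrable_slice ξ)] at h
  exact eq_neg_of_add_eq_zero_left h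

theorem pairDifference_eq (P : (Spacetime → ℂ) → ℂ) (α β : List (Fin 4))
    (H : Spacetime × Spacetime → ℂ) :
    pairDifference P α β H =
      (-1 : ℂ) ^ (α.length + β.length) * P (diffPair (mixedDeriv α β H)) := rfl

theorem diffPair_const_mul (a : ℂ) (K : Spacetime × Spacetime → ℂ) :
    diffPair (fun z => a * K z) = fun ξ => a * diffPair K ξ := by
  ext ξ
  exact integral_const_mul a _

theorem diffPair_add {H K : Spacetime × Spacetime → ℂ} (hH : IsTest H) (hK : IsTest K) :
    diffPair (fun z => H z + K z) = fun ξ => diffPair H ξ + diffPair K ξ := by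
  ext ξ
  exact integral_add (hH.integrable_slice ξ) (hK.integrable_slice ξ)

/-- A derivative on the contracted leg at `x` is a distributional derivative, and so moves to the
test function with a minus sign. -/
theorem pairDifference_cons_left (P : (Spacetime → ℂ) → ℂ) (α β : List (Fin 4)) (μ : Fin 4)
    {H : Spacetime × Spacetime → ℂ} (hH : IsTest H) :
    pairDifference P (μ :: α) β H = -pairDifference P α β (dX μ H) := by
  rw [pairDifference_eq, pairDifference_eq, mixedDeriv_dX hH, List.length_cons,
    show α.length + 1 + β.length = α.length + β.length + 1 by ring, pow_succ]
  simp only [mixedDeriv, List.foldr_cons]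
  ring

theorem pairDifference_cons_right (P : (Spacetime → ℂ) → ℂ) (α β : List (Fin 4)) (μ : Fin 4)
    {H : Spacetime × Spacetime → ℂ} (hH : IsTest H) :
    pairDifference P α (μ :: β) H = -pairDifference P α β (dY μ H) := by
  have e : mixedDeriv α (μ :: β) H = dY μ (mixedDeriv α β H) := by
    rw [mixedDeriv, List.foldr_cons, foldr_dX_dY (hH.foldr_dY β)]; rfl
  rw [pairDifference_eq, pairDifference_eq, mixedDeriv_dY hH, List.length_cons,
    ← add_assoc, pow_succ, e]
  ring

theorem pairDifference_const_mul (τ ρ : ℝ → ℝ) (α β : List (Fin 4)) (a : ℂ)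
    {H : Spacetime × Spacetime → ℂ} (hH : IsTest H) :
    pairDifference (offShell τ ρ) α β (fun z => a * H z) =
      a * pairDifference (offShell τ ρ) α β H := by
  rw [pairDifference_eq, pairDifference_eq, mixedDeriv_const_mul hH, diffPair_const_mul,
    offShell_const_mul]
  ring

theorem pairDifference_add {τ : ℝ → ℝ} (hτ : Continuous τ) {ρ : ℝ → ℝ}
    (hρ : IntegrableOn ρ (Set.Ioi 0)) (α β : List (Fin 4))
    {H K : Spacetime × Spacetime → ℂ} (hH : IsTest H) (hK : IsTest K) :
    pairDifference (offShell τ ρ) α β (fun z => H z + K z) =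
      pairDifference (offShell τ ρ) α β H + pairDifference (offShell τ ρ) α β K := by
  have hH' := hH.mixedDeriv α β
  have hK' := hK.mixedDeriv α β
  rw [pairDifference_eq, pairDifference_eq, pairDifference_eq, mixedDeriv_add hH hK,
    diffPair_add hH' hK']
  have := offShell_add hτ hρ hH'.schwartz hK'.schwartz
  rw [hH'.coe_schwartz, hK'.coe_schwartz] at this
  rw [this, mul_add]

theorem pairDifference_zero (τ ρ : ℝ → ℝ) (α β : List (Fin 4)) :
    pairDifference (offShell τ ρ) α β (fun _ => 0) = 0 := by
  simpa using pairDifference_const_mul τ ρ α β 0 isTest_zero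

theorem pairDifference_sum {τ : ℝ → ℝ} (hτ : Continuous τ) {ρ : ℝ → ℝ}
    (hρ : IntegrableOn ρ (Set.Ioi 0)) (α β : List (Fin 4)) {ι : Type*} (s : Finset ι)
    {H : ι → Spacetime × Spacetime → ℂ} (h : ∀ i, IsTest (H i)) :
    pairDifference (offShell τ ρ) α β (fun z => ∑ i ∈ s, H i z) =
      ∑ i ∈ s, pairDifference (offShell τ ρ) α β (H i) := by
  classical
  induction s using Finset.induction_on with
  | empty => simp [pairDifference_zero]
  | insert a s ha ih =>
    simp only [Finset.sum_insert ha]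
    rw [pairDifference_add hτ hρ α β (h a) (IsTest.sum s h), ih]

theorem pairDifference_dX (τ ρ : ℝ → ℝ) (α β : List (Fin 4)) (μ : Fin 4)
    {H : Spacetime × Spacetime → ℂ} (hH : IsTest H) :
    pairDifference (offShell τ ρ) α β (dX μ H) = -pairDifference (offShell τ ρ) α β (dY μ H) := by
  rw [pairDifference_eq, pairDifference_eq, mixedDeriv_dX hH, mixedDeriv_dY hH,
    diffPair_dX (hH.mixedDeriv α β), offShell_neg, mul_neg]

theorem IsTest.comp_swap {H : Spacetime × Spacetime → ℂ} (hH : IsTest H) :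
    IsTest fun z => H z.swap := by
  refine ⟨hH.1.comp (contDiff_snd.prodMk contDiff_fst), ?_⟩
  exact hH.2.comp_homeomorph (Homeomorph.prodComm Spacetime Spacetime)

theorem fderiv_comp_swap (H : Spacetime × Spacetime → ℂ)
    (v : Spacetime × Spacetime) :
    (fun z : Spacetime × Spacetime => fderiv ℝ (fun z : Spacetime × Spacetime => H z.swap) z v) =
      fun z => fderiv ℝ H z.swap v.swap := by
  ext z
  have := (ContinuousLinearEquiv.prodComm ℝ Spacetime Spacetime).comp_right_fderiv
    (f := H) (x := z)
  exact congrArg (fun L : Spacetime × Spacetime →L[ℝ] ℂ => L v) this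

theorem mixedDeriv_comp_swap {H : Spacetime × Spacetime → ℂ} (hH : IsTest H)
    (α β : List (Fin 4)) :
    mixedDeriv β α (fun z => H z.swap) = fun z => mixedDeriv α β H z.swap := by
  have h1 : α.foldr dY (fun z => H z.swap) = fun z => α.foldr dX H z.swap := by
    induction α with
    | nil => rfl
    | cons μ α ih =>
      rw [List.foldr_cons, ih]
      exact fderiv_comp_swap _ _
  rw [← foldr_dX_foldr_dY_comm hH, mixedDeriv, h1]
  generalize α.foldr dX H = K
  induction β with
  | nil => rfl
  | cons μ β ih =>
    rw [List.foldr_cons, ih]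
    exact fderiv_comp_swap _ _

theorem diffPair_comp_swap (K : Spacetime × Spacetime → ℂ) :
    diffPair (fun z => K z.swap) = fun ξ => diffPair K (-ξ) := by
  ext ξ
  simp only [diffPair, Prod.swap_prod_mk]
  have := integral_add_right_eq_self (μ := volume) (fun y => K (y + -ξ, y)) ξ
  simpa using this

/-- Exchanging `x` and `y` reflects the difference variable. -/
theorem pairDifference_comp_swap (P : (Spacetime → ℂ) → ℂ) (α β : List (Fin 4))
    {H : Spacetime × Spacetime → ℂ} (hH : IsTest H) :
    pairDifference P β α (fun z => H z.swap) =
      pairDifference (fun g => P fun ξ => g (-ξ)) α β H := by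
  rw [pairDifference_eq, pairDifference_eq, mixedDeriv_comp_swap hH, diffPair_comp_swap,
    add_comm β.length]

/-! ### Transfer of locality to two-point pairings -/

theorem tsupport_mixedDeriv_subset (H : Spacetime × Spacetime → ℂ) (α β : List (Fin 4)) :
    tsupport (mixedDeriv α β H) ⊆ tsupport H := by
  have h : ∀ (v : Spacetime × Spacetime) (H : Spacetime × Spacetime → ℂ),
      tsupport (fun z => fderiv ℝ H z v) ⊆ tsupport H := by
    intro v H
    refine (closure_mono ?_).trans (tsupport_fderiv_subset ℝ (f := H))
    intro z hz h0
    exact hz (by simp [h0])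
  have hy : tsupport (β.foldr dY H) ⊆ tsupport H := by
    induction β with
    | nil => exact subset_rfl
    | cons μ β ih => exact (h _ _).trans ih
  refine subset_trans ?_ hy
  unfold mixedDeriv
  induction α with
  | nil => exact subset_rfl
  | cons μ α ih => exact (h _ _).trans ih

/-- Differentiation does not enlarge supports, so for `ξ` in `K` the integrand is identically zero.
-/
theorem diffPair_mixedDeriv_eq_zero {H : Spacetime × Spacetime → ℂ} {K : Set Spacetime}
    (h : ∀ z ∈ tsupport H, z.1 - z.2 ∉ K) (α β : List (Fin 4)) {ξ : Spacetime} (hξ : ξ ∈ K) :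
    diffPair (mixedDeriv α β H) ξ = 0 := by
  have : ∀ y, mixedDeriv α β H (y + ξ, y) = 0 := by
    intro y
    by_contra h0
    have := h _ (tsupport_mixedDeriv_subset H α β (subset_tsupport _ h0))
    simp [hξ] at this
  simp [diffPair, this]

theorem pairDifference_feynman_eq_plus (ρ : ℝ → ℝ) {H : Spacetime × Spacetime → ℂ}
    (hH : IsTest H) (h : ∀ z ∈ tsupport H, z.1 - z.2 ∉ backwardCone) (α β : List (Fin 4)) :
    pairDifference (offShellFeynman ρ) α β H = pairDifference (offShellPlus ρ) α β H := by
  rw [pairDifference_eq, pairDifference_eq]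
  have hK := hH.mixedDeriv α β
  congr 1
  exact offShellFeynman_eq_plus ρ hK.schwartz fun ξ hξ => diffPair_mixedDeriv_eq_zero h α β hξ

theorem pairDifference_feynman_eq_swap (ρ : ℝ → ℝ) {H : Spacetime × Spacetime → ℂ}
    (hH : IsTest H) (h : ∀ z ∈ tsupport H, z.1 - z.2 ∉ forwardCone) (α β : List (Fin 4)) :
    pairDifference (offShellFeynman ρ) α β H =
      pairDifference (offShellPlus ρ) β α (fun z => H z.swap) := by
  rw [pairDifference_comp_swap _ _ _ hH, pairDifference_eq, pairDifference_eq]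
  have hK := hH.mixedDeriv α β
  congr 1
  exact offShellFeynman_eq_plus_comp_neg ρ hK.schwartz
    fun ξ hξ => diffPair_mixedDeriv_eq_zero h α β hξ

/-! ### Contractions with smeared fields -/

/-- The complexification of a real test function. -/
def complexify (g : 𝓢(Spacetime, ℝ)) : 𝓢(Spacetime, ℂ) := g.postcompCLM Complex.ofRealCLM

theorem complexify_apply (g : 𝓢(Spacetime, ℝ)) (x : Spacetime) : complexify g x = (g x : ℂ) := rfl

theorem lineDerivOp_complexify (v : Spacetime) (g : 𝓢(Spacetime, ℝ)) :
    ∂_{v} (complexify g) = complexify (∂_{v} g) := by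
  ext x
  rw [complexify_apply, SchwartzMap.lineDerivOp_apply_eq_fderiv,
    SchwartzMap.lineDerivOp_apply_eq_fderiv]
  have h := (Complex.ofRealCLM.hasFDerivAt (x := g x)).comp x (g.hasFDerivAt x)
  have h' : HasFDerivAt (complexify g) (Complex.ofRealCLM.comp (fderiv ℝ g x)) x := h
  rw [h'.fderiv]
  rfl

/-- The reflection `ξ ↦ G(-ξ)`. -/
def reflect (G : 𝓢(Spacetime, ℂ)) : 𝓢(Spacetime, ℂ) :=
  SchwartzMap.compCLMOfContinuousLinearEquiv ℂ (ContinuousLinearEquiv.neg ℝ) G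

theorem reflect_apply (G : 𝓢(Spacetime, ℂ)) (x : Spacetime) : reflect G x = G (-x) := rfl

theorem lineDerivOp_reflect (v : Spacetime) (G : 𝓢(Spacetime, ℂ)) :
    ∂_{v} (reflect G) = -reflect (∂_{v} G) := by
  rw [reflect, SchwartzMap.lineDerivOp_compCLMOfContinuousLinearEquiv]
  ext x
  simp [reflect, LineDeriv.lineDerivOp_left_neg]

theorem testDeriv_cons (μ : Fin 4) (α : List (Fin 4)) (g : 𝓢(Spacetime, ℝ)) :
    testDeriv (μ :: α) g = ∂_{basisVec μ} (testDeriv α g) := rfl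

theorem testDeriv_lineDerivOp (μ : Fin 4) (α : List (Fin 4)) (g : 𝓢(Spacetime, ℝ)) :
    testDeriv α (∂_{basisVec μ} g) = ∂_{basisVec μ} (testDeriv α g) := by
  induction α with
  | nil => rfl
  | cons ν α ih => rw [testDeriv_cons, ih, lineDerivOp_comm, testDeriv_cons]

/-- `x ↦ ∫ D⁽⁺⁾(ξ) g(x + ξ) dξ`. -/
def smearRight (ρ : ℝ → ℝ) (g : 𝓢(Spacetime, ℝ)) (x : Spacetime) : ℂ :=
  offShellPlus ρ fun ξ => (g (x + ξ) : ℂ)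

/-- `x ↦ ∫ D⁽⁺⁾(ξ) g(x - ξ) dξ`. -/
def smearLeft (ρ : ℝ → ℝ) (g : 𝓢(Spacetime, ℝ)) (x : Spacetime) : ℂ :=
  offShellPlus ρ fun ξ => (g (x - ξ) : ℂ)

/-- Puts the reflected smearing into the translated form already known to be smooth. In the
derivative, the sign from `-x` and the sign from the reflection cancel. -/
theorem smearLeft_eq (ρ : ℝ → ℝ) (g : 𝓢(Spacetime, ℝ)) (x : Spacetime) :
    smearLeft ρ g x =
      offShell (fun t => t) ρ fun ξ => reflect (complexify g) (-x + ξ) := by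
  rw [smearLeft, offShellPlus_eq]
  congr 1
  ext ξ
  rw [reflect_apply, complexify_apply]
  congr 2
  abel

theorem contDiff_smearRight {ρ : ℝ → ℝ} (hρ : IntegrableOn ρ (Set.Ioi 0))
    (g : 𝓢(Spacetime, ℝ)) : ContDiff ℝ (⊤ : ℕ∞) (smearRight ρ g) :=
  contDiff_offShell_translate continuous_id' hρ (complexify g)

theorem contDiff_smearLeft {ρ : ℝ → ℝ} (hρ : IntegrableOn ρ (Set.Ioi 0))
    (g : 𝓢(Spacetime, ℝ)) : ContDiff ℝ (⊤ : ℕ∞) (smearLeft ρ g) := by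
  have h := (contDiff_offShell_translate continuous_id' hρ (reflect (complexify g))).comp
    (contDiff_neg (𝕜 := ℝ) (F := Spacetime))
  convert h using 1
  ext x
  exact smearLeft_eq ρ g x

theorem fderiv_smearRight {ρ : ℝ → ℝ} (hρ : IntegrableOn ρ (Set.Ioi 0))
    (g : 𝓢(Spacetime, ℝ)) (x v : Spacetime) :
    fderiv ℝ (smearRight ρ g) x v = smearRight ρ (∂_{v} g) x := by
  obtain ⟨D, hD, hD'⟩ := hasFDerivAt_offShell_translate continuous_id' hρ (complexify g) x
  have h : HasFDerivAt (smearRight ρ g) D x := hD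
  rw [h.fderiv, hD', lineDerivOp_complexify]
  rfl

theorem fderiv_smearLeft {ρ : ℝ → ℝ} (hρ : IntegrableOn ρ (Set.Ioi 0))
    (g : 𝓢(Spacetime, ℝ)) (x v : Spacetime) :
    fderiv ℝ (smearLeft ρ g) x v = smearLeft ρ (∂_{v} g) x := by
  obtain ⟨D, hD, hD'⟩ := hasFDerivAt_offShell_translate continuous_id' hρ
    (reflect (complexify g)) (-x)
  have h : HasFDerivAt (smearLeft ρ g) (D.comp (-ContinuousLinearMap.id ℝ Spacetime)) x := by
    have e : smearLeft ρ g = (fun a => offShell (fun t => t) ρ fun ξ =>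
        reflect (complexify g) (a + ξ)) ∘ fun y => -y := funext fun y => smearLeft_eq ρ g y
    rw [e]
    exact hD.comp x (hasFDerivAt_id x).neg
  have e : (D.comp (-ContinuousLinearMap.id ℝ Spacetime)) v = -D v := by simp
  rw [h.fderiv, smearLeft_eq, e, hD', lineDerivOp_reflect, lineDerivOp_complexify]
  simp only [neg_apply]
  rw [offShell_neg, neg_neg]

variable {r : ℕ}

theorem contraction_smeared_atX (ρ : ℝ → ℝ) (x y : Spacetime) (s : Smeared r) (j : Jet r) :
    contraction ρ x y (.smeared s) (.atX j) =
      twoPointCoeff s.field j.field * smearRight ρ (testDeriv j.der s.test) x := rfl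

theorem contraction_smeared_atY (ρ : ℝ → ℝ) (x y : Spacetime) (s : Smeared r) (j : Jet r) :
    contraction ρ x y (.smeared s) (.atY j) =
      twoPointCoeff s.field j.field * smearRight ρ (testDeriv j.der s.test) y := rfl

theorem contraction_atX_smeared (ρ : ℝ → ℝ) (x y : Spacetime) (s : Smeared r) (j : Jet r) :
    contraction ρ x y (.atX j) (.smeared s) =
      twoPointCoeff j.field s.field * smearLeft ρ (testDeriv j.der s.test) x := rfl

theorem contraction_atY_smeared (ρ : ℝ → ℝ) (x y : Spacetime) (s : Smeared r) (j : Jet r) :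
    contraction ρ x y (.atY j) (.smeared s) =
      twoPointCoeff j.field s.field * smearLeft ρ (testDeriv j.der s.test) y := rfl

theorem contraction_atX_atX (ρ : ℝ → ℝ) (x y : Spacetime) (j k : Jet r) :
    contraction ρ x y (.atX j) (.atX k) = 0 := rfl

theorem contraction_atX_atY (ρ : ℝ → ℝ) (x y : Spacetime) (j k : Jet r) :
    contraction ρ x y (.atX j) (.atY k) = 0 := rfl

theorem contraction_atY_atX (ρ : ℝ → ℝ) (x y : Spacetime) (j k : Jet r) :
    contraction ρ x y (.atY j) (.atX k) = 0 := rfl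

theorem contraction_atY_atY (ρ : ℝ → ℝ) (x y : Spacetime) (j k : Jet r) :
    contraction ρ x y (.atY j) (.atY k) = 0 := rfl

theorem parity_eq_of_twoPointCoeff_ne_zero {φ ψ : Field r} (h : twoPointCoeff φ ψ ≠ 0) :
    φ.parity = ψ.parity := by
  cases φ <;> cases ψ <;> simp_all [twoPointCoeff, Field.parity]

theorem parity_eq_of_contraction_ne_zero (ρ : ℝ → ℝ) (x y : Spacetime) (l l' : Letter r)
    (h : contraction ρ x y l l' ≠ 0) : l.parity = l'.parity := by
  cases l <;> cases l' <;> first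
    | exact absurd rfl h
    | exact parity_eq_of_twoPointCoeff_ne_zero (left_ne_zero_of_mul h)

theorem contDiff_contraction {ρ : ℝ → ℝ} (hρ : IntegrableOn ρ (Set.Ioi 0)) (l l' : Letter r) :
    ContDiff ℝ (⊤ : ℕ∞) fun z : Spacetime × Spacetime => contraction ρ z.1 z.2 l l' := by
  have hr := fun g => contDiff_smearRight hρ g
  have hl := fun g => contDiff_smearLeft hρ g
  cases l with
  | smeared s =>
    cases l' with
    | smeared s' => exact contDiff_const
    | atX j =>
      simp only [contraction_smeared_atX]
      exact contDiff_const.mul ((hr _).comp contDiff_fst)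
    | atY j =>
      simp only [contraction_smeared_atY]
      exact contDiff_const.mul ((hr _).comp contDiff_snd)
  | atX j =>
    cases l' with
    | smeared s =>
      simp only [contraction_atX_smeared]
      exact contDiff_const.mul ((hl _).comp contDiff_fst)
    | atX k => exact contDiff_const
    | atY k => exact contDiff_const
  | atY j =>
    cases l' with
    | smeared s =>
      simp only [contraction_atY_smeared]
      exact contDiff_const.mul ((hl _).comp contDiff_snd)
    | atX k => exact contDiff_const
    | atY k => exact contDiff_const

/-! ### Expectation values depending on parameters -/

theorem contDiff_extSum {X : Type*} (par : X → ℕ) (w : List X)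
    {F : Spacetime × Spacetime → X → List X → ℂ}
    (hF : ∀ y w', w'.length < w.length → ContDiff ℝ (⊤ : ℕ∞) fun z => F z y w') :
    ContDiff ℝ (⊤ : ℕ∞) fun z => extSum par w (F z) := by
  simp only [extSum_eq_sum]
  refine ContDiff.sum fun k _ => contDiff_const.mul (hF _ _ ?_)
  rw [List.length_eraseIdx_of_lt k.2]
  have := k.2
  omega

theorem contDiff_vev {W : Spacetime × Spacetime → Letter r → Letter r → ℂ}
    (hW : ∀ l l', ContDiff ℝ (⊤ : ℕ∞) fun z => W z l l') (w : List (Letter r)) :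
    ContDiff ℝ (⊤ : ℕ∞) fun z => vev (W z) w := by
  induction hn : w.length using Nat.strong_induction_on generalizing w with
  | _ n ih =>
    cases w with
    | nil => simpa only [vev_nil] using contDiff_const
    | cons l w =>
      simp only [vev_cons]
      exact contDiff_extSum _ w fun y w' hw' =>
        (hW l y).mul (ih w'.length (by simp at hn; omega) w' rfl)

/-- The product rule propagates through Wick's recursion: with `d = 0`, `derSum_vev_cons` is the
Leibniz rule for a contraction times the remaining expectation value. -/
theorem fderiv_vev {W : Spacetime × Spacetime → Letter r → Letter r → ℂ}
    (hW : ∀ l l', ContDiff ℝ (⊤ : ℕ∞) fun z => W z l l')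
    (hpar : ∀ z l l', W z l l' ≠ 0 → l.parity = l'.parity)
    {ι : Type*} [Fintype ι] (c : Letter r → ι → ℂ) (t : Letter r → ι → Letter r)
    (ht : ∀ l i, (t l i).parity = l.parity) (v : Spacetime × Spacetime)
    (hv : ∀ z l l', fderiv ℝ (fun z => W z l l') z v =
      ∑ i, c l i * W z (t l i) l' + ∑ i, c l' i * W z l (t l' i))
    (z : Spacetime × Spacetime) (w : List (Letter r)) :
    fderiv ℝ (fun z => vev (W z) w) z v = derSum Letter.parity c t 0 w (vev (W z)) := by
  induction hn : w.length using Nat.strong_induction_on generalizing w with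
  | _ n ih =>
    cases w with
    | nil => simp [vev_nil, derSum]
    | cons l w =>
      rw [derSum_vev_cons c t 0 (fun l i _ => by rw [ht, add_zero]) (hpar z)]
      simp only [vev_cons, extSum_eq_sum]
      have hd : ∀ w, Differentiable ℝ fun z => vev (W z) w := fun w =>
        (contDiff_vev hW w).differentiable (by simp)
      have hd' : ∀ l l', Differentiable ℝ fun z => W z l l' := fun l l' =>
        (hW l l').differentiable (by simp)
      have hdk : ∀ k : Fin w.length,
          DifferentiableAt ℝ (fun z => W z l (w.get k) * vev (W z) (w.eraseIdx k)) z :=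
        fun k => (hd' _ _ z).mul (hd _ z)
      rw [fderiv_fun_sum fun k _ => (hdk k).const_mul _, sum_apply]
      refine Finset.sum_congr rfl fun k _ => ?_
      rw [fderiv_const_mul (hdk k), fderiv_fun_mul (hd' _ _ z) (hd _ z)]
      simp only [smul_apply, add_apply, smul_eq_mul]
      rw [hv, ih (w.eraseIdx k).length _ _ rfl]
      · simp only [zero_mul, pow_zero, one_mul]
        ring
      · have := k.2
        rw [List.length_eraseIdx_of_lt this]
        simp at hn
        omega

theorem derSum_map {X Y : Type*} (parX : X → ℕ) (parY : Y → ℕ) (f : X → Y)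
    (hf : ∀ x, parY (f x) = parX x) {ι : Type*} [Fintype ι] (c : X → ι → ℂ) (t : X → ι → X)
    (c' : Y → ι → ℂ) (t' : Y → ι → Y) (d : ℕ) (hc : ∀ x i, c' (f x) i = c x i)
    (ht : ∀ x i, t' (f x) i = f (t x i)) (w : List X) (F : List Y → ℂ) :
    derSum parY c' t' d (w.map f) F = derSum parX c t d w (fun w' => F (w'.map f)) := by
  induction w generalizing F with
  | nil => rfl
  | cons x w ih => simp only [List.map_cons, derSum, ih, hc, ht, hf]

theorem derSum_eq_zero_of_coeff {X : Type*} (par : X → ℕ) {ι : Type*} [Fintype ι] (c : X → ι → ℂ)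
    (t : X → ι → X) (d : ℕ) (w : List X) (hc : ∀ x ∈ w, ∀ i, c x i = 0) (F : List X → ℂ) :
    derSum par c t d w F = 0 := by
  induction w generalizing F with
  | nil => rfl
  | cons x w ih =>
    rw [derSum, ih (fun y hy => hc y (by simp [hy]))]
    simp [hc x (by simp)]

/-! ### Derivatives of normal products -/

/-- The statistics of a jet. -/
def Jet.parity (j : Jet r) : ℕ := j.field.parity

theorem wordParity_eq (w : List (Jet r)) : wordParity w = (w.map Jet.parity).sum := rfl

/-- `∂_μ` on a jet. -/
def Jet.deriv (μ : Fin 4) (j : Jet r) : Jet r := ⟨j.field, μ :: j.der⟩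

/-- The sum over all words obtained by differentiating one factor. -/
def wordDeriv (μ : Fin 4) (w : List (Jet r)) (F : List (Jet r) → ℂ) : ℂ :=
  derSum Jet.parity (fun _ (_ : Unit) => 1) (fun j _ => j.deriv μ) 0 w F

/-- Selects the letters at `x`. -/
def xCoeff : Letter r → Unit → ℂ
  | .atX _, _ => 1
  | _, _ => 0

/-- Selects the letters at `y`. -/
def yCoeff : Letter r → Unit → ℂ
  | .atY _, _ => 1
  | _, _ => 0

/-- Differentiates the jet of a letter. -/
def Letter.deriv (μ : Fin 4) : Letter r → Unit → Letter r
  | .atX j, _ => .atX (j.deriv μ)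
  | .atY j, _ => .atY (j.deriv μ)
  | l, _ => l

theorem Letter.parity_deriv (μ : Fin 4) (l : Letter r) (i : Unit) :
    (l.deriv μ i).parity = l.parity := by cases l <;> rfl

theorem fderiv_const_mul_fst (a : ℂ) {F : Spacetime → ℂ} (hF : ContDiff ℝ (⊤ : ℕ∞) F)
    (z v : Spacetime × Spacetime) :
    fderiv ℝ (fun z : Spacetime × Spacetime => a * F z.1) z v = a * fderiv ℝ F z.1 v.1 := by
  have h1 : HasFDerivAt (fun z : Spacetime × Spacetime => F z.1)
      ((fderiv ℝ F z.1).comp (ContinuousLinearMap.fst ℝ Spacetime Spacetime)) z :=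
    (hF.differentiable (by simp) z.1).hasFDerivAt.comp z hasFDerivAt_fst
  rw [(h1.const_mul a).fderiv]
  simp

theorem fderiv_const_mul_snd (a : ℂ) {F : Spacetime → ℂ} (hF : ContDiff ℝ (⊤ : ℕ∞) F)
    (z v : Spacetime × Spacetime) :
    fderiv ℝ (fun z : Spacetime × Spacetime => a * F z.2) z v = a * fderiv ℝ F z.2 v.2 := by
  have h1 : HasFDerivAt (fun z : Spacetime × Spacetime => F z.2)
      ((fderiv ℝ F z.2).comp (ContinuousLinearMap.snd ℝ Spacetime Spacetime)) z :=
    (hF.differentiable (by simp) z.2).hasFDerivAt.comp z hasFDerivAt_snd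
  rw [(h1.const_mul a).fderiv]
  simp

theorem fderiv_contraction_x {ρ : ℝ → ℝ} (hρ : IntegrableOn ρ (Set.Ioi 0)) (μ : Fin 4)
    (z : Spacetime × Spacetime) (l l' : Letter r) :
    fderiv ℝ (fun z : Spacetime × Spacetime => contraction ρ z.1 z.2 l l') z (basisVec μ, 0) =
      ∑ i, xCoeff l i * contraction ρ z.1 z.2 (l.deriv μ i) l' +
        ∑ i, xCoeff l' i * contraction ρ z.1 z.2 l (l'.deriv μ i) := by
  have hr := fun g => contDiff_smearRight hρ g
  have hl := fun g => contDiff_smearLeft hρ g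
  -- The contractions depending only on `y` lead to directional derivatives in the direction `0`.
  have hr0 : ∀ g x, smearRight ρ (∂_{(0 : Spacetime)} g) x = 0 := fun g x => by
    rw [← fderiv_smearRight hρ, map_zero]
  have hl0 : ∀ g x, smearLeft ρ (∂_{(0 : Spacetime)} g) x = 0 := fun g x => by
    rw [← fderiv_smearLeft hρ, map_zero]
  simp only [Finset.univ_unique, Finset.sum_singleton]
  rcases l with s | j | j <;> rcases l' with s' | k | k <;>
    simp only [xCoeff, Letter.deriv, zero_mul, one_mul, add_zero, zero_add,
      contraction_smeared_atX, contraction_smeared_atY, contraction_atX_smeared,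
      contraction_atY_smeared, contraction_atX_atX, contraction_atX_atY, contraction_atY_atX,
      contraction_atY_atY, fderiv_const_mul_fst _ (hr _), fderiv_const_mul_fst _ (hl _),
      fderiv_const_mul_snd _ (hr _), fderiv_const_mul_snd _ (hl _), hr0, hl0, mul_zero,
      fderiv_smearRight hρ, fderiv_smearLeft hρ, Jet.deriv, testDeriv_cons, fderiv_fun_const,
      Pi.zero_apply, zero_apply]
  simp [contraction]

theorem fderiv_contraction_y {ρ : ℝ → ℝ} (hρ : IntegrableOn ρ (Set.Ioi 0)) (μ : Fin 4)
    (z : Spacetime × Spacetime) (l l' : Letter r) :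
    fderiv ℝ (fun z : Spacetime × Spacetime => contraction ρ z.1 z.2 l l') z (0, basisVec μ) =
      ∑ i, yCoeff l i * contraction ρ z.1 z.2 (l.deriv μ i) l' +
        ∑ i, yCoeff l' i * contraction ρ z.1 z.2 l (l'.deriv μ i) := by
  have hr := fun g => contDiff_smearRight hρ g
  have hl := fun g => contDiff_smearLeft hρ g
  have hr0 : ∀ g x, smearRight ρ (∂_{(0 : Spacetime)} g) x = 0 := fun g x => by
    rw [← fderiv_smearRight hρ, map_zero]
  have hl0 : ∀ g x, smearLeft ρ (∂_{(0 : Spacetime)} g) x = 0 := fun g x => by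
    rw [← fderiv_smearLeft hρ, map_zero]
  simp only [Finset.univ_unique, Finset.sum_singleton]
  rcases l with s | j | j <;> rcases l' with s' | k | k <;>
    simp only [yCoeff, Letter.deriv, zero_mul, one_mul, add_zero, zero_add,
      contraction_smeared_atX, contraction_smeared_atY, contraction_atX_smeared,
      contraction_atY_smeared, contraction_atX_atX, contraction_atX_atY, contraction_atY_atX,
      contraction_atY_atY, fderiv_const_mul_fst _ (hr _), fderiv_const_mul_fst _ (hl _),
      fderiv_const_mul_snd _ (hr _), fderiv_const_mul_snd _ (hl _), hr0, hl0, mul_zero,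
      fderiv_smearRight hρ, fderiv_smearLeft hρ, Jet.deriv, testDeriv_cons, fderiv_fun_const,
      Pi.zero_apply, zero_apply]
  simp [contraction]

/-- The word whose expectation value is a matrix element of a normal product. -/
def fullWord (w : List (Smeared r)) (A B : List (Jet r)) (w' : List (Smeared r)) :
    List (Letter r) :=
  w.map Letter.smeared ++ A.map Letter.atX ++ B.map Letter.atY ++ w'.map Letter.smeared

/-- The matrix elements of normal products between words. -/
def wordElement (ρ : ℝ → ℝ) (A B : List (Jet r)) (z : Spacetime × Spacetime)
    (w w' : List (Smeared r)) : ℂ :=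
  vev (contraction ρ z.1 z.2) (fullWord w A B w')

theorem normalProduct_eq (ρ : ℝ → ℝ) (A B : List (Jet r)) (z : Spacetime × Spacetime)
    (ψ ψ' : State r) :
    normalProduct ρ A B z.1 z.2 ψ ψ' = ∑ w ∈ ψ.support, ∑ w' ∈ ψ'.support,
      (starRingEnd ℂ) (ψ w) * ψ' w' * (adjointSign w * wordElement ρ A B z w.reverse w') := by
  rfl

theorem contDiff_wordElement {ρ : ℝ → ℝ} (hρ : IntegrableOn ρ (Set.Ioi 0)) (A B : List (Jet r))
    (w w' : List (Smeared r)) : ContDiff ℝ (⊤ : ℕ∞) fun z => wordElement ρ A B z w w' :=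
  contDiff_vev (contDiff_contraction hρ) _

theorem contDiff_normalProduct {ρ : ℝ → ℝ} (hρ : IntegrableOn ρ (Set.Ioi 0)) (A B : List (Jet r))
    (ψ ψ' : State r) :
    ContDiff ℝ (⊤ : ℕ∞) fun z : Spacetime × Spacetime => normalProduct ρ A B z.1 z.2 ψ ψ' := by
  simp only [normalProduct_eq]
  exact ContDiff.sum fun w _ => ContDiff.sum fun w' _ => contDiff_const.mul
    (contDiff_const.mul (contDiff_wordElement hρ A B _ _))

theorem fderiv_normalProduct {ρ : ℝ → ℝ} (hρ : IntegrableOn ρ (Set.Ioi 0)) (A B : List (Jet r))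
    (ψ ψ' : State r) (z v : Spacetime × Spacetime) :
    fderiv ℝ (fun z : Spacetime × Spacetime => normalProduct ρ A B z.1 z.2 ψ ψ') z v =
      ∑ w ∈ ψ.support, ∑ w' ∈ ψ'.support, (starRingEnd ℂ) (ψ w) * ψ' w' * (adjointSign w *
        fderiv ℝ (fun z => wordElement ρ A B z w.reverse w') z v) := by
  have hd : ∀ w w', DifferentiableAt ℝ (fun z => wordElement ρ A B z w w') z := fun w w' =>
    (contDiff_wordElement hρ A B w w').differentiable (by simp) z
  simp only [normalProduct_eq]
  rw [fderiv_fun_sum fun w _ => DifferentiableAt.fun_sum fun w' _ =>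
    ((hd _ _).const_mul _).const_mul _, sum_apply]
  refine Finset.sum_congr rfl fun w _ => ?_
  rw [fderiv_fun_sum fun w' _ => ((hd _ _).const_mul _).const_mul _, sum_apply]
  refine Finset.sum_congr rfl fun w' _ => ?_
  rw [fderiv_const_mul ((hd _ _).const_mul _), fderiv_const_mul (hd _ _)]
  simp

/-- Only the letters at `x` depend on `x`, so among the blocks of the full word only `A` is
differentiated. -/
theorem dX_normalProduct {ρ : ℝ → ℝ} (hρ : IntegrableOn ρ (Set.Ioi 0)) (μ : Fin 4)
    (A B : List (Jet r)) (ψ ψ' : State r) (z : Spacetime × Spacetime) :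
    dX μ (fun z => normalProduct ρ A B z.1 z.2 ψ ψ') z =
      wordDeriv μ A (fun A' => normalProduct ρ A' B z.1 z.2 ψ ψ') := by
  rw [dX, fderiv_normalProduct hρ]
  simp only [normalProduct_eq, wordDeriv, derSum_sum, derSum_mul_left]
  refine Finset.sum_congr rfl fun w _ => Finset.sum_congr rfl fun w' _ => ?_
  congr 2
  simp only [wordElement]
  rw [fderiv_vev (contDiff_contraction hρ)
    (fun z => parity_eq_of_contraction_ne_zero ρ z.1 z.2) xCoeff (Letter.deriv μ)
    (Letter.parity_deriv μ) _ (fderiv_contraction_x hρ μ)]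
  simp only [fullWord, derSum_append, zero_mul, pow_zero, one_mul]
  rw [derSum_eq_zero_of_coeff _ _ _ _ (w.reverse.map Letter.smeared) (by simp [xCoeff]),
    derSum_eq_zero_of_coeff _ _ _ _ (B.map Letter.atY) (by simp [xCoeff]),
    derSum_eq_zero_of_coeff _ _ _ _ (w'.map Letter.smeared) (by simp [xCoeff]),
    derSum_map Jet.parity Letter.parity Letter.atX (fun _ => rfl) (fun _ _ => 1)
      (fun j _ => j.deriv μ) xCoeff (Letter.deriv μ) 0 (fun _ _ => rfl) (fun _ _ => rfl)]
  simp

theorem dY_normalProduct {ρ : ℝ → ℝ} (hρ : IntegrableOn ρ (Set.Ioi 0)) (μ : Fin 4)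
    (A B : List (Jet r)) (ψ ψ' : State r) (z : Spacetime × Spacetime) :
    dY μ (fun z => normalProduct ρ A B z.1 z.2 ψ ψ') z =
      wordDeriv μ B (fun B' => normalProduct ρ A B' z.1 z.2 ψ ψ') := by
  rw [dY, fderiv_normalProduct hρ]
  simp only [normalProduct_eq, wordDeriv, derSum_sum, derSum_mul_left]
  refine Finset.sum_congr rfl fun w _ => Finset.sum_congr rfl fun w' _ => ?_
  congr 2
  simp only [wordElement]
  rw [fderiv_vev (contDiff_contraction hρ)
    (fun z => parity_eq_of_contraction_ne_zero ρ z.1 z.2) yCoeff (Letter.deriv μ)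
    (Letter.parity_deriv μ) _ (fderiv_contraction_y hρ μ)]
  simp only [fullWord, derSum_append, zero_mul, pow_zero, one_mul]
  rw [derSum_eq_zero_of_coeff _ _ _ _ (w.reverse.map Letter.smeared) (by simp [yCoeff]),
    derSum_eq_zero_of_coeff _ _ _ _ (A.map Letter.atX) (by simp [yCoeff]),
    derSum_eq_zero_of_coeff _ _ _ _ (w'.map Letter.smeared) (by simp [yCoeff]),
    derSum_map Jet.parity Letter.parity Letter.atY (fun _ => rfl) (fun _ _ => 1)
      (fun j _ => j.deriv μ) yCoeff (Letter.deriv μ) 0 (fun _ _ => rfl) (fun _ _ => rfl)]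
  simp

/-! ### Graded commutativity of normal products -/

theorem normalProduct_congr {ρ : ℝ → ℝ} {A B A' B' : List (Jet r)} {z z' : Spacetime × Spacetime}
    {a : ℂ} (h : ∀ w w', wordElement ρ A B z w w' = a * wordElement ρ A' B' z' w w')
    (ψ ψ' : State r) :
    normalProduct ρ A B z.1 z.2 ψ ψ' = a * normalProduct ρ A' B' z'.1 z'.2 ψ ψ' := by
  simp only [normalProduct_eq, h, Finset.mul_sum]
  exact Finset.sum_congr rfl fun _ _ => Finset.sum_congr rfl fun _ _ => by ring

/-- Factors of one normal product never contract with each other, so the symmetry condition of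
`vev_swap` reads `0 = 0`. -/
theorem normalProduct_swap_left (ρ : ℝ → ℝ) (j k : Jet r) (L R B : List (Jet r))
    (z : Spacetime × Spacetime) (ψ ψ' : State r) :
    normalProduct ρ (L ++ j :: k :: R) B z.1 z.2 ψ ψ' =
      (-1) ^ (j.parity * k.parity) * normalProduct ρ (L ++ k :: j :: R) B z.1 z.2 ψ ψ' := by
  refine normalProduct_congr (fun w w' => ?_) ψ ψ'
  have h := vev_swap (parity_eq_of_contraction_ne_zero ρ z.1 z.2) (j := Letter.atX j)
    (k := Letter.atX k) (by simp [contraction_atX_atX])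
    (w.map Letter.smeared ++ L.map Letter.atX)
    (R.map Letter.atX ++ B.map Letter.atY ++ w'.map Letter.smeared)
  simp only [wordElement, fullWord, List.map_append, List.map_cons]
  simpa [List.append_assoc, Letter.parity, Jet.parity] using h

theorem normalProduct_swap_right (ρ : ℝ → ℝ) (j k : Jet r) (A L R : List (Jet r))
    (z : Spacetime × Spacetime) (ψ ψ' : State r) :
    normalProduct ρ A (L ++ j :: k :: R) z.1 z.2 ψ ψ' =
      (-1) ^ (j.parity * k.parity) * normalProduct ρ A (L ++ k :: j :: R) z.1 z.2 ψ ψ' := by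
  refine normalProduct_congr (fun w w' => ?_) ψ ψ'
  have h := vev_swap (parity_eq_of_contraction_ne_zero ρ z.1 z.2) (j := Letter.atY j)
    (k := Letter.atY k) (by simp [contraction_atY_atY])
    (w.map Letter.smeared ++ A.map Letter.atX ++ L.map Letter.atY)
    (R.map Letter.atY ++ w'.map Letter.smeared)
  simp only [wordElement, fullWord, List.map_append, List.map_cons]
  simpa [List.append_assoc, Letter.parity, Jet.parity] using h

theorem vev_move_block {ρ : ℝ → ℝ} (z : Spacetime × Spacetime) (j : Jet r) (B : List (Jet r))
    (L R : List (Letter r)) :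
    vev (contraction ρ z.1 z.2) (L ++ Letter.atX j :: (B.map Letter.atY ++ R)) =
      (-1) ^ (j.parity * wordParity B) *
        vev (contraction ρ z.1 z.2) (L ++ B.map Letter.atY ++ Letter.atX j :: R) := by
  induction B generalizing L with
  | nil => simp [wordParity]
  | cons k B ih =>
    have h := vev_swap (parity_eq_of_contraction_ne_zero ρ z.1 z.2) (j := Letter.atX j)
      (k := Letter.atY k) (by simp [contraction_atX_atY, contraction_atY_atX]) L
      (B.map Letter.atY ++ R)
    have h2 := ih (L ++ [Letter.atY k])
    simp only [List.append_assoc, List.cons_append, List.nil_append] at h2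
    simp only [List.map_cons, List.cons_append, List.append_assoc]
    rw [h, h2, ← mul_assoc, ← pow_add]
    congr 2
    simp only [wordParity, List.map_cons, List.sum_cons, Letter.parity, Jet.parity]
    ring

theorem vev_swap_blocks {ρ : ℝ → ℝ} (z : Spacetime × Spacetime) (A B : List (Jet r))
    (L R : List (Letter r)) :
    vev (contraction ρ z.1 z.2) (L ++ A.map Letter.atX ++ B.map Letter.atY ++ R) =
      (-1) ^ (wordParity A * wordParity B) *
        vev (contraction ρ z.1 z.2) (L ++ B.map Letter.atY ++ A.map Letter.atX ++ R) := by
  induction A generalizing L with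
  | nil => simp [wordParity]
  | cons j A ih =>
    have h1 := ih (L ++ [Letter.atX j])
    have h2 := vev_move_block (ρ := ρ) z j B L (A.map Letter.atX ++ R)
    simp only [List.append_assoc, List.cons_append, List.nil_append, List.map_cons] at h1 h2 ⊢
    rw [h1, h2, ← mul_assoc, ← pow_add]
    congr 2
    simp only [wordParity, List.map_cons, List.sum_cons, Jet.parity]
    ring

/-- Exchanges the letters at `x` and at `y`. -/
def Letter.exchange : Letter r → Letter r
  | .smeared s => .smeared s
  | .atX j => .atY j
  | .atY j => .atX j

theorem vev_map_exchange (ρ : ℝ → ℝ) (x y : Spacetime) (w : List (Letter r)) :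
    vev (contraction ρ x y) (w.map Letter.exchange) = vev (contraction ρ y x) w := by
  induction hn : w.length using Nat.strong_induction_on generalizing w with
  | _ n ih =>
    cases w with
    | nil => simp [vev_nil]
    | cons l w =>
      have hp : ∀ l : Letter r, l.exchange.parity = l.parity := by rintro (_ | _ | _) <;> rfl
      have hW : ∀ l l' : Letter r, contraction ρ x y l.exchange l'.exchange =
        contraction ρ y x l l' := by rintro (_ | _ | _) (_ | _ | _) <;> rfl
      have hmap : ∀ (w : List (Letter r)) (F : Letter r → List (Letter r) → ℂ),
          extSum Letter.parity (w.map Letter.exchange) F =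
            extSum Letter.parity w (fun y w' => F y.exchange (w'.map Letter.exchange)) := by
        intro w
        induction w with
        | nil => intro F; rfl
        | cons a w ih => intro F; simp only [List.map_cons, extSum, ih, hp]
      rw [List.map_cons, vev_cons, vev_cons, hmap]
      refine extSum_congr _ w fun y w' hw' _ => ?_
      rw [hW, ih w'.length (by simp at hn; omega) w' rfl]

/-- Relabelling the points exchanges the two blocks; moving them past each other costs only the
Fermi sign, since letters at `x` and at `y` do not contract. -/
theorem normalProduct_exchange (ρ : ℝ → ℝ) (A B : List (Jet r)) (z : Spacetime × Spacetime)
    (ψ ψ' : State r) :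
    normalProduct ρ B A z.2 z.1 ψ ψ' =
      (-1) ^ (wordParity A * wordParity B) * normalProduct ρ A B z.1 z.2 ψ ψ' := by
  refine normalProduct_congr (z := z.swap) (z' := z) (fun w w' => ?_) ψ ψ'
  have h := vev_swap_blocks (ρ := ρ) z A B (w.map Letter.smeared) (w'.map Letter.smeared)
  simp only [wordElement, fullWord, Prod.fst_swap, Prod.snd_swap]
  rw [h, ← mul_assoc, ← mul_pow, ← vev_map_exchange]
  simp only [List.map_append, List.map_map]
  simp only [neg_mul, one_mul, neg_neg, one_pow]
  rfl

/-- Jets that differ only in the order of the derivatives give the same normal products. -/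
theorem normalProduct_letter_congr_left (ρ : ℝ → ℝ) {j k : Jet r} (hf : j.field = k.field)
    (hd : ∀ g, testDeriv j.der g = testDeriv k.der g) (L R B : List (Jet r))
    (z : Spacetime × Spacetime) (ψ ψ' : State r) :
    normalProduct ρ (L ++ j :: R) B z.1 z.2 ψ ψ' =
      normalProduct ρ (L ++ k :: R) B z.1 z.2 ψ ψ' := by
  rw [← one_mul (normalProduct ρ (L ++ k :: R) B z.1 z.2 ψ ψ')]
  refine normalProduct_congr (fun w w' => ?_) ψ ψ'
  have h := vev_letter_congr (W := contraction ρ z.1 z.2) (j := Letter.atX j)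
    (k := Letter.atX k) (by simp [Letter.parity, hf])
    (by rintro (s | a | a) <;> simp [contraction_atX_smeared, contraction_atX_atX,
      contraction_atX_atY, hf, hd])
    (by rintro (s | a | a) <;> simp [contraction_smeared_atX, contraction_atX_atX,
      contraction_atY_atX, hf, hd])
    (w.map Letter.smeared ++ L.map Letter.atX)
    (R.map Letter.atX ++ B.map Letter.atY ++ w'.map Letter.smeared)
  simp only [wordElement, fullWord, List.map_append, List.map_cons, one_mul]
  simpa [List.append_assoc] using h

theorem normalProduct_letter_congr_right (ρ : ℝ → ℝ) {j k : Jet r} (hf : j.field = k.field)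
    (hd : ∀ g, testDeriv j.der g = testDeriv k.der g) (A L R : List (Jet r))
    (z : Spacetime × Spacetime) (ψ ψ' : State r) :
    normalProduct ρ A (L ++ j :: R) z.1 z.2 ψ ψ' =
      normalProduct ρ A (L ++ k :: R) z.1 z.2 ψ ψ' := by
  rw [← one_mul (normalProduct ρ A (L ++ k :: R) z.1 z.2 ψ ψ')]
  refine normalProduct_congr (fun w w' => ?_) ψ ψ'
  have h := vev_letter_congr (W := contraction ρ z.1 z.2) (j := Letter.atY j)
    (k := Letter.atY k) (by simp [Letter.parity, hf])
    (by rintro (s | a | a) <;> simp [contraction_atY_smeared, contraction_atY_atX,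
      contraction_atY_atY, hf, hd])
    (by rintro (s | a | a) <;> simp [contraction_smeared_atY, contraction_atY_atY,
      contraction_atX_atY, hf, hd])
    (w.map Letter.smeared ++ A.map Letter.atX ++ L.map Letter.atY)
    (R.map Letter.atY ++ w'.map Letter.smeared)
  simp only [wordElement, fullWord, List.map_append, List.map_cons, one_mul]
  simpa [List.append_assoc] using h

/-! ### The gauge charge and normal products -/

/-- The coefficients in `d_Q φ = ∑ᵢ c(φ,i) ∂ᵢ ψ(φ,i)`. -/
def gaugeCoeff : Field r → Fin 4 → ℂ
  | .v _ μ, i => if i = μ then Complex.I * metric μ else 0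
  | .u _, _ => 0
  | .ut _, _ => -Complex.I

/-- The fields in `d_Q φ = ∑ᵢ c(φ,i) ∂ᵢ ψ(φ,i)`. -/
def gaugeField : Field r → Fin 4 → Field r
  | .v a _, _ => .u a
  | .u a, _ => .u a
  | .ut a, i => .v a i

theorem parity_gaugeField (φ : Field r) (i : Fin 4) (h : gaugeCoeff φ i ≠ 0) :
    (gaugeField φ i).parity ≡ φ.parity + 1 [MOD 2] := by
  cases φ with
  | v a μ => rfl
  | u a => exact absurd rfl h
  | ut a => exact (by decide : 0 ≡ 1 + 1 [MOD 2])

/-- Gauge invariance of the two-point functions. -/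
theorem gaugeCoeff_mul_twoPointCoeff (φ ψ : Field r) (i : Fin 4) :
    gaugeCoeff φ i * twoPointCoeff (gaugeField φ i) ψ =
      (-1) ^ φ.parity * (gaugeCoeff ψ i * twoPointCoeff φ (gaugeField ψ i)) := by
  have hI := Complex.I_sq
  cases φ with
  | v a μ =>
    cases ψ with
    | v b ν => simp [gaugeCoeff, gaugeField, twoPointCoeff]
    | u b => simp [gaugeCoeff, gaugeField, twoPointCoeff]
    | ut b =>
      by_cases hab : a = b <;> by_cases hi : i = μ <;>
        simp [gaugeCoeff, gaugeField, twoPointCoeff, Field.parity, hab, hi, eq_comm]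
      ring
  | u a => cases ψ <;> simp [gaugeCoeff, gaugeField, twoPointCoeff]
  | ut a =>
    cases ψ with
    | v b ν =>
      by_cases hab : a = b <;> by_cases hi : i = ν <;>
        simp [gaugeCoeff, gaugeField, twoPointCoeff, Field.parity, hab, hi]
      ring
    | u b => simp [gaugeCoeff, gaugeField, twoPointCoeff]
    | ut b => simp [gaugeCoeff, gaugeField, twoPointCoeff]

/-- `d_Q` on a jet. -/
def Jet.gauge (j : Jet r) (i : Fin 4) : Jet r := ⟨gaugeField j.field i, i :: j.der⟩

/-- `d_Q` on a word of jets, evaluated by `F`. -/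
def wordGauge (w : List (Jet r)) (F : List (Jet r) → ℂ) : ℂ :=
  derSum Jet.parity (fun j i => gaugeCoeff j.field i) Jet.gauge 1 w F

/-- `d_Q` on a smeared field. -/
def Smeared.gauge (s : Smeared r) (i : Fin 4) : Smeared r :=
  ⟨gaugeField s.field i, ∂_{basisVec i} s.test⟩

/-- `d_Q` on a word of smeared fields, evaluated by `F`. -/
def smearedGauge (w : List (Smeared r)) (F : List (Smeared r) → ℂ) : ℂ :=
  derSum (fun s => s.field.parity) (fun s i => -gaugeCoeff s.field i) Smeared.gauge 1 w F

/-- The coefficients of `d_Q` on letters. -/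
def Letter.gaugeCoeff : Letter r → Fin 4 → ℂ
  | .smeared s, i => -OffShellYM.gaugeCoeff s.field i
  | .atX j, i => OffShellYM.gaugeCoeff j.field i
  | .atY j, i => OffShellYM.gaugeCoeff j.field i

/-- The letters occurring in `d_Q` of a letter. -/
def Letter.gauge : Letter r → Fin 4 → Letter r
  | .smeared s, i => .smeared (s.gauge i)
  | .atX j, i => .atX (j.gauge i)
  | .atY j, i => .atY (j.gauge i)

theorem Letter.parity_gauge (l : Letter r) (i : Fin 4) (h : l.gaugeCoeff i ≠ 0) :
    (l.gauge i).parity ≡ l.parity + 1 [MOD 2] := by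
  cases l with
  | smeared s => exact parity_gaugeField s.field i (by simpa [Letter.gaugeCoeff] using h)
  | atX j => exact parity_gaugeField j.field i h
  | atY j => exact parity_gaugeField j.field i h

theorem integral_shift_lineDerivOp (g g' : 𝓢(Spacetime, ℝ)) (v ξ : Spacetime) :
    ∫ z, ((∂_{v} g : 𝓢(Spacetime, ℝ)) (z + ξ) : ℂ) * (g' z : ℂ) =
      -∫ z, (g (z + ξ) : ℂ) * ((∂_{v} g' : 𝓢(Spacetime, ℝ)) z : ℂ) := by
  have h := SchwartzMap.integral_mul_lineDerivOp_right_eq_neg_left (𝕜 := ℂ) (μ := volume)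
    (translate ξ (complexify g)) (complexify g') v
  rw [lineDerivOp_translate, lineDerivOp_complexify, lineDerivOp_complexify] at h
  simp only [translate_apply, complexify_apply, add_comm ξ] at h
  rw [h, neg_neg]

/-- Integration by parts shifts the derivative between the test functions with a minus sign, which
reduces invariance to the coefficient identity `h`. -/
theorem pairSmeared_gauge (ρ : ℝ → ℝ) (φ ψ φ' ψ' : Field r) (g g' : 𝓢(Spacetime, ℝ)) (v : Spacetime)
    (a b : ℂ) (h : a * twoPointCoeff φ' ψ = b * twoPointCoeff φ ψ') :
    a * pairSmeared ρ ⟨φ', ∂_{v} g⟩ ⟨ψ, g'⟩ + b * pairSmeared ρ ⟨φ, g⟩ ⟨ψ', ∂_{v} g'⟩ = 0 := by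
  simp only [pairSmeared, integral_shift_lineDerivOp]
  rw [offShellPlus_eq, offShell_neg]
  linear_combination (-offShell (fun t => t) ρ (fun ξ => ∫ z, (g (z + ξ) : ℂ) *
    ((∂_{v} g' : 𝓢(Spacetime, ℝ)) z : ℂ))) * h

/-- Gauge invariance of the contractions. -/
theorem contraction_gauge (ρ : ℝ → ℝ) (x y : Spacetime) (l l' : Letter r) :
    ∑ i, l.gaugeCoeff i * contraction ρ x y (l.gauge i) l' +
      (-1) ^ (1 * l.parity) * ∑ i, l'.gaugeCoeff i * contraction ρ x y l (l'.gauge i) = 0 := by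
  rw [Finset.mul_sum, ← Finset.sum_add_distrib, one_mul]
  -- Invariance holds for each derivative index separately. The opposite signs of the coefficients
  -- for smeared fields and for jets account for the transfer of the derivative to the test
  -- function.
  refine Finset.sum_eq_zero fun i _ => ?_
  cases l with
  | smeared s =>
    have hk := fun ψ => gaugeCoeff_mul_twoPointCoeff s.field ψ i
    cases l' with
    | smeared s' =>
      rw [← mul_assoc]
      refine pairSmeared_gauge ρ _ _ _ _ _ _ _ _ _ ?_
      simp only [Letter.gaugeCoeff, Letter.parity]
      linear_combination -hk s'.field
    | atX j =>
      simp only [Letter.gaugeCoeff, Letter.gauge, Smeared.gauge, Jet.gauge, Letter.parity,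
        contraction_smeared_atX, testDeriv_lineDerivOp, testDeriv_cons]
      linear_combination
        -smearRight ρ (∂_{basisVec i} (testDeriv j.der s.test)) x * hk j.field
    | atY j =>
      simp only [Letter.gaugeCoeff, Letter.gauge, Smeared.gauge, Jet.gauge, Letter.parity,
        contraction_smeared_atY, testDeriv_lineDerivOp, testDeriv_cons]
      linear_combination
        -smearRight ρ (∂_{basisVec i} (testDeriv j.der s.test)) y * hk j.field
  | atX j =>
    have hk := fun ψ => gaugeCoeff_mul_twoPointCoeff j.field ψ i
    cases l' with
    | smeared s =>
      simp only [Letter.gaugeCoeff, Letter.gauge, Smeared.gauge, Jet.gauge, Letter.parity,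
        contraction_atX_smeared, testDeriv_lineDerivOp, testDeriv_cons]
      linear_combination
        smearLeft ρ (∂_{basisVec i} (testDeriv j.der s.test)) x * hk s.field
    | atX k => simp [Letter.gauge, contraction_atX_atX]
    | atY k => simp [Letter.gauge, contraction_atX_atY]
  | atY j =>
    have hk := fun ψ => gaugeCoeff_mul_twoPointCoeff j.field ψ i
    cases l' with
    | smeared s =>
      simp only [Letter.gaugeCoeff, Letter.gauge, Smeared.gauge, Jet.gauge, Letter.parity,
        contraction_atY_smeared, testDeriv_lineDerivOp, testDeriv_cons]
      linear_combination
        smearLeft ρ (∂_{basisVec i} (testDeriv j.der s.test)) y * hk s.field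
    | atX k => simp [Letter.gauge, contraction_atY_atX]
    | atY k => simp [Letter.gauge, contraction_atY_atY]

/-- The identity expressing `Q Ω = 0`: the total variation of the expectation value vanishes, split
over bra, `A`, `B` and ket with the graded Leibniz signs. -/
theorem wordElement_gauge (ρ : ℝ → ℝ) (A B : List (Jet r)) (z : Spacetime × Spacetime)
    (w w' : List (Smeared r)) :
    smearedGauge w (fun v => wordElement ρ A B z v w') +
      (-1) ^ (w.map fun s => s.field.parity).sum *
        (wordGauge A (fun A' => wordElement ρ A' B z w w') +
          (-1) ^ wordParity A * (wordGauge B (fun B' => wordElement ρ A B' z w w') +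
            (-1) ^ wordParity B * smearedGauge w' (fun v => wordElement ρ A B z w v))) = 0 := by
  have h := derSum_vev_eq_zero (W := contraction ρ z.1 z.2) Letter.gaugeCoeff Letter.gauge 1
    Letter.parity_gauge (parity_eq_of_contraction_ne_zero ρ z.1 z.2)
    (contraction_gauge ρ z.1 z.2) (fullWord w A B w')
  simp only [fullWord, derSum_append] at h
  have hS : ∀ (w : List (Smeared r)) F, derSum Letter.parity Letter.gaugeCoeff Letter.gauge 1
      (w.map Letter.smeared) F = smearedGauge w fun w' => F (w'.map Letter.smeared) :=
    fun w F => derSum_map _ _ _ (fun _ => rfl) _ _ _ _ _ (fun _ _ => rfl) (fun _ _ => rfl) w F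
  have hX : ∀ (w : List (Jet r)) F, derSum Letter.parity Letter.gaugeCoeff Letter.gauge 1
      (w.map Letter.atX) F = wordGauge w fun w' => F (w'.map Letter.atX) :=
    fun w F => derSum_map _ _ _ (fun _ => rfl) _ _ _ _ _ (fun _ _ => rfl) (fun _ _ => rfl) w F
  have hY : ∀ (w : List (Jet r)) F, derSum Letter.parity Letter.gaugeCoeff Letter.gauge 1
      (w.map Letter.atY) F = wordGauge w fun w' => F (w'.map Letter.atY) :=
    fun w F => derSum_map _ _ _ (fun _ => rfl) _ _ _ _ _ (fun _ _ => rfl) (fun _ _ => rfl) w F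
  rw [hS, hX, hY, hS] at h
  simp only [List.map_append, List.sum_append, List.map_map, one_mul, pow_add] at h
  have e1 : (w.map (Letter.parity ∘ Letter.smeared)).sum =
      (w.map fun s => s.field.parity).sum := rfl
  have e2 : (A.map (Letter.parity ∘ Letter.atX)).sum = wordParity A := rfl
  have e3 : (B.map (Letter.parity ∘ Letter.atY)).sum = wordParity B := rfl
  rw [e1, e2, e3] at h
  simp only [wordElement, fullWord]
  linear_combination h

/-! ### The gauge charge on states -/

theorem sum_single_mul {α : Type*} (a : α) (c : ℂ) (F : α → ℂ) :
    (Finsupp.single a c).sum (fun b e => e * F b) = c * F a :=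
  Finsupp.sum_single_index (zero_mul _)

/-- The minus sign comes from moving the derivative of the field to the test function. -/
theorem chargeOnField_sum (s : Smeared r) (F : Smeared r → ℂ) :
    (chargeOnField s).sum (fun s' c => c * F s') =
      ∑ i, -gaugeCoeff s.field i * F (s.gauge i) := by
  obtain ⟨φ, g⟩ := s
  cases φ with
  | v a μ =>
    rw [chargeOnField, sum_single_mul]
    simp [gaugeCoeff, Smeared.gauge, gaugeField]
  | u a => simp [chargeOnField, gaugeCoeff]
  | ut a =>
    rw [chargeOnField, ← Finsupp.sum_finsetSum_index (by simp) (by intros; ring)]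
    simp only [sum_single_mul]
    simp [gaugeCoeff, Smeared.gauge, gaugeField]

theorem chargeOnField_sum_conj (s : Smeared r) (F : Smeared r → ℂ) :
    (chargeOnField s).sum (fun s' c => (starRingEnd ℂ) c * F s') =
      ∑ i, (starRingEnd ℂ) (-gaugeCoeff s.field i) * F (s.gauge i) := by
  have h1 : ∀ (p : Smeared r →₀ ℂ) (F : Smeared r → ℂ),
      p.sum (fun s' c => (starRingEnd ℂ) c * F s') =
        (starRingEnd ℂ) (p.sum fun s' c => c * (starRingEnd ℂ) (F s')) := by
    intro p F
    simp [Finsupp.sum, map_sum]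
  rw [h1, chargeOnField_sum]
  simp [map_sum]

theorem chargeOnWord_sum (w : List (Smeared r)) (F : List (Smeared r) → ℂ) :
    (chargeOnWord w).sum (fun w' c => c * F w') = smearedGauge w F := by
  induction w generalizing F with
  | nil => simp [chargeOnWord, smearedGauge, derSum]
  | cons s w ih =>
    rw [chargeOnWord, Finsupp.sum_add_index' (by simp) (by intros; ring),
      Finsupp.sum_mapDomain_index (by simp) (by intros; ring), chargeOnField_sum,
      Finsupp.sum_smul_index (by simp)]
    simp only [mul_assoc]
    rw [← Finsupp.mul_sum, Finsupp.sum_mapDomain_index (by simp) (by intros; ring), ih]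
    simp [smearedGauge, derSum]

/-- The sign in `φ† = ± φ`. -/
def fieldSign : Field r → ℂ
  | .v _ _ => 1
  | .u _ => 1
  | .ut _ => -1

theorem adjointSign_cons (s : Smeared r) (w : List (Smeared r)) :
    adjointSign (s :: w) = fieldSign s.field * adjointSign w := by
  obtain ⟨φ, g⟩ := s
  cases φ <;> simp [adjointSign, fieldSign]

theorem conj_metric (μ : Fin 4) : (starRingEnd ℂ) (metric μ) = metric μ := by
  unfold metric; split_ifs <;> simp

/-- In coefficients, this is `(d_Q φ)† = -(-1)^{|φ|} d_Q(φ†)`, a consequence of `Q† = Q`. The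
factors `i` and the convention `ũ† = -ũ` are what make it hold. -/
theorem conj_gaugeCoeff (φ : Field r) (i : Fin 4) :
    (starRingEnd ℂ) (-gaugeCoeff φ i) * fieldSign (gaugeField φ i) =
      -((-1) ^ φ.parity * fieldSign φ * -gaugeCoeff φ i) := by
  cases φ with
  | v a μ =>
    by_cases h : i = μ <;> simp [gaugeCoeff, gaugeField, fieldSign, Field.parity, h, conj_metric]
  | u a => simp [gaugeCoeff]
  | ut a => simp [gaugeCoeff, gaugeField, fieldSign, Field.parity]

/-- Self-adjointness of the charge. -/
theorem chargeOnWord_sum_conj (w : List (Smeared r)) (F : List (Smeared r) → ℂ) :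
    (chargeOnWord w).sum (fun w' c => (starRingEnd ℂ) c * (adjointSign w' * F w'.reverse)) =
      -((-1) ^ (w.map fun s => s.field.parity).sum * adjointSign w *
        smearedGauge w.reverse F) := by
  induction w generalizing F with
  | nil => simp [chargeOnWord, smearedGauge, derSum]
  | cons s w ih =>
    rw [chargeOnWord, Finsupp.sum_add_index' (by simp) (by intros; rw [map_add]; ring),
      Finsupp.sum_mapDomain_index (by simp) (by intros; rw [map_add]; ring),
      chargeOnField_sum_conj (F := fun s' => adjointSign (s' :: w) * F (s' :: w).reverse),
      Finsupp.sum_smul_index (by simp)]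
    simp only [map_mul, mul_assoc]
    rw [← Finsupp.mul_sum, Finsupp.sum_mapDomain_index (by simp) (by intros; rw [map_add]; ring)]
    -- Reversal turns the leading factor `s` into a final one, so the induction hypothesis is used
    -- for the functional that appends `s`.
    have e : ∀ w' : List (Smeared r), adjointSign (s :: w') * F (s :: w').reverse =
        adjointSign w' * (fun v => fieldSign s.field * F (v ++ [s])) w'.reverse := by
      intro w'
      rw [adjointSign_cons, List.reverse_cons]
      ring
    have ih' := ih fun v => fieldSign s.field * F (v ++ [s])
    simp only [← e] at ih'
    rw [ih']
    simp only [smearedGauge, derSum_mul_left, List.reverse_cons, derSum_append, derSum,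
      adjointSign_cons, List.map_cons, List.sum_cons, List.map_reverse, List.sum_reverse, pow_add,
      one_mul, mul_zero, add_zero]
    have hs : ((-1 : ℂ) ^ (w.map fun s => s.field.parity).sum) *
        (-1) ^ (w.map fun s => s.field.parity).sum = 1 := by rw [← mul_pow]; simp
    have hp : (starRingEnd ℂ) ((-1 : ℂ) ^ s.field.parity) = (-1) ^ s.field.parity := by simp
    have e2 : ∑ i, (starRingEnd ℂ) (-gaugeCoeff s.field i) * (fieldSign (s.gauge i).field *
        adjointSign w * F (w.reverse ++ [s.gauge i])) =
        -((-1) ^ s.field.parity * fieldSign s.field * adjointSign w *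
          ∑ i, -gaugeCoeff s.field i * F (w.reverse ++ [s.gauge i])) := by
      rw [Finset.mul_sum, ← Finset.sum_neg_distrib]
      refine Finset.sum_congr rfl fun i _ => ?_
      have := conj_gaugeCoeff s.field i
      rw [show (s.gauge i).field = gaugeField s.field i from rfl]
      linear_combination (adjointSign w * F (w.reverse ++ [s.gauge i])) * this
    rw [e2, hp]
    linear_combination ((-1) ^ s.field.parity * fieldSign s.field * adjointSign w *
          ∑ i, -gaugeCoeff s.field i * F (w.reverse ++ [s.gauge i])) * hs

theorem charge_sum (ψ : State r) (G : List (Smeared r) → ℂ → ℂ) (h0 : ∀ w, G w 0 = 0)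
    (hadd : ∀ w a b, G w (a + b) = G w a + G w b) :
    (charge ψ).sum G = ψ.sum fun w c => (c • chargeOnWord w).sum G := by
  rw [charge, Finsupp.sum_sum_index h0 hadd]

theorem normalProduct_charge_right (ρ : ℝ → ℝ) (A B : List (Jet r)) (z : Spacetime × Spacetime)
    (ψ ψ' : State r) :
    normalProduct ρ A B z.1 z.2 ψ (charge ψ') = ∑ w ∈ ψ.support, ∑ w' ∈ ψ'.support,
      (starRingEnd ℂ) (ψ w) * ψ' w' * (adjointSign w *
        smearedGauge w' fun v => wordElement ρ A B z w.reverse v) := by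
  change ψ.sum (fun w c => (charge ψ').sum fun w' c' => (starRingEnd ℂ) c * c' *
    (adjointSign w * wordElement ρ A B z w.reverse w')) = _
  refine Finset.sum_congr rfl fun w _ => ?_
  simp only
  rw [charge_sum _ _ (by simp) (by intros; ring)]
  refine Finset.sum_congr rfl fun w' _ => ?_
  simp only
  rw [Finsupp.sum_smul_index (by simp), ← chargeOnWord_sum, Finsupp.mul_sum, Finsupp.mul_sum]
  exact Finsupp.sum_congr fun v _ => by ring

theorem normalProduct_charge_left (ρ : ℝ → ℝ) (A B : List (Jet r)) (z : Spacetime × Spacetime)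
    (ψ ψ' : State r) :
    normalProduct ρ A B z.1 z.2 (charge ψ) ψ' = ∑ w ∈ ψ.support, ∑ w' ∈ ψ'.support,
      (starRingEnd ℂ) (ψ w) * ψ' w' * (adjointSign w *
        -((-1) ^ (w.map fun s => s.field.parity).sum *
        smearedGauge w.reverse fun v => wordElement ρ A B z v w')) := by
  change (charge ψ).sum (fun w c => ψ'.sum fun w' c' => (starRingEnd ℂ) c * c' *
    (adjointSign w * wordElement ρ A B z w.reverse w')) = _
  have hadd : ∀ (w : List (Smeared r)) (a b : ℂ),
      (ψ'.sum fun w' c' => (starRingEnd ℂ) (a + b) * c' *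
      (adjointSign w * wordElement ρ A B z w.reverse w')) =
      (ψ'.sum fun w' c' => (starRingEnd ℂ) a * c' *
      (adjointSign w * wordElement ρ A B z w.reverse w')) +
      ψ'.sum fun w' c' => (starRingEnd ℂ) b * c' *
      (adjointSign w * wordElement ρ A B z w.reverse w') := by
    intro w a b
    rw [← Finsupp.sum_add]
    simp only [map_add, add_mul]
  rw [charge_sum _ _ (by simp) hadd]
  refine Finset.sum_congr rfl fun w _ => ?_
  simp only
  rw [Finsupp.sum_smul_index (by simp)]
  rw [Finsupp.sum_comm]
  refine Finset.sum_congr rfl fun w' _ => ?_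
  simp only
  have h := chargeOnWord_sum_conj w fun v => wordElement ρ A B z v w'
  have e : ((chargeOnWord w).sum fun v c => (starRingEnd ℂ) (ψ w * c) * ψ' w' *
      (adjointSign v * wordElement ρ A B z v.reverse w')) = (starRingEnd ℂ) (ψ w) * ψ' w' *
      (chargeOnWord w).sum fun v c => (starRingEnd ℂ) c *
        (adjointSign v * wordElement ρ A B z v.reverse w') := by
    rw [Finsupp.mul_sum]
    exact Finsupp.sum_congr fun v _ => by rw [map_mul]; ring
  rw [e, h]
  ring

/-- The gauge variation of a normal product. -/
theorem normalProduct_gauge (ρ : ℝ → ℝ) (A B : List (Jet r)) (z : Spacetime × Spacetime)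
    (ψ ψ' : State r) :
    normalProduct ρ A B z.1 z.2 (charge ψ) ψ' -
        (-1) ^ (wordParity A + wordParity B) * normalProduct ρ A B z.1 z.2 ψ (charge ψ') =
      wordGauge A (fun A' => normalProduct ρ A' B z.1 z.2 ψ ψ') +
        (-1) ^ wordParity A * wordGauge B (fun B' => normalProduct ρ A B' z.1 z.2 ψ ψ') := by
  rw [normalProduct_charge_left, normalProduct_charge_right]
  simp only [normalProduct_eq, wordGauge, derSum_sum, derSum_mul_left]
  simp only [Finset.mul_sum, ← Finset.sum_add_distrib, ← Finset.sum_sub_distrib]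
  refine Finset.sum_congr rfl fun w _ => Finset.sum_congr rfl fun w' _ => ?_
  have h := wordElement_gauge ρ A B z w.reverse w'
  rw [List.map_reverse, List.sum_reverse] at h
  simp only [wordGauge] at h
  have hs : ((-1 : ℂ) ^ (w.map fun s => s.field.parity).sum) *
      (-1) ^ (w.map fun s => s.field.parity).sum = 1 := by rw [← mul_pow]; simp
  rw [pow_add]
  -- `σ` is the sign picked up by carrying `Q` through the bra; it squares to one, so multiplying
  -- the invariance identity by `-σ` isolates the middle blocks.
  set σ := (-1 : ℂ) ^ (w.map fun s => s.field.parity).sum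
  linear_combination (-((starRingEnd ℂ) (ψ w) * ψ' w' * adjointSign w * σ)) * h +
    ((starRingEnd ℂ) (ψ w) * ψ' w' * adjointSign w *
    (derSum Jet.parity (fun j i => gaugeCoeff j.field i) Jet.gauge 1 A
        (fun A' => wordElement ρ A' B z w.reverse w') +
      (-1) ^ wordParity A * (derSum Jet.parity (fun j i => gaugeCoeff j.field i) Jet.gauge 1 B
        (fun B' => wordElement ρ A B' z w.reverse w') +
        (-1) ^ wordParity B * smearedGauge w' (fun v => wordElement ρ A B z w.reverse v)))) * hs

/-! ### Tree contributions of words -/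

theorem neg_one_pow_mul_self (n : ℕ) : (-1 : ℂ) ^ n * (-1) ^ n = 1 := by
  rw [← mul_pow]; simp

/-- The contribution of the contraction of the factors `j` and `k` to the tree part, `A` and `B`
being the remaining factors. -/
def treeTerm (ρ : ℝ → ℝ) (P : (Spacetime → ℂ) → ℂ) (h : Spacetime × Spacetime → ℂ)
    (ψ ψ' : State r) (j k : Jet r) (A B : List (Jet r)) : ℂ :=
  (-1) ^ (j.parity * wordParity A) * (twoPointCoeff j.field k.field *
    pairDifference P j.der k.der (fun z => h z * normalProduct ρ A B z.1 z.2 ψ ψ'))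

theorem wordParity_eraseIdx (A : List (Jet r)) (m : Fin A.length) :
    wordParity (A.eraseIdx m) = wordParity (A.take m) + wordParity (A.drop (m + 1)) := by
  rw [List.eraseIdx_eq_take_drop_succ]
  simp [wordParity]

/-- `treeOnWords` moves the contracted factor of `A` to the right end, whereas `extSum` moves it to
the left end. The difference is the sign of passing all remaining factors of `A`, which `treeTerm`
carries. -/
theorem treeOnWords_eq (ρ : ℝ → ℝ) (P : (Spacetime → ℂ) → ℂ) (A B : List (Jet r))
    (h : Spacetime × Spacetime → ℂ) (ψ ψ' : State r) :
    treeOnWords ρ P A B h ψ ψ' = extSum Jet.parity A (fun j A' =>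
      extSum Jet.parity B (fun k B' => treeTerm ρ P h ψ ψ' j k A' B')) := by
  simp only [treeOnWords, extSum_eq_sum, Finset.mul_sum]
  refine Finset.sum_congr rfl fun m _ => Finset.sum_congr rfl fun n _ => ?_
  simp only [treeTerm, ← wordParity_eq, wordParity_eraseIdx, mul_add, pow_add]
  have := neg_one_pow_mul_self ((A.get m).parity * wordParity (A.take m))
  simp only [Jet.parity] at this ⊢
  linear_combination (-((-1) ^ ((A.get m).field.parity * wordParity (A.drop (m + 1))) *
    (-1) ^ ((B.get n).field.parity * wordParity (B.take n)) *
      (twoPointCoeff (A.get m).field (B.get n).field *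
      pairDifference P (A.get m).der (B.get n).der
        (fun z => h z * normalProduct ρ (A.eraseIdx m) (B.eraseIdx n) z.1 z.2 ψ ψ')))) * this

section Derivations

variable {X Y ι : Type*} [Fintype ι] (par : X → ℕ) (c : X → ι → ℂ) (t : X → ι → X) (d : ℕ)

theorem derSum_extSum_comm (par' : Y → ℕ) (w : List X) (v : List Y)
    (F : List X → Y → List Y → ℂ) :
    derSum par c t d w (fun w' => extSum par' v (F w')) =
      extSum par' v (fun y v' => derSum par c t d w (fun w' => F w' y v')) := by
  simp only [extSum_eq_sum, derSum_sum, derSum_mul_left]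

theorem isTest_mul_derSum {h : Spacetime × Spacetime → ℂ} (hh : IsTest h) (w : List X)
    {F : List X → Spacetime × Spacetime → ℂ} (hF : ∀ w, ContDiff ℝ (⊤ : ℕ∞) (F w)) :
    IsTest fun z => h z * derSum par c t d w (fun w' => F w' z) := by
  refine hh.mul ?_
  induction w generalizing F with
  | nil => exact contDiff_const
  | cons x w ih =>
    simp only [derSum]
    exact (ContDiff.sum fun i _ => contDiff_const.mul (hF _)).add
      (contDiff_const.mul (ih fun w => hF _))

theorem pairDifference_mul_derSum {τ : ℝ → ℝ} (hτ : Continuous τ) {ρ : ℝ → ℝ}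
    (hρ : IntegrableOn ρ (Set.Ioi 0)) (α β : List (Fin 4)) {h : Spacetime × Spacetime → ℂ}
    (hh : IsTest h) (w : List X) {F : List X → Spacetime × Spacetime → ℂ}
    (hF : ∀ w, ContDiff ℝ (⊤ : ℕ∞) (F w)) :
    pairDifference (offShell τ ρ) α β (fun z => h z * derSum par c t d w (fun w' => F w' z)) =
      derSum par c t d w (fun w' => pairDifference (offShell τ ρ) α β (fun z => h z * F w' z)) := by
  induction w generalizing F with
  | nil => simp [derSum, pairDifference_zero]
  | cons x w ih =>
    have e : (fun z => h z * derSum par c t d (x :: w) (fun w' => F w' z)) =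
        fun z => (∑ i, c x i * (h z * F (t x i :: w) z)) +
          (-1) ^ (d * par x) * (h z * derSum par c t d w (fun w' => F (x :: w') z)) := by
      ext z
      simp only [derSum, mul_add, Finset.mul_sum]
      exact congrArg₂ _ (Finset.sum_congr rfl fun i _ => by ring) (by ring)
    have h1 : ∀ i, IsTest fun z => c x i * (h z * F (t x i :: w) z) :=
      fun i => (hh.mul (hF _)).const_mul _
    have h2 := isTest_mul_derSum par c t d hh w (F := fun w' => F (x :: w')) fun w => hF _
    rw [e, pairDifference_add hτ hρ α β (IsTest.sum _ h1) (h2.const_mul _),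
      pairDifference_sum hτ hρ α β _ h1, pairDifference_const_mul τ ρ α β _ h2,
      ih fun w => hF _, derSum]
    simp only [pairDifference_const_mul τ ρ α β _ (hh.mul (hF _))]

end Derivations

theorem dX_mul {h N : Spacetime × Spacetime → ℂ} (hh : IsTest h)
    (hN : ContDiff ℝ (⊤ : ℕ∞) N) (μ : Fin 4) :
    dX μ (fun z => h z * N z) = fun z => dX μ h z * N z + h z * dX μ N z := by
  ext z
  rw [dX, fderiv_fun_mul (hh.differentiable z) (hN.differentiable (by simp) z)]
  simp [dX]
  ring

theorem dY_mul {h N : Spacetime × Spacetime → ℂ} (hh : IsTest h)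
    (hN : ContDiff ℝ (⊤ : ℕ∞) N) (μ : Fin 4) :
    dY μ (fun z => h z * N z) = fun z => dY μ h z * N z + h z * dY μ N z := by
  ext z
  rw [dY, fderiv_fun_mul (hh.differentiable z) (hN.differentiable (by simp) z)]
  simp [dY]
  ring

section Leibniz

variable {τ ρ : ℝ → ℝ} {h : Spacetime × Spacetime → ℂ}

theorem Jet.parity_deriv (μ : Fin 4) (j : Jet r) (_ : Unit) (_ : (1 : ℂ) ≠ 0) :
    (j.deriv μ).parity ≡ j.parity + 0 [MOD 2] := rfl

/-- Moving the derivative of the contracted leg to the product of test function and normal product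
gives two terms; the one differentiating the normal product cancels the second summand on the left.
-/
theorem treeTerm_deriv_left (hτ : Continuous τ) (hρ : IntegrableOn ρ (Set.Ioi 0)) (hh : IsTest h)
    (ψ ψ' : State r) (μ : Fin 4) (j k : Jet r) (A B : List (Jet r)) :
    treeTerm ρ (offShell τ ρ) h ψ ψ' (j.deriv μ) k A B +
        wordDeriv μ A (fun A' => treeTerm ρ (offShell τ ρ) h ψ ψ' j k A' B) =
      -treeTerm ρ (offShell τ ρ) (dX μ h) ψ ψ' j k A B := by
  have hN := fun A => contDiff_normalProduct hρ A B ψ ψ'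
  have e1 : wordDeriv μ A (fun A' => treeTerm ρ (offShell τ ρ) h ψ ψ' j k A' B) =
      (-1) ^ (j.parity * wordParity A) * (twoPointCoeff j.field k.field *
        wordDeriv μ A fun A' => pairDifference (offShell τ ρ) j.der k.der
          (fun z => h z * normalProduct ρ A' B z.1 z.2 ψ ψ')) := by
    simp only [wordDeriv, ← derSum_mul_left]
    refine derSum_congr _ _ _ _ (Jet.parity_deriv μ) A fun A' _ hp => ?_
    rw [treeTerm, wordParity_eq, neg_one_pow_congr (Nat.ModEq.mul_left _ hp)]
    rfl
  rw [e1, treeTerm, treeTerm, Jet.deriv, pairDifference_cons_left _ _ _ _ (hh.mul (hN A)),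
    dX_mul hh (hN A)]
  simp only [dX_normalProduct hρ, wordDeriv]
  rw [pairDifference_add hτ hρ _ _ ((hh.dX μ).mul (hN A))
    (isTest_mul_derSum _ _ _ _ hh A (F := fun A z => normalProduct ρ A B z.1 z.2 ψ ψ') hN)]
  rw [pairDifference_mul_derSum _ _ _ _ hτ hρ _ _ hh A
    (F := fun A z => normalProduct ρ A B z.1 z.2 ψ ψ') hN]
  simp only [Jet.parity]
  ring

theorem treeTerm_deriv_right (hτ : Continuous τ) (hρ : IntegrableOn ρ (Set.Ioi 0)) (hh : IsTest h)
    (ψ ψ' : State r) (μ : Fin 4) (j k : Jet r) (A B : List (Jet r)) :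
    treeTerm ρ (offShell τ ρ) h ψ ψ' j (k.deriv μ) A B +
        wordDeriv μ B (fun B' => treeTerm ρ (offShell τ ρ) h ψ ψ' j k A B') =
      -treeTerm ρ (offShell τ ρ) (dY μ h) ψ ψ' j k A B := by
  have hN := fun B => contDiff_normalProduct hρ A B ψ ψ'
  simp only [treeTerm, Jet.deriv]
  rw [pairDifference_cons_right _ _ _ _ (hh.mul (hN B)), dY_mul hh (hN B)]
  simp only [dY_normalProduct hρ, wordDeriv]
  rw [pairDifference_add hτ hρ _ _ ((hh.dY μ).mul (hN B))
    (isTest_mul_derSum _ _ _ _ hh B (F := fun B z => normalProduct ρ A B z.1 z.2 ψ ψ') hN)]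
  simp only [derSum_mul_left]
  rw [pairDifference_mul_derSum _ _ _ _ hτ hρ _ _ hh B
    (F := fun B z => normalProduct ρ A B z.1 z.2 ψ ψ') hN]
  ring

/-- The Leibniz rule for `∂/∂x^μ`. -/
theorem wordDeriv_treeOnWords_left (hτ : Continuous τ) (hρ : IntegrableOn ρ (Set.Ioi 0))
    (hh : IsTest h) (ψ ψ' : State r) (μ : Fin 4) (A B : List (Jet r)) :
    wordDeriv μ A (fun A' => treeOnWords ρ (offShell τ ρ) A' B h ψ ψ') =
      -treeOnWords ρ (offShell τ ρ) A B (dX μ h) ψ ψ' := by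
  simp only [wordDeriv, treeOnWords_eq]
  rw [derSum_extSum _ _ _ _ (Jet.parity_deriv μ), neg_eq_neg_one_mul (extSum _ _ _),
    ← extSum_mul_left]
  refine extSum_congr _ A fun j A' _ _ => ?_
  rw [derSum_extSum_comm]
  simp only [Fintype.sum_unique, one_mul, zero_mul, pow_zero]
  rw [← extSum_add, ← extSum_mul_left]
  refine extSum_congr _ B fun k B' _ _ => ?_
  rw [← neg_eq_neg_one_mul, ← treeTerm_deriv_left hτ hρ hh]
  rfl

/-- The Leibniz rule for `∂/∂y^μ`. -/
theorem wordDeriv_treeOnWords_right (hτ : Continuous τ) (hρ : IntegrableOn ρ (Set.Ioi 0))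
    (hh : IsTest h) (ψ ψ' : State r) (μ : Fin 4) (A B : List (Jet r)) :
    wordDeriv μ B (fun B' => treeOnWords ρ (offShell τ ρ) A B' h ψ ψ') =
      -treeOnWords ρ (offShell τ ρ) A B (dY μ h) ψ ψ' := by
  simp only [wordDeriv, treeOnWords_eq]
  rw [derSum_extSum_comm, neg_eq_neg_one_mul (extSum _ _ _), ← extSum_mul_left]
  refine extSum_congr _ A fun j A' _ _ => ?_
  rw [derSum_extSum _ _ _ _ (Jet.parity_deriv μ), ← extSum_mul_left]
  refine extSum_congr _ B fun k B' _ _ => ?_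
  rw [← neg_eq_neg_one_mul, ← treeTerm_deriv_right hτ hρ hh]
  simp only [Fintype.sum_unique, one_mul, zero_mul, pow_zero]
  rfl

/-! ### Gauge variation of tree contributions -/

theorem Jet.parity_gauge (j : Jet r) (i : Fin 4) (h : gaugeCoeff j.field i ≠ 0) :
    (j.gauge i).parity ≡ j.parity + 1 [MOD 2] := parity_gaugeField j.field i h

/-- Only the uncontracted factors vary here. The sign `(-1)^{|j|}` appears because varying `A`
changes its parity, and with it the sign of moving `j` through `A`. -/
theorem treeTerm_gauge (hτ : Continuous τ) (hρ : IntegrableOn ρ (Set.Ioi 0)) (hh : IsTest h)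
    (ψ ψ' : State r) (j k : Jet r) (A B : List (Jet r)) :
    treeTerm ρ (offShell τ ρ) h (charge ψ) ψ' j k A B -
        (-1) ^ (wordParity A + wordParity B) *
          treeTerm ρ (offShell τ ρ) h ψ (charge ψ') j k A B =
      (-1) ^ j.parity * wordGauge A (fun A' => treeTerm ρ (offShell τ ρ) h ψ ψ' j k A' B) +
        (-1) ^ wordParity A *
          wordGauge B (fun B' => treeTerm ρ (offShell τ ρ) h ψ ψ' j k A B') := by
  have hN := fun A B => contDiff_normalProduct hρ A B ψ ψ'
  have e1 : wordGauge A (fun A' => treeTerm ρ (offShell τ ρ) h ψ ψ' j k A' B) =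
      (-1) ^ j.parity * (-1) ^ (j.parity * wordParity A) * (twoPointCoeff j.field k.field *
        wordGauge A fun A' => pairDifference (offShell τ ρ) j.der k.der
          (fun z => h z * normalProduct ρ A' B z.1 z.2 ψ ψ')) := by
    simp only [wordGauge, ← derSum_mul_left]
    refine derSum_congr _ _ _ _ Jet.parity_gauge A fun A' _ hp => ?_
    rw [treeTerm, wordParity_eq, neg_one_pow_congr (Nat.ModEq.mul_left _ hp), ← wordParity_eq,
      mul_add, mul_one, pow_add]
    ring
  have e2 : pairDifference (offShell τ ρ) j.der k.der
        (fun z => h z * normalProduct ρ A B z.1 z.2 (charge ψ) ψ') =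
      (-1) ^ (wordParity A + wordParity B) * pairDifference (offShell τ ρ) j.der k.der
        (fun z => h z * normalProduct ρ A B z.1 z.2 ψ (charge ψ')) +
      (pairDifference (offShell τ ρ) j.der k.der
        (fun z => h z * wordGauge A (fun A' => normalProduct ρ A' B z.1 z.2 ψ ψ')) +
      (-1) ^ wordParity A * pairDifference (offShell τ ρ) j.der k.der
        (fun z => h z * wordGauge B (fun B' => normalProduct ρ A B' z.1 z.2 ψ ψ'))) := by
    have t0 := hh.mul (contDiff_normalProduct hρ A B ψ (charge ψ'))
    have t1 := isTest_mul_derSum Jet.parity (fun j i => gaugeCoeff j.field i) Jet.gauge 1 hh A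
      (F := fun A z => normalProduct ρ A B z.1 z.2 ψ ψ') (hN · B)
    have t2 := isTest_mul_derSum Jet.parity (fun j i => gaugeCoeff j.field i) Jet.gauge 1 hh B
      (F := fun B z => normalProduct ρ A B z.1 z.2 ψ ψ') (hN A)
    simp only [wordGauge]
    rw [← pairDifference_const_mul τ ρ _ _ _ t0, ← pairDifference_const_mul τ ρ _ _ _ t2,
      ← pairDifference_add hτ hρ _ _ t1 (t2.const_mul _),
      ← pairDifference_add hτ hρ _ _ (t0.const_mul _) (t1.add (t2.const_mul _))]
    congr 1
    ext z
    have hg := normalProduct_gauge ρ A B z ψ ψ'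
    simp only [wordGauge] at hg
    linear_combination h z * hg
  rw [e1, treeTerm, e2]
  simp only [treeTerm, wordGauge, derSum_mul_left]
  rw [pairDifference_mul_derSum _ _ _ _ hτ hρ _ _ hh A
      (F := fun A z => normalProduct ρ A B z.1 z.2 ψ ψ') (hN · B),
    pairDifference_mul_derSum _ _ _ _ hτ hρ _ _ hh B
      (F := fun B z => normalProduct ρ A B z.1 z.2 ψ ψ') (hN A)]
  have hs := neg_one_pow_mul_self j.parity
  linear_combination (-((-1) ^ (j.parity * wordParity A) * (twoPointCoeff j.field k.field *
    derSum Jet.parity (fun j i => gaugeCoeff j.field i) Jet.gauge 1 A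
      fun A' => pairDifference (offShell τ ρ) j.der k.der
        (fun z => h z * normalProduct ρ A' B z.1 z.2 ψ ψ')))) * hs

/-- The variation of the contracted pair vanishes. -/
theorem treeTerm_gauge_pair (hρ : IntegrableOn ρ (Set.Ioi 0)) (hh : IsTest h)
    (ψ ψ' : State r) (j k : Jet r) (A B : List (Jet r)) (i : Fin 4) :
    gaugeCoeff j.field i * treeTerm ρ (offShell τ ρ) h ψ ψ' (j.gauge i) k A B +
      (-1) ^ (j.parity + wordParity A) * (gaugeCoeff k.field i *
        treeTerm ρ (offShell τ ρ) h ψ ψ' j (k.gauge i) A B) = 0 := by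
  have hN := hh.mul (contDiff_normalProduct hρ A B ψ ψ')
  have hc := gaugeCoeff_mul_twoPointCoeff j.field k.field i
  simp only [treeTerm]
  have e1 : gaugeCoeff j.field i * ((-1) ^ ((j.gauge i).parity * wordParity A) *
      (twoPointCoeff (j.gauge i).field k.field *
        pairDifference (offShell τ ρ) (j.gauge i).der k.der
          (fun z => h z * normalProduct ρ A B z.1 z.2 ψ ψ'))) =
      (-1) ^ (j.parity * wordParity A) * (-1) ^ wordParity A *
        (gaugeCoeff j.field i * twoPointCoeff (gaugeField j.field i) k.field) *
        pairDifference (offShell τ ρ) (j.gauge i).der k.der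
          (fun z => h z * normalProduct ρ A B z.1 z.2 ψ ψ') := by
    by_cases h0 : gaugeCoeff j.field i = 0
    · simp [h0]
    · rw [neg_one_pow_congr ((j.parity_gauge i h0).mul_right _), add_mul, one_mul, pow_add]
      simp only [Jet.gauge]
      ring
  rw [e1, hc]
  simp only [Jet.gauge]
  -- Each varied leg has one extra `∂_i`, at `x` or at `y`; these act oppositely on a distribution
  -- in `x - y`, while the coefficients agree by invariance of the two-point function.
  rw [pairDifference_cons_left _ _ _ _ hN, pairDifference_cons_right _ _ _ _ hN,
    pairDifference_dX _ _ _ _ _ hN, pow_add]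
  simp only [Jet.parity]
  ring

/-- The gauge variation of the tree part. -/
theorem treeOnWords_gauge (hτ : Continuous τ) (hρ : IntegrableOn ρ (Set.Ioi 0)) (hh : IsTest h)
    (ψ ψ' : State r) (A B : List (Jet r)) :
    treeOnWords ρ (offShell τ ρ) A B h (charge ψ) ψ' -
        (-1) ^ (wordParity A + wordParity B) *
          treeOnWords ρ (offShell τ ρ) A B h ψ (charge ψ') =
      wordGauge A (fun A' => treeOnWords ρ (offShell τ ρ) A' B h ψ ψ') +
        (-1) ^ wordParity A *
          wordGauge B (fun B' => treeOnWords ρ (offShell τ ρ) A B' h ψ ψ') := by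
  simp only [wordGauge, treeOnWords_eq]
  rw [derSum_extSum _ _ _ _ Jet.parity_gauge, derSum_extSum_comm, sub_eq_add_neg,
    neg_eq_neg_one_mul]
  simp only [← extSum_mul_left, ← extSum_add]
  refine extSum_congr _ A fun j A' _ hA => ?_
  rw [derSum_extSum _ _ _ _ Jet.parity_gauge, derSum_extSum_comm]
  simp only [← extSum_mul_left, ← extSum_sum, ← extSum_add]
  refine extSum_congr _ B fun k B' _ hB => ?_
  rw [← wordParity_eq, ← wordParity_eq] at hA hB
  -- The variations of the contracted legs add up to zero, so only those of the remaining factors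
  -- are left to match.
  have hsum := Finset.sum_eq_zero fun i (_ : i ∈ Finset.univ) =>
    treeTerm_gauge_pair (τ := τ) hρ hh ψ ψ' j k A' B' i
  rw [Finset.sum_add_distrib, ← Finset.mul_sum] at hsum
  have hg := treeTerm_gauge hτ hρ hh ψ ψ' j k A' B'
  simp only [wordGauge] at hg
  -- When `j` and `k` do not contract their parities may differ, but then only the terms with a
  -- varied leg survive, and `hsum` disposes of them. Otherwise the parities agree and the signs
  -- combine.
  by_cases h0 : twoPointCoeff j.field k.field = 0
  · have hz : ∀ (ψ ψ' : State r) A B, treeTerm ρ (offShell τ ρ) h ψ ψ' j k A B = 0 := by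
      simp [treeTerm, h0]
    simp only [hz, derSum_zero]
    rw [← hA]
    linear_combination -hsum
  · have hp : j.parity = k.parity := parity_eq_of_twoPointCoeff_ne_zero h0
    have hs := neg_one_pow_mul_self k.parity
    rw [← hA, ← hB]
    simp only [one_mul]
    rw [hp, pow_add] at hsum
    rw [hp] at hg ⊢
    simp only [pow_add] at hg hsum ⊢
    linear_combination hg - hsum - (-1) ^ wordParity A' * ((-1) ^ wordParity B' *
      treeTerm ρ (offShell τ ρ) h ψ (charge ψ') j k A' B' +
      derSum Jet.parity (fun j i => gaugeCoeff j.field i) Jet.gauge 1 B'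
        (fun B' => treeTerm ρ (offShell τ ρ) h ψ ψ' j k A' B')) * hs

end Leibniz

/-! ### Graded commutativity of tree contributions -/

theorem treeTerm_congr {τ ρ : ℝ → ℝ} (hρ : IntegrableOn ρ (Set.Ioi 0))
    {h : Spacetime × Spacetime → ℂ} (hh : IsTest h) (ψ ψ' : State r) (j k : Jet r)
    {A B A' B' : List (Jet r)} {a : ℂ} (hp : wordParity A = wordParity A')
    (hN : ∀ z : Spacetime × Spacetime, normalProduct ρ A B z.1 z.2 ψ ψ' =
      a * normalProduct ρ A' B' z.1 z.2 ψ ψ') :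
    treeTerm ρ (offShell τ ρ) h ψ ψ' j k A B =
      a * treeTerm ρ (offShell τ ρ) h ψ ψ' j k A' B' := by
  have e : (fun z => h z * normalProduct ρ A B z.1 z.2 ψ ψ') =
      fun z => a * (h z * normalProduct ρ A' B' z.1 z.2 ψ ψ') := by
    ext z; rw [hN]; ring
  rw [treeTerm, treeTerm, e, hp,
    pairDifference_const_mul τ ρ _ _ _ (hh.mul (contDiff_normalProduct hρ A' B' ψ ψ'))]
  ring

theorem testDeriv_pair_comm (φ : List (Fin 4)) (μ ν : Fin 4) (g : 𝓢(Spacetime, ℝ)) :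
    testDeriv (μ :: ν :: φ) g = testDeriv (ν :: μ :: φ) g := by
  simp only [testDeriv_cons]
  exact lineDerivOp_comm _ _ _

theorem pairDifference_pair_comm_left (P : (Spacetime → ℂ) → ℂ) (μ ν : Fin 4)
    (α β : List (Fin 4)) {H : Spacetime × Spacetime → ℂ} (hH : IsTest H) :
    pairDifference P (μ :: ν :: α) β H = pairDifference P (ν :: μ :: α) β H := by
  rw [pairDifference_cons_left _ _ _ _ hH, pairDifference_cons_left _ _ _ _ (hH.dX μ),
    pairDifference_cons_left _ _ _ _ hH, pairDifference_cons_left _ _ _ _ (hH.dX ν),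
    dX_dX_comm hH]

theorem pairDifference_pair_comm_right (P : (Spacetime → ℂ) → ℂ) (μ ν : Fin 4)
    (α β : List (Fin 4)) {H : Spacetime × Spacetime → ℂ} (hH : IsTest H) :
    pairDifference P α (μ :: ν :: β) H = pairDifference P α (ν :: μ :: β) H := by
  rw [pairDifference_cons_right _ _ _ _ hH, pairDifference_cons_right _ _ _ _ (hH.dY μ),
    pairDifference_cons_right _ _ _ _ hH, pairDifference_cons_right _ _ _ _ (hH.dY ν),
    dY_dY_comm hH]

/-- Functionals on words that respect the relations between Wick monomials: graded commutativity
of the factors and commutativity of derivatives. -/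
structure IsWickFunctional (Φ : List (Jet r) → ℂ) : Prop where
  swap : ∀ j k L R, Φ (L ++ j :: k :: R) = (-1) ^ (j.parity * k.parity) * Φ (L ++ k :: j :: R)
  comm : ∀ φ μ ν α L R,
    Φ (L ++ ⟨φ, μ :: ν :: α⟩ :: R) = Φ (L ++ ⟨φ, ν :: μ :: α⟩ :: R)

theorem wordParity_swap (j k : Jet r) (L R : List (Jet r)) :
    wordParity (L ++ j :: k :: R) = wordParity (L ++ k :: j :: R) := by
  simp [wordParity]
  ring

theorem wordParity_letter (φ : Field r) (α β : List (Fin 4)) (L R : List (Jet r)) :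
    wordParity (L ++ ⟨φ, α⟩ :: R) = wordParity (L ++ ⟨φ, β⟩ :: R) := by
  simp [wordParity]

/-- `WickPoly` is free on words and does not identify reordered monomials, so `d_Q T^I = i ∂_μ
T^{Iμ} + S^I` makes sense only after evaluation by a functional respecting these relations. Tree
contraction with the other argument fixed is such a functional. -/
theorem isWickFunctional_treeOnWords_left {τ ρ : ℝ → ℝ} (hρ : IntegrableOn ρ (Set.Ioi 0))
    {h : Spacetime × Spacetime → ℂ} (hh : IsTest h) (ψ ψ' : State r) (B : List (Jet r)) :
    IsWickFunctional fun A => treeOnWords ρ (offShell τ ρ) A B h ψ ψ' where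
  swap j k L R := by
    simp only [treeOnWords_eq]
    refine extSum_swap _ j k L R _ fun y L' R' _ => ?_
    rw [← extSum_mul_left]
    exact extSum_congr _ B fun k' B' _ _ => treeTerm_congr hρ hh ψ ψ' _ _ (wordParity_swap _ _ _ _)
      fun z => normalProduct_swap_left ρ j k L' R' B' z ψ ψ'
  comm φ μ ν α L R := by
    simp only [treeOnWords_eq]
    refine extSum_letter_congr _ _ _ (by rfl) L R _ (fun A' => ?_) fun y L' R' _ => ?_
    · refine extSum_congr _ B fun k' B' _ _ => ?_
      simp only [treeTerm]
      rw [pairDifference_pair_comm_left _ _ _ _ _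
        (hh.mul (contDiff_normalProduct hρ A' B' ψ ψ'))]
      rfl
    · refine extSum_congr _ B fun k' B' _ _ => ?_
      refine (treeTerm_congr (a := 1) hρ hh ψ ψ' y k'
        (wordParity_letter φ (μ :: ν :: α) (ν :: μ :: α) L' R') fun z => ?_).trans (one_mul _)
      rw [one_mul]
      exact normalProduct_letter_congr_left ρ (j := ⟨φ, μ :: ν :: α⟩) (k := ⟨φ, ν :: μ :: α⟩) rfl
        (testDeriv_pair_comm α μ ν) L' R' B' z ψ ψ'

theorem isWickFunctional_treeOnWords_right {τ ρ : ℝ → ℝ} (hρ : IntegrableOn ρ (Set.Ioi 0))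
    {h : Spacetime × Spacetime → ℂ} (hh : IsTest h) (ψ ψ' : State r) (A : List (Jet r)) :
    IsWickFunctional fun B => treeOnWords ρ (offShell τ ρ) A B h ψ ψ' where
  swap j k L R := by
    simp only [treeOnWords_eq]
    rw [← extSum_mul_left]
    refine extSum_congr _ A fun j' A' _ _ => ?_
    exact extSum_swap _ j k L R _ fun y L' R' _ => treeTerm_congr hρ hh ψ ψ' _ _ rfl
      fun z => normalProduct_swap_right ρ j k A' L' R' z ψ ψ'
  comm φ μ ν α L R := by
    simp only [treeOnWords_eq]
    refine extSum_congr _ A fun j' A' _ _ => ?_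
    refine extSum_letter_congr _ _ _ (by rfl) L R _ (fun B' => ?_) fun y L' R' _ => ?_
    · simp only [treeTerm]
      rw [pairDifference_pair_comm_right _ _ _ _ _
        (hh.mul (contDiff_normalProduct hρ A' B' ψ ψ'))]
    · refine (treeTerm_congr (a := 1) hρ hh ψ ψ' j' y rfl fun z => ?_).trans (one_mul _)
      have e := normalProduct_letter_congr_right ρ (j := ⟨φ, μ :: ν :: α⟩)
        (k := ⟨φ, ν :: μ :: α⟩) rfl (testDeriv_pair_comm α μ ν) A' L' R' z ψ ψ'
      exact e.trans (one_mul _).symm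

/-! ### The chronological product -/

theorem twoPointCoeff_symm (φ ψ : Field r) :
    twoPointCoeff ψ φ = (-1) ^ (φ.parity * ψ.parity) * twoPointCoeff φ ψ := by
  cases φ <;> cases ψ <;> simp only [twoPointCoeff, Field.parity] <;>
    (try split_ifs) <;> simp_all

theorem tsupport_mul_avoids {K : Set Spacetime} {h N : Spacetime × Spacetime → ℂ}
    (hK : ∀ z ∈ tsupport h, z.1 - z.2 ∉ K) :
    ∀ z ∈ tsupport (fun z => h z * N z), z.1 - z.2 ∉ K :=
  fun z hz => hK z (tsupport_mul_subset_left hz)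

theorem treeOnWords_feynman_eq_plus {ρ : ℝ → ℝ} (hρ : IntegrableOn ρ (Set.Ioi 0))
    {h : Spacetime × Spacetime → ℂ} (hh : IsTest h)
    (hK : ∀ z ∈ tsupport h, z.1 - z.2 ∉ backwardCone) (ψ ψ' : State r) (A B : List (Jet r)) :
    treeOnWords ρ (offShellFeynman ρ) A B h ψ ψ' =
      treeOnWords ρ (offShellPlus ρ) A B h ψ ψ' := by
  simp only [treeOnWords_eq]
  refine extSum_congr _ A fun j A' _ _ => extSum_congr _ B fun k B' _ _ => ?_
  rw [treeTerm, treeTerm, pairDifference_feynman_eq_plus ρ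
    (hh.mul (contDiff_normalProduct hρ A' B' ψ ψ')) (tsupport_mul_avoids hK)]

theorem extSum_comm {X Y : Type*} (par : X → ℕ) (par' : Y → ℕ) (w : List X) (v : List Y)
    (F : X → List X → Y → List Y → ℂ) :
    extSum par w (fun x w' => extSum par' v (F x w')) =
      extSum par' v (fun y v' => extSum par w (fun x w' => F x w' y v')) := by
  simp only [extSum_eq_sum, Finset.mul_sum]
  rw [Finset.sum_comm]
  exact Finset.sum_congr rfl fun _ _ => Finset.sum_congr rfl fun _ _ => by ring

/-- Three signs enter: the symmetry of the two-point coefficient, the exchange of the remaining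
blocks, and the passage of each contracted factor. Since the contracted factors have equal parity,
they combine to the sign of exchanging `A` and `B`. -/
theorem treeOnWords_feynman_eq_rev {ρ : ℝ → ℝ} (hρ : IntegrableOn ρ (Set.Ioi 0))
    {h : Spacetime × Spacetime → ℂ} (hh : IsTest h)
    (hK : ∀ z ∈ tsupport h, z.1 - z.2 ∉ forwardCone) (ψ ψ' : State r) (A B : List (Jet r)) :
    treeOnWords ρ (offShellFeynman ρ) A B h ψ ψ' = (-1) ^ (wordParity A * wordParity B) *
      treeOnWords ρ (offShellPlus ρ) B A (fun z => h z.swap) ψ ψ' := by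
  simp only [treeOnWords_eq]
  rw [extSum_comm _ _ B A, ← extSum_mul_left]
  refine extSum_congr _ A fun j A' _ hA => ?_
  rw [← extSum_mul_left]
  refine extSum_congr _ B fun k B' _ hB => ?_
  rw [← wordParity_eq, ← wordParity_eq] at hA hB
  have hN := hh.mul (contDiff_normalProduct hρ A' B' ψ ψ')
  rw [treeTerm, treeTerm, pairDifference_feynman_eq_swap ρ hN (tsupport_mul_avoids hK)]
  have e : (fun z : Spacetime × Spacetime => h z.swap *
      normalProduct ρ B' A' z.1 z.2 ψ ψ') = fun z => (-1) ^ (wordParity A' * wordParity B') *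
        (h z.swap * normalProduct ρ A' B' z.swap.1 z.swap.2 ψ ψ') := by
    ext z
    have := normalProduct_exchange ρ A' B' z.swap ψ ψ'
    simp only [Prod.fst_swap, Prod.snd_swap] at this ⊢
    rw [this]
    ring
  rw [e, offShellPlus_eq, pairDifference_const_mul _ _ _ _ _ hN.comp_swap,
    twoPointCoeff_symm j.field k.field]
  by_cases h0 : twoPointCoeff j.field k.field = 0
  · simp [h0]
  have hp : j.parity = k.parity := parity_eq_of_twoPointCoeff_ne_zero h0
  have hjk : j.field.parity * k.field.parity = k.parity * k.parity := by
    rw [← hp]; exact congrArg (j.parity * ·) hp.symm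
  rw [hjk, ← hA, ← hB, hp]
  have s1 := neg_one_pow_mul_self (k.parity * k.parity)
  have s2 := neg_one_pow_mul_self (k.parity * wordParity B')
  have s3 := neg_one_pow_mul_self (wordParity A' * wordParity B')
  have s : (-1 : ℂ) ^ ((k.parity + wordParity A') * (k.parity + wordParity B')) =
      (-1) ^ (k.parity * k.parity) * (-1) ^ (k.parity * wordParity B') *
        (-1) ^ (k.parity * wordParity A') * (-1) ^ (wordParity A' * wordParity B') := by
    rw [← pow_add, ← pow_add, ← pow_add]
    congr 1
    ring
  rw [s]
  set a := (-1 : ℂ) ^ (k.parity * k.parity)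
  set b := (-1 : ℂ) ^ (k.parity * wordParity B')
  set c := (-1 : ℂ) ^ (wordParity A' * wordParity B')
  have s4 : a * a * (b * b) * (c * c) = 1 := by rw [s1, s2, s3]; ring
  linear_combination (-((-1) ^ (k.parity * wordParity A') * twoPointCoeff j.field k.field *
    pairDifference (offShell (fun t => t) ρ) k.der j.der (fun z : Spacetime × Spacetime =>
      h z.swap * normalProduct ρ A' B' z.swap.1 z.swap.2 ψ ψ'))) * s4

/-- `Adv` and `Ret` are defined by subtracting the two operator orderings, which makes the algebraic
conditions automatic. The supports are the content: off `V⁺` the Feynman contraction is the reversed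
product up to sign, and off `V⁻` it is the product itself. -/
theorem isTreeChronologicalProduct_feynman {ρ : ℝ → ℝ} (hρ : IntegrableOn ρ (Set.Ioi 0))
    {p q : ℕ} {A B : WickPoly r} (hA : HasParity A p) (hB : HasParity B q) :
    IsTreeChronologicalProduct ρ p q A B (treeContract ρ (offShellFeynman ρ) A B) := by
  refine ⟨fun h ψ ψ' => treeContract ρ (offShellFeynman ρ) A B h ψ ψ' -
      (-1) ^ (p * q) * treeProductRev ρ A B h ψ ψ',
    fun h ψ ψ' => treeContract ρ (offShellFeynman ρ) A B h ψ ψ' - treeProduct ρ A B h ψ ψ',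
    ?_, ?_, ?_, ?_, ?_⟩
  · intro h _
    ext ψ ψ'
    simp only [treeCommutator]
    ring
  · intro h hh hK
    ext ψ ψ'
    simp only [Pi.zero_apply, sub_eq_zero, treeProductRev, treeProduct, treeContract]
    rw [Finsupp.sum_comm, Finsupp.mul_sum]
    refine Finset.sum_congr rfl fun w' hw' => ?_
    simp only
    rw [Finsupp.mul_sum]
    refine Finset.sum_congr rfl fun w hw => ?_
    simp only
    rw [treeOnWords_feynman_eq_rev hρ hh hK,
      neg_one_pow_congr ((hA w hw).mul (hB w' hw'))]
    ring
  · intro h hh hK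
    ext ψ ψ'
    simp only [Pi.zero_apply, sub_eq_zero, treeProduct, treeContract,
      treeOnWords_feynman_eq_plus hρ hh hK]
  · intro h _
    ext ψ ψ'
    ring
  · intro h _
    ext ψ ψ'
    ring

/-! ### Gauge variation of the interaction polynomials -/

/-- The linear extension of a functional on words to Wick polynomials. -/
def evalPoly (Φ : List (Jet r) → ℂ) : WickPoly r →ₗ[ℂ] ℂ := Finsupp.linearCombination ℂ Φ

theorem evalPoly_single (Φ : List (Jet r) → ℂ) (w : List (Jet r)) (c : ℂ) :
    evalPoly Φ (Finsupp.single w c) = c * Φ w := by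
  simp [evalPoly, Finsupp.linearCombination_single]

theorem evalPoly_apply (Φ : List (Jet r) → ℂ) (A : WickPoly r) :
    evalPoly Φ A = A.sum fun w c => c * Φ w := by
  simp [evalPoly, Finsupp.linearCombination_apply]

theorem metric_eq (μ : Fin 4) : metric μ = 1 ∨ metric μ = -1 := by
  unfold metric; split_ifs <;> simp

section Words

variable (Φ : List (Jet r) → ℂ) (a b c : Fin r) (α β γ : List (Fin 4)) (μ ν lam : Fin 4)

theorem wordGauge_vvv : wordGauge [⟨.v a μ, α⟩, ⟨.v b ν, β⟩, ⟨.v c lam, γ⟩] Φ =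
    Complex.I * metric μ * Φ [⟨.u a, μ :: α⟩, ⟨.v b ν, β⟩, ⟨.v c lam, γ⟩] +
    Complex.I * metric ν * Φ [⟨.v a μ, α⟩, ⟨.u b, ν :: β⟩, ⟨.v c lam, γ⟩] +
    Complex.I * metric lam * Φ [⟨.v a μ, α⟩, ⟨.v b ν, β⟩, ⟨.u c, lam :: γ⟩] := by
  simp [wordGauge, derSum, gaugeCoeff, Jet.gauge, gaugeField, Jet.parity, Field.parity]
  ring

theorem wordGauge_uvv : wordGauge [⟨.u a, α⟩, ⟨.v b ν, β⟩, ⟨.v c lam, γ⟩] Φ =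
    -(Complex.I * metric ν * Φ [⟨.u a, α⟩, ⟨.u b, ν :: β⟩, ⟨.v c lam, γ⟩]) -
    Complex.I * metric lam * Φ [⟨.u a, α⟩, ⟨.v b ν, β⟩, ⟨.u c, lam :: γ⟩] := by
  simp [wordGauge, derSum, gaugeCoeff, Jet.gauge, gaugeField, Jet.parity, Field.parity]
  ring

theorem wordGauge_uuv : wordGauge [⟨.u a, α⟩, ⟨.u b, β⟩, ⟨.v c lam, γ⟩] Φ =
    Complex.I * metric lam * Φ [⟨.u a, α⟩, ⟨.u b, β⟩, ⟨.u c, lam :: γ⟩] := by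
  simp [wordGauge, derSum, gaugeCoeff, Jet.gauge, gaugeField, Jet.parity, Field.parity]

theorem wordGauge_uvut : wordGauge [⟨.u a, α⟩, ⟨.v b ν, β⟩, ⟨.ut c, γ⟩] Φ =
    -(Complex.I * metric ν * Φ [⟨.u a, α⟩, ⟨.u b, ν :: β⟩, ⟨.ut c, γ⟩]) +
    Complex.I * ∑ i, Φ [⟨.u a, α⟩, ⟨.v b ν, β⟩, ⟨.v c i, i :: γ⟩] := by
  simp [wordGauge, derSum, gaugeCoeff, Jet.gauge, gaugeField, Jet.parity, Field.parity,
    Finset.mul_sum, add_comm]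

theorem wordGauge_uuut : wordGauge [⟨.u a, α⟩, ⟨.u b, β⟩, ⟨.ut c, γ⟩] Φ =
    -(Complex.I * ∑ i, Φ [⟨.u a, α⟩, ⟨.u b, β⟩, ⟨.v c i, i :: γ⟩]) := by
  simp [wordGauge, derSum, gaugeCoeff, Jet.gauge, gaugeField, Jet.parity, Field.parity,
    Finset.mul_sum]

theorem wordDeriv_triple (i j k : Jet r) : wordDeriv μ [i, j, k] Φ =
    Φ [⟨i.field, μ :: i.der⟩, j, k] + Φ [i, ⟨j.field, μ :: j.der⟩, k] +
      Φ [i, j, ⟨k.field, μ :: k.der⟩] := by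
  simp [wordDeriv, derSum, Jet.deriv]
  ring

end Words

/-! ### Sums against antisymmetric structure constants -/

theorem sum_structure_eq_zero_left {f : Fin r → Fin r → Fin r → ℂ}
    (hf : TotallyAntisymmetric f) {G : Fin r → Fin r → Fin r → ℂ}
    (hG : ∀ a b c, G b a c = G a b c) : ∑ a, ∑ b, ∑ c, f a b c * G a b c = 0 := by
  have : ∑ a, ∑ b, ∑ c, f a b c * G a b c = -∑ a, ∑ b, ∑ c, f a b c * G a b c := by
    conv_lhs => rw [Finset.sum_comm]
    simp only [← Finset.sum_neg_distrib]
    refine Finset.sum_congr rfl fun a _ => Finset.sum_congr rfl fun b _ =>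
      Finset.sum_congr rfl fun c _ => ?_
    rw [hf.1 a b c, hG]
    ring
  exact self_eq_neg.mp this

theorem sum_structure_eq_zero_right {f : Fin r → Fin r → Fin r → ℂ}
    (hf : TotallyAntisymmetric f) {G : Fin r → Fin r → Fin r → ℂ}
    (hG : ∀ a b c, G a c b = G a b c) : ∑ a, ∑ b, ∑ c, f a b c * G a b c = 0 := by
  refine Finset.sum_eq_zero fun a _ => ?_
  have : ∑ b, ∑ c, f a b c * G a b c = -∑ b, ∑ c, f a b c * G a b c := by
    conv_lhs => rw [Finset.sum_comm]
    simp only [← Finset.sum_neg_distrib]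
    refine Finset.sum_congr rfl fun b _ => Finset.sum_congr rfl fun c _ => ?_
    rw [hf.2 a b c, hG]
    ring
  exact self_eq_neg.mp this

/-- The first-order identities hold only modulo terms symmetric in two colour indices. With these
supplied as `G` and `G'`, it remains to check an equality for each triple of indices. -/
theorem sum_structure_congr {f : Fin r → Fin r → Fin r → ℂ}
    (hf : TotallyAntisymmetric f) {E E' G G' : Fin r → Fin r → Fin r → ℂ}
    (hG : ∀ a b c, G b a c = G a b c) (hG' : ∀ a b c, G' a c b = G' a b c)
    (h : ∀ a b c, E a b c = E' a b c + G a b c + G' a b c) :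
    ∑ a, ∑ b, ∑ c, f a b c * E a b c = ∑ a, ∑ b, ∑ c, f a b c * E' a b c := by
  simp only [h, mul_add, Finset.sum_add_distrib]
  rw [sum_structure_eq_zero_left hf hG, sum_structure_eq_zero_right hf hG', add_zero, add_zero]

theorem sum_structure_combine {f : Fin r → Fin r → Fin r → ℂ} {X X' : Fin 4 → Fin r → Fin r →
    Fin r → ℂ} {Y Y' : Fin r → Fin r → Fin r → ℂ} (m : ℂ)
    (hX : ∀ μ a b c, X' μ a b c = f a b c * X μ a b c)
    (hY : ∀ a b c, Y' a b c = f a b c * Y a b c) :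
    m * ∑ μ, ∑ a, ∑ b, ∑ c, X' μ a b c + ∑ a, ∑ b, ∑ c, Y' a b c =
      ∑ a, ∑ b, ∑ c, f a b c * (m * ∑ μ, X μ a b c + Y a b c) := by
  have e : ∑ μ, ∑ a, ∑ b, ∑ c, X' μ a b c = ∑ a, ∑ b, ∑ c, ∑ μ, X' μ a b c := by
    rw [Finset.sum_comm]
    refine Finset.sum_congr rfl fun a _ => ?_
    rw [Finset.sum_comm]
    exact Finset.sum_congr rfl fun b _ => Finset.sum_comm
  rw [e]
  simp only [Finset.mul_sum, ← Finset.sum_add_distrib, hX, hY]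
  refine Finset.sum_congr rfl fun a _ => Finset.sum_congr rfl fun b _ =>
    Finset.sum_congr rfl fun c _ => ?_
  rw [mul_add, Finset.mul_sum]
  exact congrArg (· + _) (Finset.sum_congr rfl fun _ _ => by ring)

theorem metric_zero : metric 0 = 1 := rfl

theorem metric_one : metric 1 = -1 := rfl

theorem metric_two : metric 2 = -1 := rfl

theorem metric_three : metric 3 = -1 := rfl

namespace IsWickFunctional

variable {Φ : List (Jet r) → ℂ}

theorem swap_fst (hΦ : IsWickFunctional Φ) (j k l : Jet r) :
    Φ [j, k, l] = (-1) ^ (j.parity * k.parity) * Φ [k, j, l] :=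
  hΦ.swap j k [] [l]

theorem swap_snd (hΦ : IsWickFunctional Φ) (j k l : Jet r) :
    Φ [j, k, l] = (-1) ^ (k.parity * l.parity) * Φ [j, l, k] :=
  hΦ.swap k l [j] []

theorem comm_trd (hΦ : IsWickFunctional Φ) (j k : Jet r) (φ : Field r) (μ ν : Fin 4) :
    Φ [j, k, ⟨φ, [μ, ν]⟩] = Φ [j, k, ⟨φ, [ν, μ]⟩] := hΦ.comm φ μ ν [] [j, k] []

end IsWickFunctional

/-- `d_Q T = i ∂_μ T^μ + S`. -/
theorem gauge_lagrangian {f : Fin r → Fin r → Fin r → ℂ} (hf : TotallyAntisymmetric f)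
    {Φ : List (Jet r) → ℂ} (hΦ : IsWickFunctional Φ) :
    evalPoly (fun w => wordGauge w Φ) (lagrangian f) =
      Complex.I * ∑ μ, evalPoly (fun w => wordDeriv μ w Φ) (lagrangian1 f μ) +
        evalPoly Φ (offShellS f []) := by
  simp only [lagrangian, lagrangian1, offShellS, timesFieldStrength, timesBox, map_sum, map_add,
    map_sub, map_smul, evalPoly_single, smul_eq_mul, List.cons_append, List.nil_append,
    wordGauge_vvv, wordGauge_uvut, wordDeriv_triple]
  -- The values of `Φ` on the types of monomials that occur are given names, and the other orderings
  -- are reduced to them by graded commutativity; what remains is polynomial arithmetic in these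
  -- atoms.
  obtain ⟨X, hX⟩ : ∃ X : Fin r → Fin r → Fin r → Fin 4 → Fin 4 → ℂ, ∀ a b c μ ν,
      Φ [⟨.u a, [μ]⟩, ⟨.v b ν, []⟩, ⟨.v c μ, [ν]⟩] = X a b c μ ν := ⟨_, fun _ _ _ _ _ => rfl⟩
  obtain ⟨X', hX'⟩ : ∃ X : Fin r → Fin r → Fin r → Fin 4 → Fin 4 → ℂ, ∀ a b c μ ν,
      Φ [⟨.u a, [μ]⟩, ⟨.v b ν, []⟩, ⟨.v c ν, [μ]⟩] = X a b c μ ν := ⟨_, fun _ _ _ _ _ => rfl⟩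
  obtain ⟨Y, hY⟩ : ∃ X : Fin r → Fin r → Fin r → Fin 4 → Fin 4 → ℂ, ∀ a b c μ ν,
      Φ [⟨.u a, []⟩, ⟨.v b ν, [μ]⟩, ⟨.v c μ, [ν]⟩] = X a b c μ ν := ⟨_, fun _ _ _ _ _ => rfl⟩
  obtain ⟨Y', hY'⟩ : ∃ X : Fin r → Fin r → Fin r → Fin 4 → Fin 4 → ℂ, ∀ a b c μ ν,
      Φ [⟨.u a, []⟩, ⟨.v b ν, [μ]⟩, ⟨.v c ν, [μ]⟩] = X a b c μ ν := ⟨_, fun _ _ _ _ _ => rfl⟩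
  obtain ⟨Z, hZ⟩ : ∃ X : Fin r → Fin r → Fin r → Fin 4 → ℂ, ∀ a b c μ,
      Φ [⟨.u a, []⟩, ⟨.u b, [μ]⟩, ⟨.ut c, [μ]⟩] = X a b c μ := ⟨_, fun _ _ _ _ => rfl⟩
  have hX₂ : ∀ a b c μ ν, Φ [⟨.v a μ, []⟩, ⟨.u b, [ν]⟩, ⟨.v c ν, [μ]⟩] = X b a c ν μ := by
    intro a b c μ ν
    rw [hΦ.swap_fst, hX]
    simp [Jet.parity, Field.parity]
  have hX'₂ : ∀ a b c μ ν, Φ [⟨.v a μ, []⟩, ⟨.u b, [ν]⟩, ⟨.v c μ, [ν]⟩] = X' b a c ν μ := by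
    intro a b c μ ν
    rw [hΦ.swap_fst, hX']
    simp [Jet.parity, Field.parity]
  have hZ₂ : ∀ a b c μ, Φ [⟨.u a, [μ]⟩, ⟨.u b, []⟩, ⟨.ut c, [μ]⟩] = -Z b a c μ := by
    intro a b c μ
    rw [hΦ.swap_fst, hZ]
    simp [Jet.parity, Field.parity]
  have hYs : ∀ a b c μ ν, Y a c b μ ν = Y a b c ν μ := by
    intro a b c μ ν
    rw [← hY, ← hY, hΦ.swap_snd]
    simp [Jet.parity, Field.parity]
  have hY's : ∀ a b c μ ν, Y' a c b μ ν = Y' a b c μ ν := by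
    intro a b c μ ν
    rw [← hY', ← hY', hΦ.swap_snd]
    simp [Jet.parity, Field.parity]
  -- `d_Q F^{μν}` is the curl of a gradient and drops out once the derivatives of `u` commute.
  have hP : ∀ a b c μ ν, Φ [⟨.v a μ, []⟩, ⟨.v b ν, []⟩, ⟨.u c, [ν, μ]⟩] =
      Φ [⟨.v a μ, []⟩, ⟨.v b ν, []⟩, ⟨.u c, [μ, ν]⟩] := fun a b c μ ν => hΦ.comm_trd _ _ _ _ _
  simp only [hX, hX', hY, hY', hZ, hX₂, hX'₂, hZ₂, hP]
  rw [sum_structure_combine Complex.I (fun _ _ _ _ => rfl) fun _ _ _ =>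
    (mul_assoc _ _ _).trans (mul_left_comm _ _ _)]
  -- `G` collects the `∂u v ∂v` and `u ∂u ∂ũ` discrepancies, symmetric in `a, b`; `G'` the `u ∂v ∂v`
  -- terms, symmetric in `b, c` after interchanging the summed Lorentz indices.
  refine sum_structure_congr hf
    (G := fun a b c => -(Complex.I / 2) * ((∑ μ, ∑ ν, (X a b c μ ν + X b a c μ ν -
      metric μ * metric ν * (X' a b c μ ν + X' b a c μ ν))) +
      ∑ μ, metric μ * (Z a b c μ + Z b a c μ)))
    (G' := fun a b c => -Complex.I * ((∑ μ, ∑ ν, Y a b c μ ν) -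
      ∑ μ, ∑ ν, metric μ * metric ν * Y' a b c μ ν))
    (fun a b c => ?_) (fun a b c => ?_) fun a b c => ?_
  · simp only [add_comm]
  · simp only [hYs a b c, hY's a b c]
    rw [Finset.sum_comm]
  · simp only [Fin.sum_univ_four, metric_zero, metric_one, metric_two, metric_three]
    ring

/-- `d_Q T^μ = i ∂_ν T^{μν} + S^μ`. -/
theorem gauge_lagrangian1 {f : Fin r → Fin r → Fin r → ℂ} (hf : TotallyAntisymmetric f)
    {Φ : List (Jet r) → ℂ} (hΦ : IsWickFunctional Φ) (μ : Fin 4) :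
    evalPoly (fun w => wordGauge w Φ) (lagrangian1 f μ) =
      Complex.I * ∑ ν, evalPoly (fun w => wordDeriv ν w Φ) (lagrangian2 f μ ν) +
        evalPoly Φ (offShellS f [μ]) := by
  simp only [lagrangian1, lagrangian2, offShellS, timesFieldStrength, timesBox, map_sum,
    map_sub, map_smul, evalPoly_single, smul_eq_mul, List.cons_append, List.nil_append,
    wordGauge_uvv, wordGauge_uuut, wordDeriv_triple]
  obtain ⟨X, hX⟩ : ∃ X : Fin r → Fin r → Fin r → Fin 4 → ℂ, ∀ a b c ν,
      Φ [⟨.u a, []⟩, ⟨.u b, [ν]⟩, ⟨.v c μ, [ν]⟩] = X a b c ν := ⟨_, fun _ _ _ _ => rfl⟩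
  obtain ⟨X', hX'⟩ : ∃ X : Fin r → Fin r → Fin r → Fin 4 → ℂ, ∀ a b c ν,
      Φ [⟨.u a, []⟩, ⟨.u b, [ν]⟩, ⟨.v c ν, [μ]⟩] = X a b c ν := ⟨_, fun _ _ _ _ => rfl⟩
  have hX₂ : ∀ a b c ν, Φ [⟨.u a, [ν]⟩, ⟨.u b, []⟩, ⟨.v c μ, [ν]⟩] = -X b a c ν := by
    intro a b c ν
    rw [hΦ.swap_fst, hX]
    simp [Jet.parity, Field.parity]
  have hX'₂ : ∀ a b c ν, Φ [⟨.u a, [ν]⟩, ⟨.u b, []⟩, ⟨.v c ν, [μ]⟩] = -X' b a c ν := by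
    intro a b c ν
    rw [hΦ.swap_fst, hX']
    simp [Jet.parity, Field.parity]
  have hP : ∀ a b c ν, Φ [⟨.u a, []⟩, ⟨.v b ν, []⟩, ⟨.u c, [ν, μ]⟩] =
      Φ [⟨.u a, []⟩, ⟨.v b ν, []⟩, ⟨.u c, [μ, ν]⟩] := fun a b c ν => hΦ.comm_trd _ _ _ _ _
  simp only [hX, hX', hX₂, hX'₂, hP]
  rw [sum_structure_combine (f := f) Complex.I
    (fun _ _ _ _ => (mul_assoc _ _ _).trans (mul_left_comm _ _ _)) fun _ _ _ =>
      (mul_assoc _ _ _).trans (mul_left_comm _ _ _)]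
  -- All discrepancies are of the type `u ∂u ∂v` symmetrised in `a, b`, so no term symmetric in `b,
  -- c` is needed.
  refine sum_structure_congr hf
    (G := fun a b c => -(Complex.I / 2) * ∑ ν, (metric ν * (X a b c ν + X b a c ν) -
      metric μ * (X' a b c ν + X' b a c ν)))
    (G' := fun _ _ _ => 0) (fun a b c => ?_) (fun a b c => rfl) fun a b c => ?_
  · simp only [add_comm]
  -- The index `μ` is free here; only its sign matters, since the square of the metric entry must
  -- reduce to one.
  · rcases metric_eq μ with h | h <;>
    · simp only [h, Fin.sum_univ_four, metric_zero, metric_one, metric_two, metric_three]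
      ring

/-- `d_Q T^{μν} = 0`. -/
theorem gauge_lagrangian2 (f : Fin r → Fin r → Fin r → ℂ)
    {Φ : List (Jet r) → ℂ} (hΦ : IsWickFunctional Φ) (μ ν : Fin 4) :
    evalPoly (fun w => wordGauge w Φ) (lagrangian2 f μ ν) = 0 := by
  simp only [lagrangian2, timesFieldStrength, map_sum, map_sub, map_smul, evalPoly_single,
    smul_eq_mul, List.cons_append, List.nil_append, wordGauge_uuv]
  refine Finset.sum_eq_zero fun a _ => Finset.sum_eq_zero fun b _ =>
    Finset.sum_eq_zero fun c _ => ?_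
  rw [hΦ.comm_trd _ _ _ μ ν]
  ring

/-- `d_Q T^I = i ∂_μ T^{Iμ} + S^I`. -/
theorem gauge_lagrangianT {f : Fin r → Fin r → Fin r → ℂ} (hf : TotallyAntisymmetric f)
    {Φ : List (Jet r) → ℂ} (hΦ : IsWickFunctional Φ) (I : List (Fin 4)) :
    evalPoly (fun w => wordGauge w Φ) (lagrangianT f I) =
      Complex.I * ∑ μ, evalPoly (fun w => wordDeriv μ w Φ) (lagrangianT f (I ++ [μ])) +
        evalPoly Φ (offShellS f I) := by
  match I with
  | [] => exact gauge_lagrangian hf hΦ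
  | [μ] => exact gauge_lagrangian1 hf hΦ μ
  | [μ, ν] =>
    simp only [List.cons_append, List.nil_append, lagrangianT, offShellS, map_zero]
    rw [gauge_lagrangian2 f hΦ]
    simp
  | _ :: _ :: _ :: _ => simp [lagrangianT, offShellS]

theorem hasParity_iff (A : WickPoly r) (p : ℕ) :
    HasParity A p ↔ A ∈ Finsupp.supported ℂ ℂ {w : List (Jet r) | wordParity w ≡ p [MOD 2]} := by
  rw [Finsupp.mem_supported]
  rfl

/-- Every monomial of `T^I` has ghost number `|I|`, counting `u` as `1` and `ũ` as `-1`. -/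
theorem hasParity_lagrangianT (f : Fin r → Fin r → Fin r → ℂ) (I : List (Fin 4)) :
    HasParity (lagrangianT f I) I.length := by
  rw [hasParity_iff]
  match I with
  | [] =>
    simp only [lagrangianT, lagrangian, timesFieldStrength]
    refine Submodule.sum_mem _ fun a _ => Submodule.sum_mem _ fun b _ => Submodule.sum_mem _
      fun c _ => Submodule.smul_mem _ _ (Submodule.add_mem _ (Submodule.sum_mem _ fun μ _ =>
        Submodule.sum_mem _ fun ν _ => Submodule.smul_mem _ _ (Submodule.sub_mem _ ?_ ?_))
        (Submodule.sum_mem _ fun μ _ => ?_)) <;>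
      refine Finsupp.single_mem_supported _ _ ?_ <;>
      simp [wordParity, Field.parity, Nat.ModEq]
  | [μ] =>
    simp only [lagrangianT, lagrangian1, timesFieldStrength]
    refine Submodule.sum_mem _ fun a _ => Submodule.sum_mem _ fun b _ => Submodule.sum_mem _
      fun c _ => Submodule.smul_mem _ _ (Submodule.sub_mem _ (Submodule.sum_mem _ fun ν _ =>
        Submodule.smul_mem _ _ (Submodule.sub_mem _ ?_ ?_)) ?_) <;>
      refine Finsupp.single_mem_supported _ _ ?_ <;>
      simp [wordParity, Field.parity, Nat.ModEq]
  | [μ, ν] =>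
    simp only [lagrangianT, lagrangian2, timesFieldStrength]
    refine Submodule.sum_mem _ fun a _ => Submodule.sum_mem _ fun b _ => Submodule.sum_mem _
      fun c _ => Submodule.smul_mem _ _ (Submodule.sub_mem _ ?_ ?_) <;>
      refine Finsupp.single_mem_supported _ _ ?_ <;>
      simp [wordParity, Field.parity, Nat.ModEq]
  | _ :: _ :: _ :: _ => exact zero_mem _

/-! ### The gauge identity -/

theorem treeContract_eq_evalPoly (ρ : ℝ → ℝ) (P : (Spacetime → ℂ) → ℂ) (A B : WickPoly r)
    (h : Spacetime × Spacetime → ℂ) (ψ ψ' : State r) :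
    treeContract ρ P A B h ψ ψ' =
      evalPoly (fun w => evalPoly (fun w' => treeOnWords ρ P w w' h ψ ψ') B) A := by
  simp only [treeContract, evalPoly_apply, Finsupp.mul_sum, mul_assoc]

theorem evalPoly_comm (F : List (Jet r) → List (Jet r) → ℂ) (A B : WickPoly r) :
    evalPoly (fun w => evalPoly (fun w' => F w w') B) A =
      evalPoly (fun w' => evalPoly (fun w => F w w') A) B := by
  simp only [evalPoly_apply, Finsupp.mul_sum]
  rw [Finsupp.sum_comm]
  exact Finsupp.sum_congr fun w' _ => Finsupp.sum_congr fun w _ => by ring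

theorem evalPoly_congr {A : WickPoly r} {F G : List (Jet r) → ℂ}
    (h : ∀ w ∈ A.support, F w = G w) : evalPoly F A = evalPoly G A := by
  rw [evalPoly_apply, evalPoly_apply]
  exact Finsupp.sum_congr fun w hw => by rw [h w hw]

theorem evalPoly_fun_add (F G : List (Jet r) → ℂ) (A : WickPoly r) :
    evalPoly (fun w => F w + G w) A = evalPoly F A + evalPoly G A := by
  simp only [evalPoly_apply, mul_add, Finsupp.sum_add]

theorem evalPoly_fun_mul (a : ℂ) (F : List (Jet r) → ℂ) (A : WickPoly r) :
    evalPoly (fun w => a * F w) A = a * evalPoly F A := by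
  simp only [evalPoly_apply, Finsupp.mul_sum]
  exact Finsupp.sum_congr fun w _ => by ring

theorem evalPoly_fun_neg (F : List (Jet r) → ℂ) (A : WickPoly r) :
    evalPoly (fun w => -F w) A = -evalPoly F A := by
  simpa using evalPoly_fun_mul (-1) F A

theorem evalPoly_fun_sum {ι : Type*} (s : Finset ι) (F : ι → List (Jet r) → ℂ) (A : WickPoly r) :
    evalPoly (fun w => ∑ i ∈ s, F i w) A = ∑ i ∈ s, evalPoly (F i) A := by
  simp only [evalPoly_apply, Finset.mul_sum, Finsupp.sum]
  rw [Finset.sum_comm]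

/-- The gauge identity for tree products with an arbitrary off-shell propagator. -/
theorem gaugeComm_treeContract {f : Fin r → Fin r → Fin r → ℂ} (hf : TotallyAntisymmetric f)
    {τ ρ : ℝ → ℝ} (hτ : Continuous τ) (hρ : IntegrableOn ρ (Set.Ioi 0)) (I J : List (Fin 4))
    {h : Spacetime × Spacetime → ℂ} (hh : IsTest h) (ψ ψ' : State r) :
    gaugeComm (I.length + J.length)
        (treeContract ρ (offShell τ ρ) (lagrangianT f I) (lagrangianT f J)) h ψ ψ' =
      Complex.I * ∑ μ, distDX μ
          (treeContract ρ (offShell τ ρ) (lagrangianT f (I ++ [μ])) (lagrangianT f J)) h ψ ψ' +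
        Complex.I * (-1) ^ I.length * ∑ μ, distDY μ
          (treeContract ρ (offShell τ ρ) (lagrangianT f I) (lagrangianT f (J ++ [μ]))) h ψ ψ' +
        treeContract ρ (offShell τ ρ) (offShellS f I) (lagrangianT f J) h ψ ψ' +
        (-1) ^ I.length *
          treeContract ρ (offShell τ ρ) (lagrangianT f I) (offShellS f J) h ψ ψ' := by
  set T : List (Jet r) → List (Jet r) → ℂ :=
    fun w w' => treeOnWords ρ (offShell τ ρ) w w' h ψ ψ'
  have hX : ∀ μ A B, distDX μ (treeContract ρ (offShell τ ρ) A B) h ψ ψ' =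
      evalPoly (fun w' => evalPoly (fun w => wordDeriv μ w (T · w')) A) B := by
    intro μ A B
    rw [evalPoly_comm]
    simp only [T, wordDeriv_treeOnWords_left hτ hρ hh, evalPoly_fun_neg]
    rw [← treeContract_eq_evalPoly]
    rfl
  have hY : ∀ μ A B, distDY μ (treeContract ρ (offShell τ ρ) A B) h ψ ψ' =
      evalPoly (fun w => evalPoly (fun w' => wordDeriv μ w' (T w)) B) A := by
    intro μ A B
    simp only [T, wordDeriv_treeOnWords_right hτ hρ hh, evalPoly_fun_neg]
    rw [← treeContract_eq_evalPoly]
    rfl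
  -- `treeOnWords_gauge` is applied monomial by monomial; parity homogeneity replaces the parities
  -- of the words by `|I|` and `|J|`, so the signs leave the sums.
  have hL : gaugeComm (I.length + J.length)
      (treeContract ρ (offShell τ ρ) (lagrangianT f I) (lagrangianT f J)) h ψ ψ' =
      evalPoly (fun w' => evalPoly (fun w => wordGauge w (T · w')) (lagrangianT f I))
          (lagrangianT f J) +
        (-1) ^ I.length * evalPoly (fun w => evalPoly (fun w' => wordGauge w' (T w))
          (lagrangianT f J)) (lagrangianT f I) := by
    rw [evalPoly_comm, ← evalPoly_fun_mul, ← evalPoly_fun_add, gaugeComm,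
      treeContract_eq_evalPoly, treeContract_eq_evalPoly, sub_eq_add_neg, ← neg_mul,
      ← evalPoly_fun_mul, ← evalPoly_fun_add]
    refine evalPoly_congr fun w hw => ?_
    rw [← evalPoly_fun_mul, ← evalPoly_fun_add, ← evalPoly_fun_mul, ← evalPoly_fun_add]
    refine evalPoly_congr fun w' hw' => ?_
    have e := treeOnWords_gauge hτ hρ hh ψ ψ' w w'
    have p := hasParity_lagrangianT f I w hw
    rw [neg_one_pow_congr (p.add (hasParity_lagrangianT f J w' hw')), neg_one_pow_congr p] at e
    rw [← e]
    ring
  -- With the monomial at one point fixed, the tree contraction is a Wick functional of the other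
  -- argument, so the first-order identity applies at `x` and at `y` separately.
  have hTX := fun w' => gauge_lagrangianT hf
    (isWickFunctional_treeOnWords_left (τ := τ) hρ hh ψ ψ' w') I
  have hTY := fun w => gauge_lagrangianT hf
    (isWickFunctional_treeOnWords_right (τ := τ) hρ hh ψ ψ' w) J
  simp only [hL, hX, hY, T, hTX, hTY, evalPoly_fun_add, evalPoly_fun_mul, evalPoly_fun_sum,
    treeContract_eq_evalPoly]
  rw [evalPoly_comm (A := offShellS f I)]
  ring

end OffShellYM

end

theorem mainTheorem2 (r : ℕ) (f : Fin r → Fin r → Fin r → ℂ)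
    (hf : OffShellYM.TotallyAntisymmetric f)
    (ρ : ℝ → ℝ) (hρ : MeasureTheory.IntegrableOn ρ (Set.Ioi 0)) :
    ∃ T : OffShellYM.WickPoly r → OffShellYM.WickPoly r → OffShellYM.OpDist r,
      -- the propagator `D^off` is replaced by the Feynman propagator `D^{F,off}`
      (∀ A B, T A B = OffShellYM.treeContract ρ (OffShellYM.offShellFeynman ρ) A B) ∧
      -- the result is a chronological product
      (∀ (p q : ℕ) (A B : OffShellYM.WickPoly r),
        OffShellYM.HasParity A p → OffShellYM.HasParity B q →
          OffShellYM.IsTreeChronologicalProduct ρ p q A B (T A B)) ∧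
      -- the gauge identity
      ∀ I J : List (Fin 4),
        OffShellYM.DistEq
          (OffShellYM.gaugeComm (I.length + J.length)
            (T (OffShellYM.lagrangianT f I) (OffShellYM.lagrangianT f J)))
          (fun h ψ ψ' =>
            Complex.I * ∑ μ : Fin 4, OffShellYM.distDX μ
              (T (OffShellYM.lagrangianT f (I ++ [μ])) (OffShellYM.lagrangianT f J)) h ψ ψ' +
            Complex.I * (-1) ^ I.length * ∑ μ : Fin 4, OffShellYM.distDY μ
              (T (OffShellYM.lagrangianT f I) (OffShellYM.lagrangianT f (J ++ [μ]))) h ψ ψ' +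
            T (OffShellYM.offShellS f I) (OffShellYM.lagrangianT f J) h ψ ψ' +
            (-1) ^ I.length *
              T (OffShellYM.lagrangianT f I) (OffShellYM.offShellS f J) h ψ ψ') := by
  refine ⟨OffShellYM.treeContract ρ (OffShellYM.offShellFeynman ρ), fun _ _ => rfl,
    fun p q A B hA hB => OffShellYM.isTreeChronologicalProduct_feynman hρ hA hB,
    fun I J h hh => ?_⟩
  ext ψ ψ'
  -- For the gauge identity, the Feynman propagator is just the case `τ(t) = |t|`, of which only
  -- continuity is used.
  rw [OffShellYM.offShellFeynman_eq]
  exact OffShellYM.gaugeComm_treeContract hf continuous_abs hρ I J hh ψ ψ'
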